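/- Let $d\ge 2$. An instance of the linearization problem $\textsc{LinSPP}_d$ consists of a finite digraph $G=(V,A)$ with $m$ arcs, vertices $s\ne t$ such that every arc lies on a simple directed $s$-$t$-path, and interaction costs $q_d\colon\{B\subseteq A: |B|\le d\}\to\mathbb{R}$. The task is to find a cost function $c\colon A\to\mathbb{R}$ with $$\sum_{B\subseteq P,\ |B|\le d} q_d(B)=\sum_{a\in P} c(a)\qquad\text{for every simple directed } s\text{-}t\text{-path } P,$$ or to decide that no such $c$ exists. Theorem. There is a single algorithm which, for all $d\ge 2$ and all instances in which $G$ is acyclic, solves $\textsc{LinSPP}_d$ (it decides whether a linearizing cost function exists and outputs one if so) in $O(d^2m^d)$ time, with an absolute implied constant (for $m=0$ the bound is read as $O(1)$). Consequently, for every fixed $d$ its running time is linear in the number $\sum_{k=0}^{d}\binom{m}{k}$ of input coefficients, and for the quadratic shortest path problem ($d=2$) it is $O(m^2)$ (again read as $O(1)$ for $m=0$). Time is measured as the number of steps on a random access machine with unit-cost operations: addition, subtraction and comparison of real numbers, and arithmetic and comparison on machine words whose values are bounded by a fixed power of the instance size $|V|+m+d+\sum_{k=0}^{d}\binom{m}{k}$.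 The input consists of $|V|,m,s,t,d$, the list of arcs, and the array of the values $q_d(B)$, ordered by $|B|$ and then colexicographically. -/

import Mathlib

namespace LinSPP

/-- An instance `(G, s, t, d, q)` of the linearization problem for the order-`d` shortest path
problem: a finite digraph with vertices `0, …, n - 1` and arcs `0, …, m - 1`, a source `s`, a sink
`t ≠ s`, an order `d ≥ 2`, and a real interaction cost for every set of at most `d` arcs.
Parallel arcs are permitted. -/
structure Instance where
  n : ℕ
  m : ℕ
  tail : Fin m → Fin n
  head : Fin m → Fin n
  s : Fin n
  t : Fin n
  s_ne_t : s ≠ t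
  d : ℕ
  two_le_d : 2 ≤ d
  q : {B : Finset (Fin m) // B.card ≤ d} → ℝ

namespace Instance

variable (I : Instance)

/-- The list of arcs `P` is a directed walk from `u` to `v`. -/
def IsWalk : Fin I.n → Fin I.n → List (Fin I.m) → Prop
  | u, v, [] => u = v
  | u, v, a :: P => I.tail a = u ∧ IsWalk (I.head a) v P

/-- `P ∈ 𝒫_{st}`: the list of arcs `P` is a directed `s`-`t`-path visiting no vertex twice. -/
def IsPath (P : List (Fin I.m)) : Prop :=
  I.IsWalk I.s I.t P ∧ (I.s :: P.map I.head).Nodup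

/-- There is no directed cycle: every closed walk is trivial. -/
def Acyclic : Prop := ∀ v P, I.IsWalk v v P → P = []

/-- `G` is `𝒫_{st}`-covered: every arc is traversed by some simple `s`-`t`-path. -/
def Covered : Prop := ∀ a : Fin I.m, ∃ P, I.IsPath P ∧ a ∈ P

/-- `SPP(P, c)`. -/
def linearCost (c : Fin I.m → ℝ) (P : List (Fin I.m)) : ℝ := ∑ a ∈ P.toFinset, c a

/-- `SPP_d(P, q)`: the sum of `q B` over all sets `B` of at most `d` arcs of `P`. -/
def cost (P : List (Fin I.m)) : ℝ :=
  ∑ B : {B : Finset (Fin I.m) // B.card ≤ I.d} with B.1 ⊆ P.toFinset, I.q B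

/-- `c` is a linearizing cost function. -/
def IsLinearizing (c : Fin I.m → ℝ) : Prop := ∀ P, I.IsPath P → I.cost P = I.linearCost c P

/-- The number of coefficients of the cost function `q`. -/
def numCoeffs : ℕ := ∑ k ∈ Finset.range (I.d + 1), I.m.choose k

/-- The size of the instance, which governs the word length of the machine. -/
def size : ℕ := I.n + I.m + I.d + I.numCoeffs

/-- The position of the arc set `B` in the list of all arc sets, ordered by cardinality and, within
one cardinality, colexicographically. If `B = {b₁ < ⋯ < bₖ}`, this is
`C(m,0) + ⋯ + C(m,k-1) + C(b₁,1) + ⋯ + C(bₖ,k)`. -/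
def rank {m : ℕ} (B : Finset (Fin m)) : ℕ :=
  ∑ j ∈ Finset.range B.card, m.choose j +
    ∑ b ∈ B, (b : ℕ).choose (B.filter (fun b' => b' ≤ b)).card

end Instance

/-! ### A random access machine with words and real numbers

The memory consists of numbered word registers (holding natural numbers), numbered real registers,
and numbered arrays of words and of reals. A program is a fixed finite text, so it names only
finitely many registers and arrays; array cells are addressed indirectly through word registers.
Reals can be moved, added, subtracted and compared, and cannot be converted to words. -/

/-- A memory state. -/
structure State where
  word : ℕ → ℕ
  real : ℕ → ℝ
  wordArr : ℕ → ℕ → ℕ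
  realArr : ℕ → ℕ → ℝ

/-- Elementary operations. The first argument is the target. -/
inductive Op where
  /-- `word x := k` -/
  | const (x k : ℕ)
  /-- `word x := word y` -/
  | move (x y : ℕ)
  /-- `word x := word y + word z` -/
  | add (x y z : ℕ)
  /-- `word x := word y - word z`, or `0` if this is negative -/
  | sub (x y z : ℕ)
  /-- `word x := word y * word z` -/
  | mul (x y z : ℕ)
  /-- `word x := wordArr a [word y]` -/
  | load (x a y : ℕ)
  /-- `wordArr a [word y] := word x` -/
  | store (a y x : ℕ)
  /-- `real x := real y` -/
  | rmove (x y : ℕ)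
  /-- `real x := real y + real z` -/
  | radd (x y z : ℕ)
  /-- `real x := real y - real z` -/
  | rsub (x y z : ℕ)
  /-- `real x := realArr a [word y]` -/
  | rload (x a y : ℕ)
  /-- `realArr a [word y] := real x` -/
  | rstore (a y x : ℕ)

namespace State

/-- Write the number `v` into word register `x`; impossible if `v` exceeds the largest word `W`. -/
def setWord (W : ℕ) (σ : State) (x v : ℕ) : Option State :=
  if v ≤ W then some { σ with word := Function.update σ.word x v } else none

/-- Write `r` into real register `x`. -/
noncomputable def setReal (σ : State) (x : ℕ) (r : ℝ) : State :=
  { σ with real := Function.update σ.real x r }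

end State

/-- The effect of an elementary operation on a machine with largest word `W`; `none` means that an
overflow occurs. -/
noncomputable def Op.run (W : ℕ) (σ : State) : Op → Option State
  | .const x k => σ.setWord W x k
  | .move x y => σ.setWord W x (σ.word y)
  | .add x y z => σ.setWord W x (σ.word y + σ.word z)
  | .sub x y z => σ.setWord W x (σ.word y - σ.word z)
  | .mul x y z => σ.setWord W x (σ.word y * σ.word z)
  | .load x a y => σ.setWord W x (σ.wordArr a (σ.word y))
  | .store a y x => some { σ with
      wordArr := Function.update σ.wordArr a
        (Function.update (σ.wordArr a) (σ.word y) (σ.word x)) }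
  | .rmove x y => some (σ.setReal x (σ.real y))
  | .radd x y z => some (σ.setReal x (σ.real y + σ.real z))
  | .rsub x y z => some (σ.setReal x (σ.real y - σ.real z))
  | .rload x a y => some (σ.setReal x (σ.realArr a (σ.word y)))
  | .rstore a y x => some { σ with
      realArr := Function.update σ.realArr a
        (Function.update (σ.realArr a) (σ.word y) (σ.real x)) }

/-- Tests on two word registers or on two real registers. -/
inductive Test where
  | eq (x y : ℕ)
  | lt (x y : ℕ)
  | req (x y : ℕ)
  | rlt (x y : ℕ)

/-- The test succeeds in state `σ`. -/
def Test.Holds (σ : State) : Test → Prop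
  | .eq x y => σ.word x = σ.word y
  | .lt x y => σ.word x < σ.word y
  | .req x y => σ.real x = σ.real y
  | .rlt x y => σ.real x < σ.real y

/-- Programs. -/
inductive Prog where
  | skip
  | op (o : Op)
  | seq (p p' : Prog)
  | ite (b : Test) (p p' : Prog)
  | while (b : Test) (p : Prog)

/-- `Exec W p σ k τ`: on a machine with largest word `W`, the program `p` started in state `σ` halts
without overflow in state `τ` after exactly `k` steps. Every elementary operation and every
evaluation of a test is one step. -/
inductive Exec (W : ℕ) : Prog → State → ℕ → State → Prop
  | skip {σ} : Exec W .skip σ 1 σ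
  | op {o σ τ} : o.run W σ = some τ → Exec W (.op o) σ 1 τ
  | seq {p p' σ ρ τ k l} : Exec W p σ k ρ → Exec W p' ρ l τ → Exec W (.seq p p') σ (k + l) τ
  | iteTrue {b p p' σ τ k} : b.Holds σ → Exec W p σ k τ → Exec W (.ite b p p') σ (k + 1) τ
  | iteFalse {b p p' σ τ k} : ¬ b.Holds σ → Exec W p' σ k τ → Exec W (.ite b p p') σ (k + 1) τ
  | whileFalse {b p σ} : ¬ b.Holds σ → Exec W (.while b p) σ 1 σ
  | whileTrue {b p σ ρ τ k l} : b.Holds σ → Exec W p σ k ρ → Exec W (.while b p) ρ l τ →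
      Exec W (.while b p) σ (k + l + 1) τ

/-- The memory at the start. The word registers `0, …, 4` hold `n`, `m`, `s`, `t`, `d`; the word
arrays `0` and `1` list the tails and the heads of the arcs; the real array `0` lists the values
`q B`, each at the position `rank B` (distinct sets have distinct positions, so that the sum below
has at most one term). All other cells are zero. -/
noncomputable def Instance.init (I : Instance) : State where
  word
    | 0 => I.n
    | 1 => I.m
    | 2 => I.s
    | 3 => I.t
    | 4 => I.d
    | _ => 0
  real _ := 0
  wordArr
    | 0 => fun i => if h : i < I.m then I.tail ⟨i, h⟩ else 0
    | 1 => fun i => if h : i < I.m then I.head ⟨i, h⟩ else 0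
    | _ => fun _ => 0
  realArr
    | 0 => fun i =>
        ∑ B : {B : Finset (Fin I.m) // B.card ≤ I.d} with Instance.rank B.1 = i, I.q B
    | _ => fun _ => 0

/-- On input `I` and with words bounded by `I.size ^ K`, the program `p` halts after at most `T`
steps and answers correctly: either word register `0` holds `1` and the first `m` cells of real
array `1` are a linearizing cost function, or word register `0` holds `0` and no linearizing cost
function exists. -/
def SolvesWithin (p : Prog) (K : ℕ) (I : Instance) (T : ℕ) : Prop :=
  ∃ (k : ℕ) (τ : State), Exec (I.size ^ K) p I.init k τ ∧ k ≤ T ∧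
    ((τ.word 0 = 1 ∧ I.IsLinearizing (fun a => τ.realArr 1 a)) ∨
      (τ.word 0 = 0 ∧ ¬ ∃ c, I.IsLinearizing c))

end LinSPP

/-! Number the arcs topologically by `1, …, m` and add two sentinels: arc `0` has head `s`, arc `m +
1` has tail `t`. A walk is then an increasing set of positions, and since the digraph is acyclic the
walks from `0` to `m + 1` are exactly the simple `s`-`t`-paths. The algorithm rewrites `q` without
changing the cost of any path, until linearizability can be read off.

The basic move is a pass. Fix an arc set `C` and neighbours `lo < hi` in `{0} ∪ C ∪ {m + 1}`. Given
a potential `π` on the vertices with `π (T hi) = 0`, add `π (H b) - π (T b)` to the coefficient of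
`C ∪ {b}` for each `b` in between that reaches `hi`, and add `π (H lo)` to that of `C`. Along a walk
from `lo` to `hi` these changes telescope to `0` (`PassRel.sum_eq_zero`). Coefficients of arcs `b`
that do not reach `hi` concern no walk and are set to `0`. The potential can be chosen so that at
every tail other than `T hi` one arc, the `Basic` one, gets coefficient `0`. Following basic arcs
yields a canonical walk to `hi` from everywhere that `hi` can be reached.

Stage `j` carries out the passes in the gap below the top `j` elements of `C`, for `|C| + 1 = K` and
`K = d, …, j + 1`. Since `K` decreases, what has been normalized stays normalized during the stage.
A set of `K` elements arises from just one `C`, by removing its element with exactly `j` larger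
ones, so the passes for one `K` do not interfere.

The cost function is linearizable iff in the end all coefficients of two or more arcs vanish. If
they vanish, a path costs `q ∅ + ∑ q {a}`, and `q ∅` can be charged to the arcs leaving `s`, since a
path has exactly one of these. For the converse let `B` be a set of `j` arcs with first arc `hi`,
and consider the costs in the context `B`, that is `∑ q (A ∪ B)` over the subsets `A` of a walk from
`s` to `hi`. Stage `j` preserves these costs and makes canonical continuations free. Hence the new
cost of `R` in the context `B ∪ {b}` is the cost in the context `B` of `R` continued canonically
through `b`, minus that of `R` continued by a canonical detour (`Down.walkCost_insert`). For `B = ∅`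
costs are linear and `R` cancels, so in contexts of one arc the cost is independent of the walk;
therefore in contexts of two or more arcs it is `0` (`Stages.walkCost_const`). For canonical `R`,
only `q B` survives in the sum after the stage, so `q B = 0` (`Stages.zero_of_good`). Sets in which
some arc does not reach the next one become `0` and remain so (`Stages.zero_of_bad`).

For the time bound, a pass handles at most `m` arcs and computes a rank for each in `O(K²)` steps.
Because `C(m,k) (k+2)² ≤ 9 m^k` (`choose_mul_sq_le`), all passes for one pair `(j, K)` take
`O(m^d)`, and there are `O(d²)` pairs. -/

namespace LinSPP

/-! ### Walks in a topologically numbered digraph -/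

/-- `LWalk T H lo hi R`: the arcs in `R`, taken in increasing order, lead from the head of the arc
`lo` to the tail of the arc `hi`. -/
inductive LWalk (T H : ℕ → ℕ) : ℕ → ℕ → Finset ℕ → Prop
  | nil {lo hi} : lo < hi → H lo = T hi → LWalk T H lo hi ∅
  | snoc {lo b hi R} : LWalk T H lo b R → b < hi → H b = T hi → LWalk T H lo hi (insert b R)

/-- Some walk leads from the head of `p` to the tail of `hi`. -/
def Reach (T H : ℕ → ℕ) (p hi : ℕ) : Prop := ∃ R, LWalk T H p hi R

/-- The arc `b` is the last of the arcs with its tail from which `hi` can be reached. -/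
def Basic (T H : ℕ → ℕ) (hi b : ℕ) : Prop :=
  Reach T H b hi ∧ T b ≠ T hi ∧ ∀ b', b < b' → b' < hi → T b' = T b → ¬ Reach T H b' hi

variable {T H : ℕ → ℕ}

theorem LWalk.lt {lo hi : ℕ} {R : Finset ℕ} (h : LWalk T H lo hi R) : lo < hi := by
  induction h with
  | nil h _ => exact h
  | snoc _ h _ ih => exact ih.trans h

theorem LWalk.mem {lo hi : ℕ} {R : Finset ℕ} (h : LWalk T H lo hi R) :
    ∀ x ∈ R, lo < x ∧ x < hi := by
  induction h with
  | nil h _ => simp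
  | snoc h1 h _ ih =>
    intro x hx
    rcases Finset.mem_insert.1 hx with rfl | hx
    · exact ⟨h1.lt, h⟩
    · exact ⟨(ih x hx).1, (ih x hx).2.trans h⟩

theorem LWalk.append {lo b hi : ℕ} {R R' : Finset ℕ} (h : LWalk T H lo b R)
    (h' : LWalk T H b hi R') : LWalk T H lo hi (R ∪ insert b R') := by
  induction h' with
  | nil h1 h2 =>
    have : R ∪ insert b ∅ = insert b R := by ext; simp
    rw [this]
    exact .snoc h h1 h2
  | @snoc c hi R' _ h1 h2 ih =>
    have : R ∪ insert b (insert c R') = insert c (R ∪ insert b R') := by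
      ext; simp; tauto
    rw [this]
    exact .snoc ih h1 h2

/-- The target enters only through its tail, and a later target keeps the order increasing. This is
what permits exchanging an arc for the basic arc with the same tail. -/
theorem LWalk.retarget {lo b b' : ℕ} {R : Finset ℕ} (h : LWalk T H lo b R) (hb : b ≤ b')
    (ht : T b' = T b) : LWalk T H lo b' R := by
  cases h with
  | nil h1 h2 => exact .nil (h1.trans_le hb) (h2.trans ht.symm)
  | snoc h0 h1 h2 => exact .snoc h0 (h1.trans_le hb) (h2.trans ht.symm)

/-- Consecutive arcs share a vertex. Used with the potential of a pass, and with an indicator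
function to count the arcs of a path that leave the source. -/
theorem LWalk.telescope {lo hi : ℕ} {R : Finset ℕ} (h : LWalk T H lo hi R) (π : ℕ → ℝ) :
    ∑ b ∈ R, (π (H b) - π (T b)) = π (T hi) - π (H lo) := by
  induction h with
  | nil h1 h2 => simp [h2]
  | snoc h0 h1 h2 ih =>
    rw [Finset.sum_insert (fun hb => (lt_irrefl _ (h0.mem _ hb).2)), ih, h2]
    ring

theorem LWalk.splitAt {lo hi b : ℕ} {R : Finset ℕ} (h : LWalk T H lo hi R) (hb : b ∈ R) :
    LWalk T H lo b (R.filter (· < b)) ∧ LWalk T H b hi (R.filter (b < ·)) := by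
  induction h with
  | nil => simp at hb
  | @snoc c hi R h0 h1 h2 ih =>
    have hm := h0.mem
    by_cases hbc : b = c
    · subst hbc
      have e1 : (insert b R).filter (· < b) = R := by
        ext x; simp only [Finset.mem_filter, Finset.mem_insert]
        constructor
        · rintro ⟨rfl | h, h'⟩
          · omega
          · exact h
        · exact fun hx => ⟨Or.inr hx, (hm x hx).2⟩
      have e2 : (insert b R).filter (b < ·) = ∅ := by
        ext x; simp only [Finset.mem_filter, Finset.mem_insert, Finset.notMem_empty, iff_false]
        rintro ⟨rfl | h, h'⟩
        · omega
        · have := (hm x h).2; omega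
      rw [e1, e2]
      exact ⟨h0, .nil h1 h2⟩
    · have hbR : b ∈ R := (Finset.mem_insert.1 hb).resolve_left hbc
      have hlt := (hm b hbR).2
      obtain ⟨i1, i2⟩ := ih hbR
      have e1 : (insert c R).filter (· < b) = R.filter (· < b) := by
        rw [Finset.filter_insert, if_neg (by omega)]
      have e2 : (insert c R).filter (b < ·) = insert c (R.filter (b < ·)) := by
        rw [Finset.filter_insert, if_pos hlt]
      rw [e1, e2]
      exact ⟨i1, .snoc i2 h1 h2⟩

/-- Walks are built from their last arc; this peels off the first one, as required by scans and
inductions that run downwards from `hi`. -/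
theorem reach_iff {p hi : ℕ} : Reach T H p hi ↔
    (p < hi ∧ H p = T hi) ∨ ∃ b, p < b ∧ b < hi ∧ H p = T b ∧ Reach T H b hi := by
  constructor
  · rintro ⟨R, h⟩
    induction h with
    | nil h1 h2 => exact .inl ⟨h1, h2⟩
    | @snoc b hi R h0 h1 h2 ih =>
      rcases ih with ⟨h3, h4⟩ | ⟨c, h3, h4, h5, R', h6⟩
      · exact .inr ⟨b, h3, h1, h4, _, .nil h1 h2⟩
      · exact .inr ⟨c, h3, h4.trans h1, h5, _, .snoc h6 h1 h2⟩
  · rintro (⟨h1, h2⟩ | ⟨b, h1, h2, h3, R, h4⟩)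
    · exact ⟨_, .nil h1 h2⟩
    · exact ⟨_, (LWalk.nil h1 h3).append h4⟩

theorem Reach.lt {p hi : ℕ} (h : Reach T H p hi) : p < hi := h.choose_spec.lt

/-- An arc that fails to be basic has a later arc with the same tail that also reaches `hi`; moving
there decreases `hi - b`. -/
theorem exists_basic {b hi : ℕ} (h : Reach T H b hi) (hne : T b ≠ T hi) :
    ∃ c, b ≤ c ∧ T c = T b ∧ Basic T H hi c := by
  induction hn : hi - b using Nat.strong_induction_on generalizing b with
  | _ n ih =>
    by_cases hb : Basic T H hi b
    · exact ⟨b, le_rfl, rfl, hb⟩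
    · simp only [Basic, not_and, not_forall, not_not] at hb
      obtain ⟨c, h1, h2, h3, h4⟩ := hb h hne
      obtain ⟨e, h5, h6, h7⟩ := ih (hi - c) (by omega) h4 (h3 ▸ hne) rfl
      exact ⟨e, by omega, h6.trans h3, h7⟩

/-- Replace the first arc of a walk by the basic arc at the same tail, and continue from its head.
-/
theorem Reach.canonical {p hi : ℕ} (h : Reach T H p hi) :
    ∃ R, LWalk T H p hi R ∧ ∀ b ∈ R, Basic T H hi b := by
  induction hn : hi - p using Nat.strong_induction_on generalizing p with
  | _ n ih =>
    by_cases hp : H p = T hi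
    · exact ⟨∅, .nil h.lt hp, by simp⟩
    · rcases reach_iff.1 h with h1 | ⟨b, h1, h2, h3, h4⟩
      · exact absurd h1.2 hp
      · obtain ⟨c, h5, h6, h7⟩ := exists_basic h4 (h3 ▸ hp)
        obtain ⟨R, h8, h9⟩ := ih (hi - c) (by have := h7.1.lt; omega) h7.1 rfl
        have := (LWalk.nil (T := T) (H := H) (lo := p) (hi := c) (by omega)
          (h3.trans h6.symm)).append h8
        refine ⟨_, this, ?_⟩
        intro x hx
        simp only [Finset.empty_union, Finset.mem_insert] at hx
        rcases hx with rfl | hx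
        · exact h7
        · exact h9 x hx

/-- A canonical detour that replaces the arc `b` in every walk leading to it. -/
theorem Reach.detour {b hi : ℕ} (h : Reach T H b hi) :
    ∃ R', (∀ x ∈ R', b ≤ x ∧ x < hi ∧ Basic T H hi x) ∧
      ∀ lo R, LWalk T H lo b R → LWalk T H lo hi (R ∪ R') := by
  by_cases hb : T b = T hi
  · exact ⟨∅, by simp, fun lo R hR => by simpa using hR.retarget h.lt.le hb.symm⟩
  · obtain ⟨c, h5, h6, h7⟩ := exists_basic h hb
    obtain ⟨R', h8, h9⟩ := h7.1.canonical
    refine ⟨insert c R', ?_, fun lo R hR => (hR.retarget h5 h6).append h8⟩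
    intro x hx
    rcases Finset.mem_insert.1 hx with rfl | hx
    · exact ⟨h5, h7.1.lt, h7⟩
    · have := h8.mem x hx
      exact ⟨by omega, this.2, h9 x hx⟩

/-! ### Gaps of an arc set -/

/-- `lo` and `hi` are neighbours in `{0} ∪ C ∪ {m + 1}`, and `j` elements of `C` lie above. -/
structure Gap (m j : ℕ) (C : Finset ℕ) (lo hi : ℕ) : Prop where
  sub : C ⊆ Finset.Icc 1 m
  lo_mem : lo ∈ insert 0 C
  hi_mem : hi ∈ insert (m + 1) C
  lt : lo < hi
  empty : ∀ x ∈ C, x ≤ lo ∨ hi ≤ x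
  card : (C.filter (hi ≤ ·)).card = j

variable {m j : ℕ} {C : Finset ℕ} {lo hi : ℕ}

theorem Gap.notMem (h : Gap m j C lo hi) {b : ℕ} (h1 : lo < b) (h2 : b < hi) : b ∉ C := by
  intro hb
  rcases h.empty b hb with h | h <;> omega

theorem Gap.hi_le (h : Gap m j C lo hi) : hi ≤ m + 1 := by
  rcases Finset.mem_insert.1 h.hi_mem with h1 | h1
  · omega
  · have := Finset.mem_Icc.1 (h.sub h1); omega

theorem Gap.filter_insert (h : Gap m j C lo hi) {b : ℕ} (h1 : lo < b) (h2 : b < hi) :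
    (insert b C).filter (b < ·) = C.filter (hi ≤ ·) := by
  ext x
  simp only [Finset.mem_filter, Finset.mem_insert]
  constructor
  · rintro ⟨rfl | h3, h4⟩
    · omega
    · refine ⟨h3, ?_⟩
      rcases h.empty x h3 with h | h <;> omega
  · rintro ⟨h3, h4⟩
    exact ⟨.inr h3, by omega⟩

theorem filter_lt_card_inj {S : Finset ℕ} {b b' : ℕ} (hb : b ∈ S) (hb' : b' ∈ S)
    (h : (S.filter (b < ·)).card = (S.filter (b' < ·)).card) : b = b' := by
  have key : ∀ {x y : ℕ}, y ∈ S → x < y → (S.filter (y < ·)).card < (S.filter (x < ·)).card := by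
    intro x y hy hxy
    apply Finset.card_lt_card
    rw [Finset.ssubset_iff_of_subset]
    · exact ⟨y, by simp [hy, hxy], by simp⟩
    · intro z hz
      simp only [Finset.mem_filter] at hz ⊢
      exact ⟨hz.1, by omega⟩
  rcases lt_trichotomy b b' with h1 | h1 | h1
  · have := key hb' h1; omega
  · exact h1
  · have := key hb h1; omega

/-- In the union, `b` is the element with exactly `j` larger ones, so the union determines `b` and
then `C`. Hence two passes with the same `j` and `K` never touch the same coefficient of cardinality
`K`. -/
theorem Gap.unique_insert {C' : Finset ℕ} {lo' hi' b b' : ℕ} (h : Gap m j C lo hi)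
    (h' : Gap m j C' lo' hi') (h1 : lo < b) (h2 : b < hi) (h1' : lo' < b') (h2' : b' < hi')
    (e : insert b C = insert b' C') : b = b' ∧ C = C' := by
  have hbb : b = b' := by
    apply filter_lt_card_inj (S := insert b C) (by simp) (by simp [e])
    rw [h.filter_insert h1 h2, e, h'.filter_insert h1' h2', h.card, h'.card]
  subst hbb
  refine ⟨rfl, ?_⟩
  rw [← Finset.erase_insert (h.notMem h1 h2), e, Finset.erase_insert (h'.notMem h1' h2')]

theorem Gap.unique {lo' hi' : ℕ} (h : Gap m j C lo hi) (h' : Gap m j C lo' hi') :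
    lo = lo' ∧ hi = hi' := by
  have key : ∀ {lo hi lo' hi' : ℕ}, Gap m j C lo hi → Gap m j C lo' hi' → ¬ hi < hi' := by
    intro lo hi lo' hi' h h' hlt
    have := h'.hi_le
    have hmem : hi ∈ C := (Finset.mem_insert.1 h.hi_mem).resolve_left (by omega)
    have : (C.filter (hi' ≤ ·)).card < (C.filter (hi ≤ ·)).card := by
      apply Finset.card_lt_card
      rw [Finset.ssubset_iff_of_subset]
      · exact ⟨hi, by simp [hmem], by simp [hlt]⟩
      · intro z hz
        simp only [Finset.mem_filter] at hz ⊢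
        exact ⟨hz.1, by omega⟩
    rw [h.card, h'.card] at this
    omega
  have e : hi = hi' := by
    have := key h h'
    have := key h' h
    omega
  subst e
  have key2 : ∀ {lo lo' : ℕ}, Gap m j C lo hi → Gap m j C lo' hi → ¬ lo < lo' := by
    intro lo lo' h h' hlt
    have hmem : lo' ∈ C := (Finset.mem_insert.1 h'.lo_mem).resolve_left (by omega)
    have := h'.lt
    rcases h.empty _ hmem with h | h <;> omega
  have := key2 h h'
  have := key2 h' h
  exact ⟨by omega, rfl⟩

theorem exists_lower {C : Finset ℕ} {x : ℕ} (hx : 0 < x) :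
    ∃ lo, lo ∈ insert 0 C ∧ lo < x ∧ ∀ y ∈ C, y < x → y ≤ lo := by
  have hne : ((insert 0 C).filter (· < x)).Nonempty := ⟨0, by simp [hx]⟩
  refine ⟨_, (Finset.mem_filter.1 (Finset.max'_mem _ hne)).1,
    (Finset.mem_filter.1 (Finset.max'_mem _ hne)).2, fun y hy hyx => Finset.le_max' _ _ ?_⟩
  simp [hy, hyx]

/-- Gap `0` ends at `m + 1`. The lower end of gap `j` belongs to `C` as long as `j < C.card`, and it
is the upper end of gap `j + 1`. -/
theorem exists_gap (hC : C ⊆ Finset.Icc 1 m) : ∀ j ≤ C.card, ∃ lo hi, Gap m j C lo hi := by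
  intro j
  induction j with
  | zero =>
    intro _
    obtain ⟨lo, h1, h2, h3⟩ := exists_lower (C := C) (x := m + 1) (by omega)
    refine ⟨lo, m + 1, hC, h1, by simp, h2, fun x hx => ?_, ?_⟩
    · have := Finset.mem_Icc.1 (hC hx)
      exact .inl (h3 x hx (by omega))
    · rw [Finset.card_eq_zero, Finset.filter_eq_empty_iff]
      intro x hx
      have := Finset.mem_Icc.1 (hC hx)
      omega
  | succ j ih =>
    intro hj
    obtain ⟨lo, hi, h⟩ := ih (by omega)
    have hlo : lo ∈ C := by
      rcases Finset.mem_insert.1 h.lo_mem with h0 | h0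
      · exfalso
        have : C.filter (hi ≤ ·) = C := by
          rw [Finset.filter_eq_self]
          intro x hx
          have := Finset.mem_Icc.1 (hC hx)
          rcases h.empty x hx with h | h <;> omega
        have := h.card
        rw [‹C.filter (hi ≤ ·) = C›] at this
        omega
      · exact h0
    have hpos : 0 < lo := (Finset.mem_Icc.1 (hC hlo)).1
    obtain ⟨lo', h1, h2, h3⟩ := exists_lower (C := C) hpos
    refine ⟨lo', lo, hC, h1, by simp [hlo], h2, fun x hx => ?_, ?_⟩
    · by_cases hx' : x < lo
      · exact .inl (h3 x hx hx')
      · exact .inr (by omega)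
    · have : C.filter (lo ≤ ·) = insert lo (C.filter (hi ≤ ·)) := by
        ext x
        simp only [Finset.mem_filter, Finset.mem_insert]
        have := h.lt
        constructor
        · rintro ⟨hx, hx'⟩
          rcases h.empty x hx with h | h
          · left; omega
          · exact .inr ⟨hx, h⟩
        · rintro (rfl | ⟨hx, hx'⟩)
          · exact ⟨hlo, le_rfl⟩
          · exact ⟨hx, by omega⟩
      rw [this, Finset.card_insert_of_notMem, h.card]
      have := h.lt
      simp; omega

/-- The element to remove is the lower end of gap `j` of `S`; its removal merges the gaps on its two
sides. -/
theorem exists_gap_erase {S : Finset ℕ} (hS : S ⊆ Finset.Icc 1 m) (hj : j < S.card) :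
    ∃ C lo hi b, Gap m j C lo hi ∧ lo < b ∧ b < hi ∧ insert b C = S := by
  obtain ⟨b, hi, h⟩ := exists_gap hS j hj.le
  obtain ⟨b', hi', h'⟩ := exists_gap hS (j + 1) hj
  have hb : b ∈ S := by
    rcases Finset.mem_insert.1 h.lo_mem with h0 | h0
    · exfalso
      have : S.filter (hi ≤ ·) = S := by
        rw [Finset.filter_eq_self]
        intro x hx
        have := Finset.mem_Icc.1 (hS hx)
        rcases h.empty x hx with h | h <;> omega
      have := h.card
      rw [‹S.filter (hi ≤ ·) = S›] at this
      omega
    · exact h0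
  have hpos : 0 < b := (Finset.mem_Icc.1 (hS hb)).1
  obtain ⟨lo, h1, h2, h3⟩ := exists_lower (C := S.erase b) hpos
  refine ⟨S.erase b, lo, hi, b, ⟨(Finset.erase_subset _ _).trans hS, h1, ?_, h2.trans h.lt, ?_, ?_⟩,
    h2, h.lt, Finset.insert_erase hb⟩
  · have := h.lt
    rcases Finset.mem_insert.1 h.hi_mem with h0 | h0
    · simp [h0]
    · simp [h0]; right; omega
  · intro x hx
    have hx' := Finset.mem_of_mem_erase hx
    rcases h.empty x hx' with h4 | h4
    · left
      exact h3 x hx (lt_of_le_of_ne h4 (Finset.ne_of_mem_erase hx))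
    · exact .inr h4
  · rw [← h.card]
    congr 1
    ext x
    have := h.lt
    simp only [Finset.mem_filter, Finset.mem_erase]
    constructor
    · rintro ⟨⟨_, h⟩, h'⟩; exact ⟨h, h'⟩
    · rintro ⟨h, h'⟩; exact ⟨⟨by omega, h⟩, h'⟩

end LinSPP

namespace LinSPP

/-! ### Normalization of a cost function -/

/-- The effect of one normalization pass, with `C` the set of fixed arcs and `lo`, `hi` the arcs
between which the additional arc ranges. -/
def PassRel (T H : ℕ → ℕ) (q q' : Finset ℕ → ℝ) (C : Finset ℕ) (lo hi : ℕ) : Prop :=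
  ∃ π : ℕ → ℝ, π (T hi) = 0 ∧
    (∀ b, lo < b → b < hi →
      (Reach T H b hi → q' (insert b C) = q (insert b C) + π (H b) - π (T b)) ∧
      (¬ Reach T H b hi → q' (insert b C) = 0) ∧
      (Basic T H hi b → q' (insert b C) = 0)) ∧
    (Reach T H lo hi → q' C = q C + π (H lo)) ∧ (¬ Reach T H lo hi → q' C = q C)

/-- `q` vanishes outside the sets of at most `d` arcs. -/
def Supp (m d : ℕ) (q : Finset ℕ → ℝ) : Prop :=
  ∀ S, ¬ (S ⊆ Finset.Icc 1 m ∧ S.card ≤ d) → q S = 0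

/-- All passes for sets of cardinality `K`, the gap being below `j` elements. -/
structure StepRel (T H : ℕ → ℕ) (m d j K : ℕ) (q q' : Finset ℕ → ℝ) : Prop where
  supp : Supp m d q'
  pass : ∀ C lo hi, Gap m j C lo hi → C.card + 1 = K → PassRel T H q q' C lo hi
  other : ∀ S, S.card ≠ K → S.card + 1 ≠ K → q' S = q S

/-- The steps `K = d, …, k + 1`. -/
inductive Down (T H : ℕ → ℕ) (m d j : ℕ) (q : Finset ℕ → ℝ) : ℕ → (Finset ℕ → ℝ) → Prop
  | start : Down T H m d j q d q
  | step {K q₁ q₂} : Down T H m d j q (K + 1) q₁ → j ≤ K → StepRel T H m d j (K + 1) q₁ q₂ →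
      Down T H m d j q K q₂

/-- The first `j` stages. -/
inductive Stages (T H : ℕ → ℕ) (m d : ℕ) (q₀ : Finset ℕ → ℝ) : ℕ → (Finset ℕ → ℝ) → Prop
  | zero : Stages T H m d q₀ 0 q₀
  | succ {j q q'} : Stages T H m d q₀ j q → Down T H m d j q j q' → Stages T H m d q₀ (j + 1) q'

/-- The cost of the walk `R` in the context `B`. -/
def walkCost (q : Finset ℕ → ℝ) (B R : Finset ℕ) : ℝ := ∑ A ∈ R.powerset, q (A ∪ B)

variable {T H : ℕ → ℕ} {m d j K : ℕ} {C : Finset ℕ} {lo hi : ℕ} {q q' : Finset ℕ → ℝ}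

/-- The sum telescopes to `π (T hi) - π (H lo) = -π (H lo)`, which the change at `C` itself
compensates. -/
theorem PassRel.sum_eq_zero (h : PassRel T H q q' C lo hi) {R : Finset ℕ}
    (hR : LWalk T H lo hi R) :
    ∑ b ∈ R, (q' (insert b C) - q (insert b C)) + (q' C - q C) = 0 := by
  obtain ⟨π, h0, h1, h2, -⟩ := h
  rw [h2 ⟨R, hR⟩]
  have := hR.telescope π
  rw [h0] at this
  rw [Finset.sum_congr rfl (g := fun b => π (H b) - π (T b)), this]
  · ring
  · intro b hb
    rw [(h1 b (hR.mem b hb).1 (hR.mem b hb).2).1 ⟨_, (hR.splitAt hb).2⟩]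
    ring

theorem LWalk.above {R : Finset ℕ} (h : LWalk T H 0 hi R) {C : Finset ℕ}
    (hlo : lo ∈ insert 0 C) (hC : C ⊆ R) : LWalk T H lo hi (R.filter (lo < ·)) := by
  rcases Finset.mem_insert.1 hlo with rfl | h0
  · rwa [Finset.filter_true_of_mem (fun x hx => (h.mem x hx).1)]
  · exact (h.splitAt (hC h0)).2

theorem exists_max_insert {A : Finset ℕ} {k : ℕ} (hA : A.card = k + 1) :
    ∃ A' b, (∀ a ∈ A', a < b) ∧ insert b A' = A ∧ A'.card = k := by
  have hne : A.Nonempty := Finset.card_pos.1 (by omega)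
  refine ⟨A.erase (A.max' hne), A.max' hne, fun a ha => ?_,
    Finset.insert_erase (Finset.max'_mem _ _), ?_⟩
  · exact Finset.lt_max'_of_mem_erase_max' _ hne ha
  · rw [Finset.card_erase_of_mem (Finset.max'_mem _ _)]; omega

/-- Attaching each set to the set without its maximum brings together the coefficients that one pass
changes along a walk. -/
theorem sum_powersetCard_max (R : Finset ℕ) (k : ℕ) (f : Finset ℕ → ℝ) :
    ∑ A ∈ R.powersetCard (k + 1), f A =
      ∑ A ∈ R.powersetCard k, ∑ b ∈ R with ∀ a ∈ A, a < b, f (insert b A) := by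
  rw [Finset.sum_sigma']
  symm
  apply Finset.sum_nbij (fun x : (_ : Finset ℕ) × ℕ => insert x.2 x.1)
  · rintro ⟨A, b⟩ h
    simp only [Finset.mem_sigma, Finset.mem_powersetCard, Finset.mem_filter] at h ⊢
    refine ⟨Finset.insert_subset h.2.1 h.1.1, ?_⟩
    rw [Finset.card_insert_of_notMem (fun hb => lt_irrefl _ (h.2.2 b hb)), h.1.2]
  · rintro ⟨A, b⟩ h ⟨A', b'⟩ h' e
    simp only [Finset.coe_sigma, Set.mem_sigma_iff, Finset.mem_coe, Finset.mem_powersetCard,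
      Finset.mem_filter] at h h' e
    have hb : b ∈ insert b' A' := e ▸ Finset.mem_insert_self _ _
    have hb' : b' ∈ insert b A := e ▸ Finset.mem_insert_self _ _
    have hbb : b = b' := by
      rcases Finset.mem_insert.1 hb with h1 | h1
      · exact h1
      · rcases Finset.mem_insert.1 hb' with h2 | h2
        · exact h2.symm
        · have := h.2.2 _ h2; have := h'.2.2 _ h1; omega
    subst hbb
    rw [← Finset.erase_insert (fun hb => lt_irrefl _ (h.2.2 b hb)), e,
      Finset.erase_insert (fun hb => lt_irrefl _ (h'.2.2 b hb))]
  · intro A hA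
    simp only [Finset.mem_coe, Finset.mem_powersetCard] at hA
    obtain ⟨A', b, h1, rfl, h3⟩ := exists_max_insert hA.2
    refine ⟨⟨A', b⟩, ?_, rfl⟩
    simp only [Finset.coe_sigma, Set.mem_sigma_iff, Finset.mem_coe, Finset.mem_powersetCard,
      Finset.mem_filter]
    exact ⟨⟨(Finset.subset_insert _ _).trans hA.1, h3⟩, hA.1 (Finset.mem_insert_self _ _), h1⟩
  · intro _ _; rfl

/-- `hi` is the first arc of the context `B`, which has `j` arcs. -/
structure Context (m j : ℕ) (B : Finset ℕ) (hi : ℕ) : Prop where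
  sub : B ⊆ Finset.Icc 1 m
  mem : hi ∈ insert (m + 1) B
  le : ∀ b ∈ B, hi ≤ b
  card : B.card = j

theorem Context.hi_le {B : Finset ℕ} (h : Context m j B hi) : hi ≤ m + 1 := by
  rcases Finset.mem_insert.1 h.mem with h1 | h1
  · omega
  · have := Finset.mem_Icc.1 (h.sub h1); omega

/-- With `lo` the maximum of `A` (or the sentinel), the pass for `A ∪ B` ranges over the arcs that
can extend `A` upwards without entering the context. -/
theorem Context.gap {A B : Finset ℕ} (h : Context m j B hi) (hA : ∀ a ∈ A, 0 < a ∧ a < hi)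
    (hlo : lo ∈ insert 0 A) (hlo' : ∀ a ∈ A, a ≤ lo) (hpos : 0 < hi) :
    Gap m j (A ∪ B) lo hi := by
  have := h.hi_le
  refine ⟨?_, ?_, ?_, ?_, ?_, ?_⟩
  · apply Finset.union_subset _ h.sub
    intro a ha
    have := hA a ha
    exact Finset.mem_Icc.2 ⟨this.1, by omega⟩
  · rw [← Finset.insert_union]; exact Finset.mem_union_left _ hlo
  · rw [← Finset.union_insert]; exact Finset.mem_union_right _ h.mem
  · rcases Finset.mem_insert.1 hlo with rfl | h1
    · exact hpos
    · exact (hA _ h1).2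
  · intro x hx
    rcases Finset.mem_union.1 hx with h1 | h1
    · exact .inl (hlo' x h1)
    · exact .inr (h.le x h1)
  · rw [Finset.filter_union, Finset.filter_true_of_mem h.le, Finset.filter_false_of_mem,
      Finset.empty_union, h.card]
    intro a ha
    have := hA a ha
    omega

theorem Context.card_union {A B : Finset ℕ} (h : Context m j B hi) (hA : ∀ a ∈ A, a < hi) :
    (A ∪ B).card = A.card + j := by
  rw [Finset.card_union_of_disjoint, h.card]
  rw [Finset.disjoint_left]
  intro a ha hb
  have := hA a ha
  have := h.le a hb
  omega

/-- Only subsets `A` of the walk with `K - j` or `K - j + 1` arcs are affected. Grouped by their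
lowest `K - j` arcs, the changes are those of a single pass along the part of the walk above these
arcs, so every group contributes `0`. -/
theorem StepRel.walkCost_eq (h : StepRel T H m d j (K + 1) q q') (hjK : j ≤ K) {B R : Finset ℕ}
    (hB : Context m j B hi) (hR : LWalk T H 0 hi R) : walkCost q' B R = walkCost q B R := by
  have hmem := hR.mem
  have hsub : ∀ A ⊆ R, ∀ a ∈ A, 0 < a ∧ a < hi := fun A hA a ha => hmem a (hA ha)
  set D : Finset ℕ → ℝ := fun A => q' (A ∪ B) - q (A ∪ B) with hD
  have hcard : ∀ A ⊆ R, (A ∪ B).card = A.card + j :=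
    fun A hA => hB.card_union fun a ha => (hsub A hA a ha).2
  obtain ⟨k, rfl⟩ := Nat.exists_eq_add_of_le' hjK
  have hzero : ∀ A ⊆ R, A.card ≠ k → A.card ≠ k + 1 → D A = 0 := by
    intro A hA h1 h2
    have := hcard A hA
    simp only [hD]
    rw [h.other _ (by omega) (by omega), sub_self]
  have e1 : ∑ A ∈ R.powerset, D A =
      ∑ A ∈ R.powersetCard k, D A + ∑ A ∈ R.powersetCard (k + 1), D A := by
    rw [← Finset.sum_union]
    · symm
      apply Finset.sum_subset
      · apply Finset.union_subset <;>
          exact fun A hA => Finset.mem_powerset.2 (Finset.mem_powersetCard.1 hA).1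
      · intro A hA hA'
        simp only [Finset.mem_union, Finset.mem_powersetCard, Finset.mem_powerset] at hA hA'
        exact hzero A hA (by tauto) (by tauto)
    · rw [Finset.disjoint_left]
      intro A hA hA'
      simp only [Finset.mem_powersetCard] at hA hA'
      omega
  have e2 : ∑ A ∈ R.powerset, D A = 0 := by
    rw [e1, sum_powersetCard_max, ← Finset.sum_add_distrib]
    apply Finset.sum_eq_zero
    intro A hA
    obtain ⟨hA, hAk⟩ := Finset.mem_powersetCard.1 hA
    obtain ⟨lo, h1, h2, h3⟩ := exists_lower (C := A) (hR.lt)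
    have hlo' : ∀ a ∈ A, a ≤ lo := fun a ha => h3 a ha (hsub A hA a ha).2
    have hg := hB.gap (hsub A hA) h1 hlo' hR.lt
    have hp := h.pass _ _ _ hg (by rw [hcard A hA]; omega)
    have hs := hp.sum_eq_zero (hR.above h1 hA)
    have hf : R.filter (fun b => ∀ a ∈ A, a < b) = R.filter (lo < ·) := by
      apply Finset.filter_congr
      intro b hb
      constructor
      · intro hb'
        rcases Finset.mem_insert.1 h1 with rfl | h4
        · exact (hmem b hb).1
        · exact hb' _ h4
      · intro hb' a ha
        exact (hlo' a ha).trans_lt hb'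
    rw [hf, add_comm]
    simpa only [hD, Finset.insert_union] using hs
  have e3 : ∑ A ∈ R.powerset, D A = walkCost q' B R - walkCost q B R := by
    simp only [hD, walkCost, Finset.sum_sub_distrib]
  linarith

theorem Down.walkCost_eq {q₀ : Finset ℕ → ℝ} (h : Down T H m d j q₀ K q) {B R : Finset ℕ}
    (hB : Context m j B hi) (hR : LWalk T H 0 hi R) : walkCost q B R = walkCost q₀ B R := by
  induction h with
  | start => rfl
  | step _ h1 h2 ih => rw [h2.walkCost_eq h1 hB hR, ih]

theorem Down.other {q₀ : Finset ℕ → ℝ} (h : Down T H m d j q₀ K q) {S : Finset ℕ}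
    (hS : S.card < j) : q S = q₀ S := by
  induction h with
  | start => rfl
  | step _ h1 h2 ih => rw [h2.other _ (by omega) (by omega), ih]

/-- The subsets of `P` with at least `j` elements, grouped by their top `j` elements. -/
theorem sum_powerset_top {P : Finset ℕ} (hP : P ⊆ Finset.Icc 1 m) (j : ℕ) (f : Finset ℕ → ℝ) :
    ∑ S ∈ P.powerset with j ≤ S.card, f S =
      ∑ B ∈ P.powersetCard j, ∑ A ∈ (P.filter (fun a => ∀ b ∈ B, a < b)).powerset,
        f (A ∪ B) := by
  rw [Finset.sum_sigma']
  symm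
  apply Finset.sum_nbij (fun x : (_ : Finset ℕ) × Finset ℕ => x.2 ∪ x.1)
  · rintro ⟨B, A⟩ h
    simp only [Finset.mem_sigma, Finset.mem_powersetCard, Finset.mem_filter,
      Finset.mem_powerset] at h ⊢
    refine ⟨Finset.union_subset (h.2.trans (Finset.filter_subset _ _)) h.1.1, ?_⟩
    rw [← h.1.2]
    exact Finset.card_le_card Finset.subset_union_right
  · rintro ⟨B, A⟩ h ⟨B', A'⟩ h' e
    simp only [Finset.coe_sigma, Set.mem_sigma_iff, Finset.mem_coe, Finset.mem_powersetCard,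
      Finset.mem_powerset] at h h' e
    -- An element of `B` outside `B'` lies in `A'`, hence below all of `B'`. No element of `B'` can
    -- then lie in `A`, so `B'` is a proper subset of `B`, against the equal cardinalities.
    have key : ∀ {A B A' B' : Finset ℕ}, A ⊆ P.filter (fun a => ∀ b ∈ B, a < b) →
        A' ⊆ P.filter (fun a => ∀ b ∈ B', a < b) → B.card = B'.card → A ∪ B = A' ∪ B' →
        B ⊆ B' := by
      intro A B A' B' hA hA' hc e x hx
      by_contra hx'
      have hxA : x ∈ A' := by
        have : x ∈ A' ∪ B' := e ▸ Finset.mem_union_right _ hx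
        exact (Finset.mem_union.1 this).resolve_right hx'
      have hlt := (Finset.mem_filter.1 (hA' hxA)).2
      have : B' ⊂ B := by
        rw [Finset.ssubset_iff_of_subset]
        · exact ⟨x, hx, hx'⟩
        · intro y hy
          have : y ∈ A ∪ B := e ▸ Finset.mem_union_right _ hy
          rcases Finset.mem_union.1 this with h1 | h1
          · have := (Finset.mem_filter.1 (hA h1)).2 x hx
            have := hlt y hy
            omega
          · exact h1
      have := Finset.card_lt_card this
      omega
    have hBB : B = B' := (key h.2 h'.2 (h.1.2.trans h'.1.2.symm) e).antisymm
      (key h'.2 h.2 (h'.1.2.trans h.1.2.symm) e.symm)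
    subst hBB
    have : A = A' := by
      have key2 : ∀ {A A' : Finset ℕ}, A ⊆ P.filter (fun a => ∀ b ∈ B, a < b) →
          A ∪ B = A' ∪ B → A ⊆ A' := by
        intro A A' hA e x hx
        have : x ∈ A' ∪ B := e ▸ Finset.mem_union_left _ hx
        refine (Finset.mem_union.1 this).resolve_right fun hxB => ?_
        exact lt_irrefl _ ((Finset.mem_filter.1 (hA hx)).2 x hxB)
      exact (key2 h.2 e).antisymm (key2 h'.2 e.symm)
    rw [this]
  · intro S hS
    simp only [Finset.coe_filter, Set.mem_ofPred_eq, Finset.mem_powerset] at hS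
    obtain ⟨lo, hi, hg⟩ := exists_gap (hS.1.trans hP) j hS.2
    refine ⟨⟨S.filter (hi ≤ ·), S.filter (¬ hi ≤ ·)⟩, ?_, ?_⟩
    · simp only [Finset.coe_sigma, Set.mem_sigma_iff, Finset.mem_coe, Finset.mem_powersetCard,
        Finset.mem_powerset]
      refine ⟨⟨(Finset.filter_subset _ _).trans hS.1, hg.card⟩, fun x hx => ?_⟩
      simp only [Finset.mem_filter] at hx ⊢
      exact ⟨hS.1 hx.1, fun b hb => by omega⟩
    · simp only
      rw [Finset.union_comm, Finset.filter_union_filter_not_eq]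
  · intro _ _; rfl

/-- Sets of fewer than `j` arcs are untouched. The others, grouped by their top `j` arcs `B`,
contribute the cost in the context `B` of the part of the path below `B`. -/
theorem Down.total_eq {q₀ : Finset ℕ → ℝ} (h : Down T H m d j q₀ K q) {P : Finset ℕ}
    (hP : LWalk T H 0 (m + 1) P) : walkCost q ∅ P = walkCost q₀ ∅ P := by
  have hsub : P ⊆ Finset.Icc 1 m := fun x hx => by
    have := hP.mem x hx; exact Finset.mem_Icc.2 ⟨this.1, by omega⟩
  simp only [walkCost, Finset.union_empty]
  rw [← Finset.sum_filter_add_sum_filter_not _ (fun S => j ≤ S.card),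
    ← Finset.sum_filter_add_sum_filter_not (s := P.powerset) (fun S => j ≤ S.card) q₀,
    sum_powerset_top hsub, sum_powerset_top hsub]
  congr 1
  · apply Finset.sum_congr rfl
    intro B hB
    obtain ⟨hBP, hBj⟩ := Finset.mem_powersetCard.1 hB
    obtain ⟨hi, hc, hw⟩ : ∃ hi, Context m j B hi ∧
        LWalk T H 0 hi (P.filter (fun a => ∀ b ∈ B, a < b)) := by
      -- The empty context occurs for `j = 0`; its first arc is the sentinel `m + 1`.
      by_cases hne : B.Nonempty
      · refine ⟨B.min' hne, ⟨hBP.trans hsub, by simp [Finset.min'_mem], fun b hb =>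
          Finset.min'_le _ _ hb, hBj⟩, ?_⟩
        have := (hP.splitAt (hBP (Finset.min'_mem B hne))).1
        convert this using 2
        simp [Finset.lt_min'_iff]
      · rw [Finset.not_nonempty_iff_eq_empty] at hne
        subst hne
        refine ⟨m + 1, ⟨by simp, by simp, by simp, hBj⟩, ?_⟩
        simpa using hP
    exact h.walkCost_eq hc hw
  · apply Finset.sum_congr rfl
    intro S hS
    exact h.other (by simpa using (Finset.mem_filter.1 hS).2)

theorem Stages.total_eq {q₀ : Finset ℕ → ℝ} (h : Stages T H m d q₀ j q) {P : Finset ℕ}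
    (hP : LWalk T H 0 (m + 1) P) : walkCost q ∅ P = walkCost q₀ ∅ P := by
  induction h with
  | zero => rfl
  | succ _ h1 ih => rw [h1.total_eq hP, ih]

end LinSPP

namespace LinSPP

/-! ### Coefficients that vanish after a stage, and the growth of contexts -/

variable {T H : ℕ → ℕ} {m d j K : ℕ} {C : Finset ℕ} {lo hi : ℕ} {q q' q₀ : Finset ℕ → ℝ}

theorem Down.supp (h : Down T H m d j q₀ K q) (h0 : Supp m d q₀) : Supp m d q := by
  cases h with
  | start => exact h0
  | step _ _ h => exact h.supp

theorem Stages.supp (h : Stages T H m d q₀ j q) (h0 : Supp m d q₀) : Supp m d q := by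
  induction h with
  | zero => exact h0
  | succ _ h ih => exact h.supp ih

/-- A property that every step gives to the sets of the cardinality that it normalizes. -/
theorem Down.forall_card {p : Finset ℕ → ℝ → Prop}
    (hp : ∀ K q q', j ≤ K → StepRel T H m d j (K + 1) q q' → ∀ S, S.card = K + 1 → p S (q' S))
    (h : Down T H m d j q₀ K q) {S : Finset ℕ} (h1 : K < S.card) (h2 : S.card ≤ d) :
    p S (q S) := by
  induction h with
  | start => omega
  | @step K q₁ q₂ _ hjK hs ih =>
    by_cases hS : S.card = K + 1
    · exact hp K _ _ hjK hs S hS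
    · rw [hs.other S hS (by omega)]
      exact ih (by omega)

/-- The zero is created in the step for the cardinality of the set; the later steps of the stage
concern smaller cardinalities only. Sets of more than `d` arcs are covered by `Supp`. -/
theorem Down.basic (h : Down T H m d j q₀ j q) (h0 : Supp m d q₀) {lo b : ℕ}
    (hg : Gap m j C lo hi) (hlo : lo < b) (hb : b < hi) (hbas : Basic T H hi b) :
    q (insert b C) = 0 := by
  have hcard := Finset.card_insert_of_notMem (hg.notMem hlo hb)
  by_cases hd : (insert b C).card ≤ d
  · have hj : j ≤ C.card := by rw [← hg.card]; exact Finset.card_filter_le _ _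
    refine h.forall_card (p := fun S r => ∀ C lo hi b, Gap m j C lo hi → lo < b → b < hi →
      Basic T H hi b → insert b C = S → r = 0) ?_ (by omega) hd C lo hi b hg hlo hb hbas rfl
    rintro K q q' - hs S hS C lo hi b hg hlo hb hbas rfl
    obtain ⟨π, -, h1, -⟩ := hs.pass C lo hi hg
      (by rw [← hS, Finset.card_insert_of_notMem (hg.notMem hlo hb)])
    exact (h1 b hlo hb).2.2 hbas
  · exact h.supp h0 _ (by tauto)

theorem Down.unreachable (h : Down T H m d j q₀ j q) (h0 : Supp m d q₀) {lo b : ℕ}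
    (hg : Gap m j C lo hi) (hlo : lo < b) (hb : b < hi) (hbas : ¬ Reach T H b hi) :
    q (insert b C) = 0 := by
  have hcard := Finset.card_insert_of_notMem (hg.notMem hlo hb)
  by_cases hd : (insert b C).card ≤ d
  · have hj : j ≤ C.card := by rw [← hg.card]; exact Finset.card_filter_le _ _
    refine h.forall_card (p := fun S r => ∀ C lo hi b, Gap m j C lo hi → lo < b → b < hi →
      ¬ Reach T H b hi → insert b C = S → r = 0) ?_ (by omega) hd C lo hi b hg hlo hb hbas rfl
    rintro K q q' - hs S hS C lo hi b hg hlo hb hbas rfl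
    obtain ⟨π, -, h1, -⟩ := hs.pass C lo hi hg
      (by rw [← hS, Finset.card_insert_of_notMem (hg.notMem hlo hb)])
    exact (h1 b hlo hb).2.1 hbas
  · exact h.supp h0 _ (by tauto)

theorem walkCost_insert (q : Finset ℕ → ℝ) (B : Finset ℕ) {R : Finset ℕ} {b : ℕ} (hb : b ∉ R) :
    walkCost q B (insert b R) = walkCost q B R + walkCost q (insert b B) R := by
  simp only [walkCost, Finset.sum_powerset_insert hb, Finset.insert_union, Finset.union_insert]

/-- A subset that meets `R'` has its maximum in `R'`, and such subsets have coefficient `0`. -/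
theorem walkCost_union (q : Finset ℕ → ℝ) (B : Finset ℕ) {R R' : Finset ℕ}
    (hlt : ∀ x ∈ R, ∀ y ∈ R', x < y)
    (h : ∀ A ⊆ R ∪ R', ∀ b ∈ R', (∀ a ∈ A, a < b) → q (insert b A ∪ B) = 0) :
    walkCost q B (R ∪ R') = walkCost q B R := by
  symm
  apply Finset.sum_subset (Finset.powerset_mono.2 Finset.subset_union_left)
  intro A hA hA'
  simp only [Finset.mem_powerset] at hA hA'
  have hne : A.Nonempty := by
    rw [Finset.nonempty_iff_ne_empty]; rintro rfl; simp at hA'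
  obtain ⟨k, hk⟩ : ∃ k, A.card = k + 1 := Nat.exists_eq_add_one.2 (Finset.card_pos.2 hne)
  obtain ⟨A', b, h1, rfl, -⟩ := exists_max_insert hk
  have hb : b ∈ R ∪ R' := hA (Finset.mem_insert_self _ _)
  refine h A' ((Finset.subset_insert _ _).trans hA) b ?_ h1
  refine (Finset.mem_union.1 hb).resolve_left fun hbR => hA' ?_
  intro x hx
  rcases Finset.mem_insert.1 hx with rfl | hx'
  · exact hbR
  · refine (Finset.mem_union.1 (hA hx)).resolve_right fun hxR => ?_
    have := hlt b hbR x hxR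
    have := h1 x hx'
    omega

/-- The normalized cost in the context `B ∪ {b}` is a difference of costs in the context `B`. -/
theorem Down.walkCost_insert (h : Down T H m d j q₀ j q) (h0 : Supp m d q₀) {B : Finset ℕ}
    (hB : Context m j B hi) {b : ℕ} (hb : Reach T H b hi) :
    ∃ R₁ R₂, (∀ x ∈ R₁, b < x) ∧ (∀ x ∈ R₂, b ≤ x) ∧ ∀ R, LWalk T H 0 b R →
      LWalk T H 0 hi (R ∪ insert b R₁) ∧ LWalk T H 0 hi (R ∪ R₂) ∧
      walkCost q (insert b B) R =
        walkCost q₀ B (R ∪ insert b R₁) - walkCost q₀ B (R ∪ R₂) := by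
  -- `R₁` continues canonically from the head of `b`, while `R₂` starts at the tail of `b` and
  -- replaces it.
  obtain ⟨R₁, hR₁, hb₁⟩ := hb.canonical
  obtain ⟨R₂, hb₂, hR₂⟩ := hb.detour
  have hm₁ := hR₁.mem
  refine ⟨R₁, R₂, fun x hx => (hm₁ x hx).1, fun x hx => (hb₂ x hx).1, fun R hR => ?_⟩
  have hw₁ := hR.append hR₁
  have hw₂ := hR₂ 0 R hR
  refine ⟨hw₁, hw₂, ?_⟩
  rw [← h.walkCost_eq hB hw₁, ← h.walkCost_eq hB hw₂]
  have hm := hR.mem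
  -- In the context `B`, every set whose topmost arc below `B` is basic has coefficient `0` after
  -- the stage. Therefore `R₁` and `R₂` add nothing to the costs.
  have hvan : ∀ X, LWalk T H 0 hi X → ∀ A ⊆ X, ∀ c ∈ X, Basic T H hi c → (∀ a ∈ A, a < c) →
      q (insert c A ∪ B) = 0 := by
    intro X hX A hA c hc hbas hlt
    have hcm := hX.mem c hc
    obtain ⟨lo, h1, h2, h3⟩ := exists_lower (C := A) hcm.1
    have hg := hB.gap (A := A) (fun a ha => hX.mem a (hA ha)) h1
      (fun a ha => h3 a ha (hlt a ha)) hX.lt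
    rw [Finset.insert_union]
    exact h.basic h0 hg h2 hcm.2 hbas
  have e₂ : walkCost q B (R ∪ R₂) = walkCost q B R := by
    apply walkCost_union
    · intro x hx y hy
      have := hm x hx; have := hb₂ y hy; omega
    · intro A hA c hc hlt
      exact hvan _ hw₂ A hA c (Finset.mem_union_right _ hc) (hb₂ c hc).2.2 hlt
  have e₁ : walkCost q B (R ∪ insert b R₁) = walkCost q B (insert b R) := by
    have : R ∪ insert b R₁ = insert b R ∪ R₁ := by
      rw [Finset.union_insert, Finset.insert_union]
    rw [this] at hw₁ ⊢
    apply walkCost_union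
    · intro x hx y hy
      have := hm₁ y hy
      rcases Finset.mem_insert.1 hx with rfl | hx
      · omega
      · have := hm x hx; omega
    · intro A hA c hc hlt
      exact hvan _ hw₁ A hA c (Finset.mem_union_right _ hc) (hb₁ c hc) hlt
  rw [e₁, e₂, LinSPP.walkCost_insert q B (fun hbR => lt_irrefl _ (hm b hbR).2)]
  ring

/-! ### Sets that lie on no walk -/

/-- From the arc `b` of `S` the next arc of `S` (or the sink) cannot be reached. -/
def Bad (T H : ℕ → ℕ) (m : ℕ) (S : Finset ℕ) (b : ℕ) : Prop :=
  b ∈ S ∧ ∃ hi, Context m (S.filter (b < ·)).card (S.filter (b < ·)) hi ∧ ¬ Reach T H b hi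

/-- At a basic arc `c` the old and the new coefficient are both `0`, which forces `π (T c) = π (H
c)`. Going backwards from `hi`, the potential is `0` wherever the pass uses it. -/
theorem PassRel.zero (h : PassRel T H q q' C lo hi)
    (h0 : ∀ b, lo < b → b < hi → q (insert b C) = 0) :
    (∀ b, lo < b → b < hi → q' (insert b C) = 0) ∧ q' C = q C := by
  obtain ⟨π, hπ, h1, h2, h3⟩ := h
  have tail : ∀ b, lo < b → Reach T H b hi →
      (∀ c, b ≤ c → Reach T H c hi → π (H c) = 0) → π (T b) = 0 := by
    intro b hb hr hc
    by_cases hne : T b = T hi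
    · rw [hne, hπ]
    · obtain ⟨c, h4, h5, h6⟩ := exists_basic hr hne
      have h7 := (h1 c (by omega) h6.1.lt).1 h6.1
      rw [(h1 c (by omega) h6.1.lt).2.2 h6, h0 c (by omega) h6.1.lt, hc c h4 h6.1, h5] at h7
      linarith
  have head : ∀ n p, hi - p = n → lo ≤ p → Reach T H p hi → π (H p) = 0 := by
    intro n
    induction n using Nat.strong_induction_on with
    | _ n ih =>
      intro p hn hp hr
      rcases reach_iff.1 hr with ⟨-, h4⟩ | ⟨b, h4, h5, h6, h7⟩
      · rw [h4, hπ]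
      · rw [h6]
        refine tail b (by omega) h7 fun c hc hcr => ?_
        have := hcr.lt
        exact ih (hi - c) (by omega) c rfl (by omega) hcr
  constructor
  · intro b hb hb'
    by_cases hr : Reach T H b hi
    · rw [(h1 b hb hb').1 hr, h0 b hb hb', head _ b rfl hb.le hr,
        tail b hb hr fun c hc hcr => head _ c rfl (by omega) hcr]
      simp
    · exact (h1 b hb hb').2.1 hr
  · by_cases hr : Reach T H lo hi
    · rw [h2 hr, head _ lo rfl le_rfl hr, add_zero]
    · exact h3 hr

/-- A pass affecting such a set has its gap below `b₀`. All sets it considers contain `b₀` and have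
the same arcs above `b₀`, so they are bad as well, and `PassRel.zero` applies. -/
theorem StepRel.zero_of_bad (h : StepRel T H m d j (K + 1) q q') (hjK : j ≤ K)
    (hq : ∀ S b, Bad T H m S b → (S.filter (b < ·)).card < j → q S = 0) {S : Finset ℕ} {b₀ : ℕ}
    (hS : Bad T H m S b₀) (hlt : (S.filter (b₀ < ·)).card < j) : q' S = 0 := by
  by_cases hsup : S ⊆ Finset.Icc 1 m ∧ S.card ≤ d
  swap
  · exact h.supp S hsup
  have main : ∀ C lo hi, Gap m j C lo hi → C.card = K → hi ≤ b₀ → b₀ ∈ C →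
      C.filter (b₀ < ·) = S.filter (b₀ < ·) →
      (∀ b, lo < b → b < hi → q' (insert b C) = 0) ∧ q' C = q C := by
    intro C lo hi hg hc hle hmem hfil
    apply (h.pass C lo hi hg (by omega)).zero
    intro b hb hb'
    have e : (insert b C).filter (b₀ < ·) = S.filter (b₀ < ·) := by
      rw [Finset.filter_insert, if_neg (by omega), hfil]
    apply hq _ b₀
    · rw [Bad, e]
      exact ⟨Finset.mem_insert_of_mem hmem, hS.2⟩
    · rwa [e]
  by_cases h1 : S.card = K + 1
  · obtain ⟨C, lo, hi, b, hg, h2, h3, h4⟩ := exists_gap_erase (j := j) hsup.1 (by omega)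
    have hbS := hg.filter_insert h2 h3
    rw [h4] at hbS
    -- `b` has exactly `j` larger elements in `S`, and `b₀` has fewer.
    have hbb : b < b₀ := by
      by_contra hcon
      have : (S.filter (b < ·)).card ≤ (S.filter (b₀ < ·)).card := by
        apply Finset.card_le_card
        intro x hx
        simp only [Finset.mem_filter] at hx ⊢
        exact ⟨hx.1, by omega⟩
      rw [hbS, hg.card] at this
      omega
    have hmem : b₀ ∈ C := by
      have := hS.1
      rw [← h4] at this
      exact (Finset.mem_insert.1 this).resolve_left (by omega)
    have hle : hi ≤ b₀ := by
      rcases hg.empty _ hmem with h | h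
      · omega
      · exact h
    rw [← h4]
    refine (main C lo hi hg ?_ hle hmem ?_).1 b h2 h3
    · have := Finset.card_insert_of_notMem (hg.notMem h2 h3)
      rw [h4] at this; omega
    · rw [← h4, Finset.filter_insert, if_neg (by omega)]
  · by_cases h2 : S.card = K
    · obtain ⟨lo, hi, hg⟩ := exists_gap (j := j) hsup.1 (by omega)
      have hle : hi ≤ b₀ := by
        by_contra hcon
        have hsub : S.filter (hi ≤ ·) ⊆ S.filter (b₀ < ·) := by
          intro x hx
          simp only [Finset.mem_filter] at hx ⊢
          exact ⟨hx.1, by omega⟩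
        have := Finset.card_le_card hsub
        rw [hg.card] at this
        omega
      rw [(main S lo hi hg h2 hle hS.1 rfl).2]
      exact hq S b₀ hS hlt
    · rw [h.other S h1 (by omega)]
      exact hq S b₀ hS hlt

theorem Down.zero_of_bad (h : Down T H m d j q₀ K q)
    (hq : ∀ S b, Bad T H m S b → (S.filter (b < ·)).card < j → q₀ S = 0) {S : Finset ℕ} {b₀ : ℕ}
    (hS : Bad T H m S b₀) (hlt : (S.filter (b₀ < ·)).card < j) : q S = 0 := by
  induction h generalizing S b₀ with
  | start => exact hq S b₀ hS hlt
  | step _ h1 h2 ih => exact h2.zero_of_bad h1 (fun S b hS hlt => ih hS hlt) hS hlt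

/-- If `i` arcs of `S` lie above `b₀`, stage `i` sets the coefficient to `0`, because `b₀` does not
reach the next arc. Later stages work below `b₀` and preserve the zero. -/
theorem Stages.zero_of_bad (h : Stages T H m d q₀ j q) (h0 : Supp m d q₀) {S : Finset ℕ} {b₀ : ℕ}
    (hS : Bad T H m S b₀) (hlt : (S.filter (b₀ < ·)).card < j) : q S = 0 := by
  induction h generalizing S b₀ with
  | zero => omega
  | @succ j q q' hst hd ih =>
    rcases Nat.lt_succ_iff_lt_or_eq.1 hlt with h1 | h1
    · exact hd.zero_of_bad (fun S b hS hlt => ih hS hlt) hS h1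
    · by_cases hsup : S ⊆ Finset.Icc 1 m
      swap
      · exact hd.supp (hst.supp h0) S (by tauto)
      obtain ⟨hmem, hi, hc, hr⟩ := hS
      have hpos := (Finset.mem_Icc.1 (hsup hmem)).1
      obtain ⟨lo, h2, h3, h4⟩ := exists_lower (C := S.filter (· < b₀)) hpos
      have hbhi : b₀ < hi := by
        rcases Finset.mem_insert.1 hc.mem with h5 | h5
        · have := (Finset.mem_Icc.1 (hsup hmem)).2; omega
        · exact (Finset.mem_filter.1 h5).2
      rw [h1] at hc
      have hg := hc.gap (A := S.filter (· < b₀)) (fun a ha => by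
          have ha := Finset.mem_filter.1 ha
          exact ⟨(Finset.mem_Icc.1 (hsup ha.1)).1, ha.2.trans hbhi⟩) h2
        (fun a ha => h4 a ha (Finset.mem_filter.1 ha).2) (by omega)
      have e : insert b₀ (S.filter (· < b₀) ∪ S.filter (b₀ < ·)) = S := by
        ext x
        simp only [Finset.mem_insert, Finset.mem_union, Finset.mem_filter]
        constructor
        · rintro (rfl | h | h)
          · exact hmem
          · exact h.1
          · exact h.1
        · intro hx
          rcases lt_trichotomy x b₀ with h | h | h <;> tauto
      rw [← e]
      exact hd.unreachable (hst.supp h0) hg h3 hbhi hr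

/-- In a set that is not bad, the minimum can be removed. -/
theorem exists_min_insert {S : Finset ℕ} {k : ℕ} (hS : S ⊆ Finset.Icc 1 m) (hk : S.card = k + 1)
    (hgood : ∀ b, ¬ Bad T H m S b) :
    ∃ B b hi, insert b B = S ∧ Context m k B hi ∧ 1 ≤ b ∧ Reach T H b hi ∧ (∀ x ∈ B, b < x) ∧
      ∀ b, ¬ Bad T H m B b := by
  have hne : S.Nonempty := Finset.card_pos.1 (by omega)
  set b := S.min' hne with hb
  have hbS : b ∈ S := Finset.min'_mem _ _
  have hf : S.filter (b < ·) = S.erase b := by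
    ext x
    simp only [Finset.mem_filter, Finset.mem_erase]
    constructor
    · rintro ⟨h1, h2⟩; exact ⟨by omega, h1⟩
    · rintro ⟨h1, h2⟩; exact ⟨h2, lt_of_le_of_ne (Finset.min'_le _ _ h2) (Ne.symm h1)⟩
  have hcard : (S.erase b).card = k := by rw [Finset.card_erase_of_mem hbS]; omega
  obtain ⟨hi, hc⟩ : ∃ hi, Context m k (S.erase b) hi := by
    have hs := (Finset.erase_subset b S).trans hS
    by_cases hne' : (S.erase b).Nonempty
    · exact ⟨(S.erase b).min' hne', hs, Finset.mem_insert_of_mem (Finset.min'_mem _ _),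
        fun x hx => Finset.min'_le _ _ hx, hcard⟩
    · rw [Finset.not_nonempty_iff_eq_empty] at hne'
      rw [hne'] at hcard ⊢
      exact ⟨m + 1, by simp, by simp, by simp, hcard⟩
  refine ⟨S.erase b, b, hi, Finset.insert_erase hbS, hc, (Finset.mem_Icc.1 (hS hbS)).1, ?_, ?_, ?_⟩
  · by_contra hr
    exact hgood b ⟨hbS, hi, by rw [hf, hcard]; exact hc, hr⟩
  · intro x hx
    rw [← hf] at hx
    exact (Finset.mem_filter.1 hx).2
  · rintro c ⟨hcB, hi', hc', hr⟩
    refine hgood c ⟨Finset.mem_of_mem_erase hcB, hi', ?_, hr⟩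
    have hbc : b < c := by rw [← hf] at hcB; exact (Finset.mem_filter.1 hcB).2
    have : S.filter (c < ·) = (S.erase b).filter (c < ·) := by
      ext x
      simp only [Finset.mem_filter, Finset.mem_erase]
      constructor
      · rintro ⟨h1, h2⟩; exact ⟨⟨by omega, h1⟩, h2⟩
      · rintro ⟨⟨_, h1⟩, h2⟩; exact ⟨h1, h2⟩
    rw [this]
    exact hc'

/-- Induction on the size of the context, by removing its first arc `b`: stage `j` expresses the
cost in the larger context as a difference of two costs in the smaller one. Linear costs give a
difference in which `R` cancels; from then on the two costs are equal constants. -/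
theorem Stages.walkCost_const (h0 : Supp m d q₀) {c : ℕ → ℝ}
    (hc : ∀ P, LWalk T H 0 (m + 1) P → walkCost q₀ ∅ P = ∑ a ∈ P, c a) :
    ∀ j q, Stages T H m d q₀ (j + 1) q → ∀ B hi, Context m (j + 1) B hi →
      (∀ b, ¬ Bad T H m B b) →
      ∃ r : ℝ, (1 ≤ j → r = 0) ∧ ∀ R, LWalk T H 0 hi R → walkCost q B R = r := by
  intro j
  induction j with
  | zero =>
    intro q hst B hi hB hgood
    obtain _ | ⟨hst, hd⟩ := hst
    cases hst
    obtain ⟨B', b, hi', rfl, hB', hb1, hr, hlt, hgood'⟩ := exists_min_insert hB.sub hB.card hgood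
    obtain rfl : B' = ∅ := Finset.card_eq_zero.1 hB'.card
    obtain rfl : hi' = m + 1 := by simpa using hB'.mem
    obtain rfl : hi = b := by
      have h1 := hB.hi_le
      have h2 := hB.mem
      have h3 := hB.le b (by simp)
      have := hr.lt
      simp at h2
      omega
    obtain ⟨R₁, R₂, hR₁, hR₂, hw⟩ := hd.walkCost_insert h0 hB' hr
    -- The cost of `b` (now called `hi`) and its canonical continuation, minus the cost of the
    -- detour; both sums are independent of `R`.
    refine ⟨∑ a ∈ insert hi R₁, c a - ∑ a ∈ R₂, c a, by simp, fun R hR => ?_⟩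
    obtain ⟨h1, h2, h3⟩ := hw R hR
    rw [h3, hc _ h1, hc _ h2, Finset.sum_union, Finset.sum_union]
    · ring
    · rw [Finset.disjoint_left]
      intro x hx hx'
      have := hR.mem x hx; have := hR₂ x hx'; omega
    · rw [Finset.disjoint_left]
      intro x hx hx'
      have := hR.mem x hx
      rcases Finset.mem_insert.1 hx' with rfl | hx'
      · omega
      · have := hR₁ x hx'; omega
  | succ j ih =>
    intro q' hst B hi hB hgood
    refine ⟨0, fun _ => rfl, ?_⟩
    obtain _ | ⟨hst, hd⟩ := hst
    obtain ⟨B', b, hi', rfl, hB', hb1, hr, hlt, hgood'⟩ := exists_min_insert hB.sub hB.card hgood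
    obtain ⟨r, -, hr'⟩ := ih _ hst B' hi' hB' hgood'
    obtain rfl : hi = b := by
      have h1 := hB.hi_le
      have h3 := hB.le b (by simp)
      have h4 := Finset.mem_Icc.1 (hB.sub (Finset.mem_insert_self b B'))
      have h2 : hi ∈ insert b B' := (Finset.mem_insert.1 hB.mem).resolve_left (by omega)
      rcases Finset.mem_insert.1 h2 with h2 | h2
      · exact h2
      · have := hlt _ h2; omega
    intro R hR
    obtain ⟨R₁, R₂, hR₁, hR₂, hw⟩ := hd.walkCost_insert (hst.supp h0) hB' hr
    obtain ⟨h1, h2, h3⟩ := hw R hR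
    rw [h3, hr' _ h1, hr' _ h2, sub_self]

/-- By covering there is a canonical walk `R` to the first arc of `S`. After stage `S.card` each `A
∪ S` with nonempty `A ⊆ R` has coefficient `0`, so `q S` equals the cost of `R` in the context `S`.
The stage preserves this cost, and it was `0` before because `S` has at least two arcs. Later stages
leave `S` alone. -/
theorem Stages.zero_of_good (h0 : Supp m d q₀) {c : ℕ → ℝ}
    (hc : ∀ P, LWalk T H 0 (m + 1) P → walkCost q₀ ∅ P = ∑ a ∈ P, c a)
    (hcov : ∀ b, 1 ≤ b → b ≤ m → Reach T H 0 b) (h : Stages T H m d q₀ j q) {S : Finset ℕ}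
    (hS : S ⊆ Finset.Icc 1 m) (hgood : ∀ b, ¬ Bad T H m S b) (h2 : 2 ≤ S.card) (hj : S.card < j) :
    q S = 0 := by
  induction h with
  | zero => omega
  | @succ j q q' hst hd ih =>
    rcases Nat.lt_succ_iff_lt_or_eq.1 hj with h1 | h1
    · rw [hd.other h1, ih h1]
    · obtain ⟨i, rfl⟩ : ∃ i, j = i + 1 := Nat.exists_eq_add_one.2 (by omega)
      have hne : S.Nonempty := Finset.card_pos.1 (by omega)
      have hmem := Finset.min'_mem S hne
      have hB : Context m (i + 1) S (S.min' hne) :=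
        ⟨hS, Finset.mem_insert_of_mem hmem, fun x hx => Finset.min'_le _ _ hx, h1⟩
      obtain ⟨r, hr0, hr⟩ := Stages.walkCost_const h0 hc i q hst S _ hB hgood
      obtain ⟨R, hR, hbas⟩ :=
        (hcov _ (Finset.mem_Icc.1 (hS hmem)).1 (Finset.mem_Icc.1 (hS hmem)).2).canonical
      have e := hr R hR
      rw [hr0 (by omega), ← hd.walkCost_eq hB hR] at e
      rw [← e]
      have := walkCost_union q' S (R := ∅) (R' := R) (by simp) ?_
      · rw [Finset.empty_union] at this
        rw [this]
        simp [walkCost]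
      · intro A hA b hb hlt
        have hbm := hR.mem b hb
        rw [Finset.empty_union] at hA
        obtain ⟨lo, h3, h4, h5⟩ := exists_lower (C := A) hbm.1
        have hg := hB.gap (A := A) (fun a ha => hR.mem a (hA ha)) h3
          (fun a ha => h5 a ha (hlt a ha)) hR.lt
        rw [Finset.insert_union]
        exact hd.basic (hst.supp h0) hg h4 hbm.2 (hbas b hb)

/-- If the cost function is linearizable, the normalized coefficients of order at least `2`
vanish. -/
theorem Stages.eq_zero (h0 : Supp m d q₀) {c : ℕ → ℝ}
    (hc : ∀ P, LWalk T H 0 (m + 1) P → walkCost q₀ ∅ P = ∑ a ∈ P, c a)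
    (hcov : ∀ b, 1 ≤ b → b ≤ m → Reach T H 0 b) (h : Stages T H m d q₀ (d + 1) q) {S : Finset ℕ}
    (h2 : 2 ≤ S.card) : q S = 0 := by
  by_cases hS : S ⊆ Finset.Icc 1 m ∧ S.card ≤ d
  swap
  · exact h.supp h0 S hS
  by_cases hb : ∃ b, Bad T H m S b
  · obtain ⟨b, hb⟩ := hb
    refine h.zero_of_bad h0 hb ?_
    have := Finset.card_filter_le S (b < ·)
    omega
  · exact Stages.zero_of_good h0 hc hcov h hS.1 (not_exists.1 hb) h2 (by omega)

/-- If the normalized coefficients of order at least `2` vanish, the others give the cost of every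
walk. -/
theorem Stages.total_eq_linear (h : Stages T H m d q₀ j q) (hz : ∀ S, 2 ≤ S.card → q S = 0)
    {P : Finset ℕ} (hP : LWalk T H 0 (m + 1) P) :
    walkCost q₀ ∅ P = q ∅ + ∑ a ∈ P, q {a} := by
  rw [← h.total_eq hP]
  simp only [walkCost, Finset.union_empty]
  have : ∑ a ∈ P, q {a} = ∑ S ∈ P.powersetCard 1, q S := by
    rw [Finset.powersetCard_one, Finset.sum_map]; rfl
  rw [this, ← Finset.sum_insert (by simp)]
  symm
  apply Finset.sum_subset
  · intro S hS
    rcases Finset.mem_insert.1 hS with rfl | hS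
    · simp
    · exact Finset.mem_powerset.2 (Finset.mem_powersetCard.1 hS).1
  · intro S hS hS'
    apply hz
    simp only [Finset.mem_insert, Finset.mem_powersetCard, not_or, not_and] at hS'
    have h1 := hS'.2 (Finset.mem_powerset.1 hS)
    have h2 : S.card ≠ 0 := fun h => hS'.1 (Finset.card_eq_zero.1 h)
    omega

end LinSPP

namespace LinSPP

/-! ### Reasoning about programs -/

namespace State

/-- The state after writing `v` into word register `x`. -/
def w (σ : State) (x v : ℕ) : State := { σ with word := Function.update σ.word x v }
/-- The state after writing `v` into real register `x`. -/
noncomputable def r (σ : State) (x : ℕ) (v : ℝ) : State :=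
  { σ with real := Function.update σ.real x v }
/-- The state after writing `v` into cell `i` of the word array `a`. -/
def wa (σ : State) (a i v : ℕ) : State :=
  { σ with wordArr := Function.update σ.wordArr a (Function.update (σ.wordArr a) i v) }
/-- The state after writing `v` into cell `i` of the real array `a`. -/
noncomputable def ra (σ : State) (a i : ℕ) (v : ℝ) : State :=
  { σ with realArr := Function.update σ.realArr a (Function.update (σ.realArr a) i v) }

variable (σ : State) (x y a b i v : ℕ) (c : ℝ)

@[simp] theorem w_word : (σ.w x v).word y = if y = x then v else σ.word y := by
  simp [w, Function.update_apply]
@[simp] theorem w_real : (σ.w x v).real = σ.real := rfl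
@[simp] theorem w_wordArr : (σ.w x v).wordArr = σ.wordArr := rfl
@[simp] theorem w_realArr : (σ.w x v).realArr = σ.realArr := rfl
@[simp] theorem r_word : (σ.r x c).word = σ.word := rfl
@[simp] theorem r_real : (σ.r x c).real y = if y = x then c else σ.real y := by
  simp [r, Function.update_apply]
@[simp] theorem r_wordArr : (σ.r x c).wordArr = σ.wordArr := rfl
@[simp] theorem r_realArr : (σ.r x c).realArr = σ.realArr := rfl
@[simp] theorem wa_word : (σ.wa a i v).word = σ.word := rfl
@[simp] theorem wa_real : (σ.wa a i v).real = σ.real := rfl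
@[simp] theorem wa_wordArr : (σ.wa a i v).wordArr b =
    if b = a then Function.update (σ.wordArr a) i v else σ.wordArr b := by
  simp [wa, Function.update_apply]
@[simp] theorem wa_realArr : (σ.wa a i v).realArr = σ.realArr := rfl
@[simp] theorem ra_word : (σ.ra a i c).word = σ.word := rfl
@[simp] theorem ra_real : (σ.ra a i c).real = σ.real := rfl
@[simp] theorem ra_wordArr : (σ.ra a i c).wordArr = σ.wordArr := rfl
@[simp] theorem ra_realArr : (σ.ra a i c).realArr b =
    if b = a then Function.update (σ.realArr a) i c else σ.realArr b := by
  simp [ra, Function.update_apply]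

end State

/-- The condition on `σ` under which `o` runs without overflow into a state satisfying `Q`. -/
def Op.wp (W : ℕ) (σ : State) (Q : State → Prop) : Op → Prop
  | .const x k => k ≤ W ∧ Q (σ.w x k)
  | .move x y => σ.word y ≤ W ∧ Q (σ.w x (σ.word y))
  | .add x y z => σ.word y + σ.word z ≤ W ∧ Q (σ.w x (σ.word y + σ.word z))
  | .sub x y z => σ.word y - σ.word z ≤ W ∧ Q (σ.w x (σ.word y - σ.word z))
  | .mul x y z => σ.word y * σ.word z ≤ W ∧ Q (σ.w x (σ.word y * σ.word z))
  | .load x a y => σ.wordArr a (σ.word y) ≤ W ∧ Q (σ.w x (σ.wordArr a (σ.word y)))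
  | .store a y x => Q (σ.wa a (σ.word y) (σ.word x))
  | .rmove x y => Q (σ.r x (σ.real y))
  | .radd x y z => Q (σ.r x (σ.real y + σ.real z))
  | .rsub x y z => Q (σ.r x (σ.real y - σ.real z))
  | .rload x a y => Q (σ.r x (σ.realArr a (σ.word y)))
  | .rstore a y x => Q (σ.ra a (σ.word y) (σ.real x))

theorem Op.run_of_wp {W : ℕ} {σ : State} {Q : State → Prop} {o : Op} (h : o.wp W σ Q) :
    ∃ τ, o.run W σ = some τ ∧ Q τ := by
  cases o <;> simp only [Op.wp] at h <;>
    simp only [Op.run, State.setWord, State.setReal, Option.some.injEq, exists_eq_left'] <;>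
    first
    | exact h
    | (rw [if_pos h.1]; exact ⟨_, rfl, h.2⟩)

/-- `p` halts within `t` steps in a state satisfying `Q`. -/
def Runs (W : ℕ) (p : Prog) (σ : State) (t : ℕ) (Q : State → Prop) : Prop :=
  ∃ k τ, Exec W p σ k τ ∧ k ≤ t ∧ Q τ

namespace Prog

/-- Sequential composition of a list of programs. -/
def block : List Prog → Prog
  | [] => .skip
  | p :: l => .seq p (block l)

/-- The weakest precondition of a program without loops. -/
def wp (W : ℕ) : Prog → State → (State → Prop) → Prop
  | skip, σ, Q => Q σ
  | op o, σ, Q => o.wp W σ Q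
  | seq p p', σ, Q => p.wp W σ fun ρ => p'.wp W ρ Q
  | ite b p p', σ, Q => (b.Holds σ → p.wp W σ Q) ∧ (¬ b.Holds σ → p'.wp W σ Q)
  | .while _ _, _, _ => False

/-- An upper bound on the running time of a program without loops. -/
def steps : Prog → ℕ
  | skip => 1
  | op _ => 1
  | seq p p' => p.steps + p'.steps
  | ite _ p p' => max p.steps p'.steps + 1
  | .while _ _ => 0

/-- The word registers, real registers, word arrays and real arrays to which `p` may write. -/
def mods : Prog → List ℕ × List ℕ × List ℕ × List ℕ
  | skip => ([], [], [], [])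
  | op (.const x _) => ([x], [], [], [])
  | op (.move x _) => ([x], [], [], [])
  | op (.add x _ _) => ([x], [], [], [])
  | op (.sub x _ _) => ([x], [], [], [])
  | op (.mul x _ _) => ([x], [], [], [])
  | op (.load x _ _) => ([x], [], [], [])
  | op (.store a _ _) => ([], [], [a], [])
  | op (.rmove x _) => ([], [x], [], [])
  | op (.radd x _ _) => ([], [x], [], [])
  | op (.rsub x _ _) => ([], [x], [], [])
  | op (.rload x _ _) => ([], [x], [], [])
  | op (.rstore a _ _) => ([], [], [], [a])
  | seq p p' => (p.mods.1 ++ p'.mods.1, p.mods.2.1 ++ p'.mods.2.1, p.mods.2.2.1 ++ p'.mods.2.2.1,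
      p.mods.2.2.2 ++ p'.mods.2.2.2)
  | ite _ p p' => (p.mods.1 ++ p'.mods.1, p.mods.2.1 ++ p'.mods.2.1,
      p.mods.2.2.1 ++ p'.mods.2.2.1, p.mods.2.2.2 ++ p'.mods.2.2.2)
  | .while _ p => p.mods

end Prog

/-- `σ` and `τ` agree on all that `p` does not modify. -/
structure Frame (p : Prog) (σ τ : State) : Prop where
  word : ∀ x, x ∉ p.mods.1 → τ.word x = σ.word x
  real : ∀ x, x ∉ p.mods.2.1 → τ.real x = σ.real x
  wordArr : ∀ x, x ∉ p.mods.2.2.1 → τ.wordArr x = σ.wordArr x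
  realArr : ∀ x, x ∉ p.mods.2.2.2 → τ.realArr x = σ.realArr x

theorem Frame.refl (p : Prog) (σ : State) : Frame p σ σ :=
  ⟨fun _ _ => rfl, fun _ _ => rfl, fun _ _ => rfl, fun _ _ => rfl⟩

theorem Frame.trans {p : Prog} {σ ρ τ : State} (h : Frame p σ ρ) (h' : Frame p ρ τ) :
    Frame p σ τ :=
  ⟨fun x hx => (h'.word x hx).trans (h.word x hx), fun x hx => (h'.real x hx).trans (h.real x hx),
    fun x hx => (h'.wordArr x hx).trans (h.wordArr x hx),
    fun x hx => (h'.realArr x hx).trans (h.realArr x hx)⟩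

theorem Frame.op {W : ℕ} {o : Op} {σ τ : State} (h : o.run W σ = some τ) :
    Frame (.op o) σ τ := by
  cases o <;> simp only [Op.run, State.setWord, State.setReal] at h <;>
    (try split_ifs at h) <;> (try cases h) <;>
    constructor <;> intro x hx <;> simp [Prog.mods, Function.update_apply] at hx ⊢ <;>
    intro hx' <;> exact absurd hx' hx

/-- The sets of cells written are syntactic, so `decide` establishes later that data survive a whole
subprogram, loops included. -/
theorem Exec.frame {W : ℕ} {p : Prog} {σ τ : State} {k : ℕ} (h : Exec W p σ k τ) :
    Frame p σ τ := by
  induction h with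
  | skip => exact .refl _ _
  | op h => exact .op h
  | seq _ _ ih ih' =>
    constructor <;> intro x hx <;> simp only [Prog.mods, List.mem_append, not_or] at hx
    · exact (ih'.word x hx.2).trans (ih.word x hx.1)
    · exact (ih'.real x hx.2).trans (ih.real x hx.1)
    · exact (ih'.wordArr x hx.2).trans (ih.wordArr x hx.1)
    · exact (ih'.realArr x hx.2).trans (ih.realArr x hx.1)
  | iteTrue _ _ ih =>
    constructor <;> intro x hx <;> simp only [Prog.mods, List.mem_append, not_or] at hx
    · exact ih.word x hx.1
    · exact ih.real x hx.1
    · exact ih.wordArr x hx.1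
    · exact ih.realArr x hx.1
  | iteFalse _ _ ih =>
    constructor <;> intro x hx <;> simp only [Prog.mods, List.mem_append, not_or] at hx
    · exact ih.word x hx.2
    · exact ih.real x hx.2
    · exact ih.wordArr x hx.2
    · exact ih.realArr x hx.2
  | whileFalse _ => exact .refl _ _
  | whileTrue _ _ _ ih ih' => exact Frame.trans (p := .while _ _) ⟨ih.1, ih.2, ih.3, ih.4⟩ ih'

namespace Runs

variable {W : ℕ} {p p' : Prog} {σ : State} {t t' : ℕ} {Q Q' : State → Prop}

theorem mono (h : Runs W p σ t Q) (ht : t ≤ t') (hQ : ∀ τ, Frame p σ τ → Q τ → Q' τ) :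
    Runs W p σ t' Q' := by
  obtain ⟨k, τ, h1, h2, h3⟩ := h
  exact ⟨k, τ, h1, h2.trans ht, hQ τ h1.frame h3⟩

theorem skip (h : Q σ) : Runs W .skip σ 1 Q := ⟨1, σ, .skip, le_rfl, h⟩

theorem seq (h : Runs W p σ t fun ρ => Runs W p' ρ t' Q) : Runs W (.seq p p') σ (t + t') Q := by
  obtain ⟨k, ρ, h1, h2, l, τ, h3, h4, h5⟩ := h
  exact ⟨k + l, τ, .seq h1 h3, by omega, h5⟩

theorem ite {b : Test} (h : b.Holds σ → Runs W p σ t Q) (h' : ¬ b.Holds σ → Runs W p' σ t Q) :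
    Runs W (.ite b p p') σ (t + 1) Q := by
  by_cases hb : b.Holds σ
  · obtain ⟨k, τ, h1, h2, h3⟩ := h hb
    exact ⟨_, τ, .iteTrue hb h1, by omega, h3⟩
  · obtain ⟨k, τ, h1, h2, h3⟩ := h' hb
    exact ⟨_, τ, .iteFalse hb h1, by omega, h3⟩

theorem nil (h : Q σ) : Runs W (.block []) σ 1 Q := skip h

theorem cons {l : List Prog} (h : Runs W p σ t fun ρ => Frame p σ ρ → Runs W (.block l) ρ t' Q) :
    Runs W (.block (p :: l)) σ (t + t') Q :=
  seq (h.mono le_rfl fun _ hf hr => hr hf)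

theorem of_wp (h : p.wp W σ Q) : Runs W p σ p.steps Q := by
  induction p generalizing σ Q with
  | skip => exact skip h
  | op o =>
    obtain ⟨τ, h1, h2⟩ := Op.run_of_wp h
    exact ⟨1, τ, .op h1, le_rfl, h2⟩
  | seq p p' ih ih' =>
    exact seq ((ih h).mono le_rfl fun ρ _ hρ => ih' hρ)
  | ite b p p' ih ih' =>
    refine ite (fun hb => (ih (h.1 hb)).mono (le_max_left _ _) fun _ _ h => h)
      (fun hb => (ih' (h.2 hb)).mono (le_max_right _ _) fun _ _ h => h)
  | _ => exact h.elim

/-- A counting loop. -/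
theorem loop {b : Test} {Inv : ℕ → State → Prop} {N t : ℕ} (h0 : Inv 0 σ)
    (hstep : ∀ i < N, ∀ ρ, Frame p σ ρ → Inv i ρ →
      b.Holds ρ ∧ Runs W p ρ t fun τ => Frame p σ τ → Inv (i + 1) τ)
    (hend : ∀ ρ, Frame p σ ρ → Inv N ρ → ¬ b.Holds ρ) :
    Runs W (.while b p) σ (N * (t + 1) + 1) (Inv N) := by
  -- Induction on the number `n` of rounds that remain.
  suffices H : ∀ n ≤ N, ∀ ρ, Frame p σ ρ → Inv (N - n) ρ →
      Runs W (.while b p) ρ (n * (t + 1) + 1) (Inv N) from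
    H N le_rfl σ (.refl _ _) (by simpa using h0)
  intro n
  induction n with
  | zero =>
    intro _ ρ hf hi
    exact ⟨1, ρ, .whileFalse (hend ρ hf hi), by simp, hi⟩
  | succ n ih =>
    intro hn ρ hf hi
    obtain ⟨hb, k, τ, h1, h2, h3⟩ := hstep (N - (n + 1)) (by omega) ρ hf hi
    have hf' := hf.trans h1.frame
    have h3' := h3 hf'
    rw [show N - (n + 1) + 1 = N - n by omega] at h3'
    obtain ⟨l, τ', h4, h5, h6⟩ := ih (by omega) τ hf' h3'
    exact ⟨_, τ', .whileTrue hb h1 h4, by rw [Nat.succ_mul]; omega, h6⟩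

end Runs

end LinSPP

namespace LinSPP

/-! ### Ranking and unranking of finite sets -/

/-- The `r`-th subset of `{1, …, p}` of cardinality `k` in colexicographic order. -/
def unrank : ℕ → ℕ → ℕ → Finset ℕ
  | 0, _, _ => ∅
  | p + 1, k, r => if r < p.choose k then unrank p k r
      else insert (p + 1) (unrank p (k - 1) (r - p.choose k))

theorem unrank_mem : ∀ {p k r : ℕ}, r < p.choose k →
    unrank p k r ∈ (Finset.Icc 1 p).powersetCard k := by
  intro p
  induction p with
  | zero =>
    intro k r h
    cases k with
    | zero => simp [unrank]
    | succ k => simp at h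
  | succ p ih =>
    intro k r h
    have hmono : Finset.Icc 1 p ⊆ Finset.Icc 1 (p + 1) := Finset.Icc_subset_Icc_right (by omega)
    rw [unrank]
    split_ifs with h1
    · exact Finset.powersetCard_mono hmono (ih h1)
    · obtain _ | k := k
      · simp at h h1; omega
      · rw [Nat.choose_succ_succ'] at h
        have := ih (k := k) (r := r - p.choose (k + 1)) (by omega)
        rw [Nat.add_sub_cancel]
        obtain ⟨h2, h3⟩ := Finset.mem_powersetCard.1 this
        rw [Finset.mem_powersetCard]
        constructor
        · exact Finset.insert_subset (by simp) (h2.trans hmono)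
        · rw [Finset.card_insert_of_notMem, h3]
          intro h4
          have := Finset.mem_Icc.1 (h2 h4)
          omega

theorem exists_unrank : ∀ {p k : ℕ} {S : Finset ℕ}, S ∈ (Finset.Icc 1 p).powersetCard k →
    ∃ r < p.choose k, unrank p k r = S := by
  intro p
  induction p with
  | zero =>
    intro k S h
    simp only [Finset.mem_powersetCard] at h
    obtain rfl : S = ∅ := Finset.subset_empty.1 (by simpa using h.1)
    simp only [Finset.card_empty] at h
    rw [← h.2]
    exact ⟨0, by simp, rfl⟩
  | succ p ih =>
    intro k S h
    obtain ⟨h1, h2⟩ := Finset.mem_powersetCard.1 h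
    by_cases hp : p + 1 ∈ S
    · obtain ⟨k, rfl⟩ : ∃ k', k = k' + 1 :=
        Nat.exists_eq_add_one.2 (by rw [← h2]; exact Finset.card_pos.2 ⟨_, hp⟩)
      obtain ⟨r, hr, e⟩ := ih (k := k) (S := S.erase (p + 1)) (by
        rw [Finset.mem_powersetCard, Finset.card_erase_of_mem hp]
        refine ⟨fun x hx => ?_, by omega⟩
        have := Finset.mem_Icc.1 (h1 (Finset.mem_of_mem_erase hx))
        have := Finset.ne_of_mem_erase hx
        exact Finset.mem_Icc.2 ⟨by omega, by omega⟩)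
      refine ⟨r + p.choose (k + 1), by rw [Nat.choose_succ_succ']; omega, ?_⟩
      rw [unrank, if_neg (by omega), Nat.add_sub_cancel, Nat.add_sub_cancel, e,
        Finset.insert_erase hp]
    · obtain ⟨r, hr, e⟩ := ih (k := k) (S := S) (by
        rw [Finset.mem_powersetCard]
        refine ⟨fun x hx => ?_, h2⟩
        have := Finset.mem_Icc.1 (h1 hx)
        have : x ≠ p + 1 := fun h => hp (h ▸ hx)
        exact Finset.mem_Icc.2 ⟨by omega, by omega⟩)
      refine ⟨r, hr.trans_le (Nat.choose_le_choose k (by omega)), ?_⟩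
      rw [unrank, if_pos hr, e]

/-- `unrank` maps `p.choose k` numbers onto `p.choose k` sets. -/
theorem unrank_inj {p k r r' : ℕ} (hr : r < p.choose k) (hr' : r' < p.choose k)
    (h : unrank p k r = unrank p k r') : r = r' := by
  have := Finset.injOn_of_surjOn_of_card_le (s := Finset.range (p.choose k))
    (t := (Finset.Icc 1 p).powersetCard k) (unrank p k)
    (fun r hr => unrank_mem (by simpa using hr))
    (fun S hS => by
      obtain ⟨r, hr, e⟩ := exists_unrank (Finset.mem_coe.1 hS)
      exact ⟨r, by simpa using hr, e⟩)
    (by simp)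
  exact this (by simpa using hr) (by simpa using hr') h

/-- The colexicographic position of `B` among the sets of the same cardinality. -/
def colexRank (B : Finset ℕ) : ℕ := ∑ b ∈ B, b.choose (B.filter (· ≤ b)).card

/-- The position of `B` among the subsets of `{0, …, m - 1}`. -/
def setRank (m : ℕ) (B : Finset ℕ) : ℕ := ∑ j ∈ Finset.range B.card, m.choose j + colexRank B

theorem colexRank_insert {p : ℕ} {B : Finset ℕ} (hB : B ⊆ Finset.range p) :
    colexRank (insert p B) = colexRank B + p.choose (B.card + 1) := by
  have hp : p ∉ B := fun h => by simpa using hB h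
  rw [colexRank, Finset.sum_insert hp, add_comm]
  congr 1
  · apply Finset.sum_congr rfl
    intro b hb
    have := Finset.mem_range.1 (hB hb)
    rw [Finset.filter_insert, if_neg (by omega)]
  · congr 1
    rw [Finset.filter_true_of_mem, Finset.card_insert_of_notMem hp]
    intro b hb
    rcases Finset.mem_insert.1 hb with rfl | hb
    · exact le_rfl
    · exact (Finset.mem_range.1 (hB hb)).le

theorem erase_subset_range {p : ℕ} {B : Finset ℕ} (hB : B ⊆ Finset.range (p + 1)) :
    B.erase p ⊆ Finset.range p := by
  intro x hx
  have := Finset.mem_range.1 (hB (Finset.mem_of_mem_erase hx))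
  have := Finset.ne_of_mem_erase hx
  exact Finset.mem_range.2 (by omega)

theorem colexRank_eq {p : ℕ} {B : Finset ℕ} (hB : B ⊆ Finset.range (p + 1)) (hp : p ∈ B) :
    colexRank B = colexRank (B.erase p) + p.choose B.card := by
  have := colexRank_insert (erase_subset_range hB)
  rw [Finset.insert_erase hp, Finset.card_erase_of_mem hp] at this
  rw [this, Nat.sub_add_cancel (Finset.card_pos.2 ⟨_, hp⟩)]

theorem colexRank_lt : ∀ {p : ℕ} {B : Finset ℕ}, B ⊆ Finset.range p →
    colexRank B < p.choose B.card := by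
  intro p
  induction p with
  | zero =>
    intro B h
    obtain rfl : B = ∅ := Finset.subset_empty.1 (by simpa using h)
    simp [colexRank]
  | succ p ih =>
    intro B h
    by_cases hp : p ∈ B
    · have h1 := ih (erase_subset_range h)
      have h2 := Finset.card_erase_add_one hp
      rw [colexRank_eq h hp, ← h2, Nat.choose_succ_succ']
      omega
    · have hB : B ⊆ Finset.range p := by
        rw [← Finset.erase_eq_of_notMem hp]; exact erase_subset_range h
      exact (ih hB).trans_le (Nat.choose_le_choose _ (by omega))

/-- Sets of `k` elements without `p` have rank below `p.choose k`, those with `p` at least this. So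
the rank reveals whether `p` belongs to the set, and one recurses. -/
theorem colexRank_inj : ∀ {p : ℕ} {B B' : Finset ℕ}, B ⊆ Finset.range p → B' ⊆ Finset.range p →
    B.card = B'.card → colexRank B = colexRank B' → B = B' := by
  intro p
  induction p with
  | zero =>
    intro B B' h h' _ _
    rw [Finset.subset_empty.1 (by simpa using h : B ⊆ ∅),
      Finset.subset_empty.1 (by simpa using h' : B' ⊆ ∅)]
  | succ p ih =>
    have key : ∀ {B B' : Finset ℕ}, B ⊆ Finset.range (p + 1) → B' ⊆ Finset.range (p + 1) →
        B.card = B'.card → colexRank B = colexRank B' → p ∈ B → p ∈ B' := by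
      intro B B' h h' hc hr hp
      by_contra hp'
      have hB' : B' ⊆ Finset.range p := by
        rw [← Finset.erase_eq_of_notMem hp']; exact erase_subset_range h'
      have := colexRank_lt hB'
      rw [← hc, ← hr, colexRank_eq h hp] at this
      omega
    intro B B' h h' hc hr
    by_cases hp : p ∈ B
    · have hp' := key h h' hc hr hp
      have : B.erase p = B'.erase p := by
        apply ih (erase_subset_range h) (erase_subset_range h')
        · rw [Finset.card_erase_of_mem hp, Finset.card_erase_of_mem hp', hc]
        · rw [colexRank_eq h hp, colexRank_eq h' hp', hc] at hr
          omega
      rw [← Finset.insert_erase hp, this, Finset.insert_erase hp']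
    · have hp' : p ∉ B' := fun hp' => hp (key h' h hc.symm hr.symm hp')
      apply ih _ _ hc hr
      · rw [← Finset.erase_eq_of_notMem hp]; exact erase_subset_range h
      · rw [← Finset.erase_eq_of_notMem hp']; exact erase_subset_range h'

theorem sum_choose_mono (m : ℕ) {a b : ℕ} (h : a ≤ b) :
    ∑ j ∈ Finset.range a, m.choose j ≤ ∑ j ∈ Finset.range b, m.choose j :=
  Finset.sum_le_sum_of_subset (Finset.range_mono h)

theorem setRank_lt {m d : ℕ} {B : Finset ℕ} (hB : B ⊆ Finset.range m) (hd : B.card ≤ d) :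
    setRank m B < ∑ j ∈ Finset.range (d + 1), m.choose j := by
  refine lt_of_lt_of_le ?_ (sum_choose_mono m (Nat.succ_le_succ hd))
  rw [setRank, Finset.sum_range_succ]
  exact Nat.add_lt_add_left (colexRank_lt hB) _

theorem setRank_inj {m : ℕ} {B B' : Finset ℕ} (hB : B ⊆ Finset.range m)
    (hB' : B' ⊆ Finset.range m) (h : setRank m B = setRank m B') : B = B' := by
  have key : ∀ {B B' : Finset ℕ}, B ⊆ Finset.range m → setRank m B = setRank m B' →
      ¬ B.card < B'.card := by
    intro B B' hB h hc
    have h1 := setRank_lt hB le_rfl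
    have h2 := sum_choose_mono m hc
    rw [h, setRank] at h1
    simp only [Nat.succ_eq_add_one] at h2
    omega
  have hc : B.card = B'.card := by
    have := key hB h
    have := key hB' h.symm
    omega
  apply colexRank_inj hB hB' hc
  rw [setRank, setRank, hc] at h
  omega

/-- Within one cardinality `colexRank` is injective into a range with as many elements as there are
sets, hence onto. -/
theorem exists_setRank {m : ℕ} : ∀ {d r : ℕ}, r < ∑ j ∈ Finset.range d, m.choose j →
    ∃ B ⊆ Finset.range m, B.card < d ∧ setRank m B = r := by
  intro d
  induction d with
  | zero => simp
  | succ d ih =>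
    intro r hr
    by_cases h : r < ∑ j ∈ Finset.range d, m.choose j
    · obtain ⟨B, h1, h2, h3⟩ := ih h
      exact ⟨B, h1, by omega, h3⟩
    · rw [Finset.sum_range_succ] at hr
      have hs := Finset.surjOn_of_injOn_of_card_le (s := (Finset.range m).powersetCard d)
        (t := Finset.range (m.choose d)) colexRank
        (fun B hB => by
          obtain ⟨h1, h2⟩ := Finset.mem_powersetCard.1 (Finset.mem_coe.1 hB)
          have := colexRank_lt h1
          rw [h2] at this
          simpa using this)
        (fun B hB B' hB' e => by
          obtain ⟨h1, h2⟩ := Finset.mem_powersetCard.1 (Finset.mem_coe.1 hB)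
          obtain ⟨h3, h4⟩ := Finset.mem_powersetCard.1 (Finset.mem_coe.1 hB')
          exact colexRank_inj h1 h3 (h2.trans h4.symm) e)
        (by simp)
      obtain ⟨B, hB, e⟩ := hs (a := r - ∑ j ∈ Finset.range d, m.choose j)
        (by simp only [Finset.coe_range, Set.mem_Iio]; omega)
      obtain ⟨h1, h2⟩ := Finset.mem_powersetCard.1 (Finset.mem_coe.1 hB)
      refine ⟨B, h1, by omega, ?_⟩
      rw [setRank, h2, e]
      omega

theorem Instance.rank_eq {m : ℕ} (B : Finset (Fin m)) :
    Instance.rank B = setRank m (B.map Fin.valEmbedding) := by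
  rw [Instance.rank, setRank, colexRank, Finset.card_map, Finset.sum_map]
  congr 1
  apply Finset.sum_congr rfl
  intro b _
  rw [Finset.filter_map, Finset.card_map]
  rfl

/-- The rank of a set that is listed without repetitions. -/
theorem setRank_image (m len : ℕ) (y : ℕ → ℕ) (hy : Set.InjOn y (Finset.Icc 1 len)) :
    setRank m ((Finset.Icc 1 len).image y) = ∑ j ∈ Finset.range len, m.choose j +
      ∑ i ∈ Finset.Icc 1 len, (y i).choose ((Finset.Icc 1 len).filter (y · ≤ y i)).card := by
  rw [setRank, colexRank, Finset.card_image_of_injOn hy, Finset.sum_image hy]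
  congr 1
  · simp
  · apply Finset.sum_congr rfl
    intro i _
    rw [Finset.filter_image, Finset.card_image_of_injOn]
    exact hy.mono (by intro x; simp only [Finset.coe_filter]; exact fun h => h.1)

theorem choose_le_sum {m d x k : ℕ} (hx : x ≤ m) (hk : k ≤ d) :
    x.choose k ≤ ∑ j ∈ Finset.range (d + 1), m.choose j :=
  (Nat.choose_le_choose k hx).trans
    (Finset.single_le_sum (f := fun j => m.choose j) (fun _ _ => Nat.zero_le _)
      (Finset.mem_range.2 (Nat.lt_succ_of_le hk)))

theorem index_inj {D x y k z : ℕ} (hk : k < D) (hz : z < D) (h : y * D + z = x * D + k) :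
    y = x ∧ z = k := by
  have h1 := congrArg (· / D) h
  have h2 := congrArg (· % D) h
  have hD : 0 < D := by omega
  simp only [Nat.mul_add_mod_of_lt hk, Nat.mul_add_mod_of_lt hz] at h2
  subst h2
  exact ⟨Nat.eq_of_mul_eq_mul_right hD (by omega), rfl⟩

end LinSPP

namespace LinSPP

/-! ### Common facts about the memory -/

/-- The straight-line program consisting of the operations in the list. -/
def Prog.ops (l : List Op) : Prog := .block (l.map .op)

/-- Words are large enough for `I`. -/
structure Wide (I : Instance) (W : ℕ) : Prop where
  n : I.n ≤ W
  m1 : I.m + 1 ≤ W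
  d1 : I.d + 2 ≤ W
  table : (I.m + 1) * (I.d + 1) ≤ W
  coeffs : ∑ j ∈ Finset.range (I.d + 1), I.m.choose j ≤ W

/-- The memory after preprocessing: word registers `5, …, 8` hold `1`, `0`, `m + 1`, `d + 1`; word
arrays `2` and `3` hold the binomial coefficients and their partial sums; word arrays `4, 5, 6`
hold the arc at each position, its tail and its head. -/
structure Env (I : Instance) (O T H : ℕ → ℕ) (σ : State) : Prop where
  m : σ.word 1 = I.m
  s : σ.word 2 = I.s
  d : σ.word 4 = I.d
  one : σ.word 5 = 1
  zero : σ.word 6 = 0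
  m1 : σ.word 7 = I.m + 1
  d1 : σ.word 8 = I.d + 1
  tails : ∀ a : Fin I.m, σ.wordArr 0 a = I.tail a
  binom : ∀ x ≤ I.m, ∀ k ≤ I.d, σ.wordArr 2 (x * (I.d + 1) + k) = x.choose k
  base : ∀ k ≤ I.d + 1, σ.wordArr 3 k = ∑ j ∈ Finset.range k, I.m.choose j
  arc : σ.wordArr 4 = O
  tail : σ.wordArr 5 = T
  head : σ.wordArr 6 = H
  real : σ.real 0 = 0

/-- `p` leaves the preprocessed data alone. -/
def Prog.Safe (p : Prog) : Prop :=
  (∀ x ∈ [1, 2, 4, 5, 6, 7, 8], x ∉ p.mods.1) ∧ 0 ∉ p.mods.2.1 ∧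
    ∀ x ∈ [0, 2, 3, 4, 5, 6], x ∉ p.mods.2.2.1

instance (p : Prog) : Decidable p.Safe := by unfold Prog.Safe; infer_instance

theorem Env.of_frame {I : Instance} {O T H : ℕ → ℕ} {σ τ : State} {p : Prog} (h : Env I O T H σ)
    (hf : Frame p σ τ) (hp : p.Safe) : Env I O T H τ := by
  obtain ⟨h1, h2, h3⟩ := hp
  have w : ∀ x ∈ [1, 2, 4, 5, 6, 7, 8], τ.word x = σ.word x := fun x hx => hf.word x (h1 x hx)
  have a : ∀ x ∈ [0, 2, 3, 4, 5, 6], τ.wordArr x = σ.wordArr x :=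
    fun x hx => hf.wordArr x (h3 x hx)
  constructor
  · rw [w 1 (by decide), h.m]
  · rw [w 2 (by decide), h.s]
  · rw [w 4 (by decide), h.d]
  · rw [w 5 (by decide), h.one]
  · rw [w 6 (by decide), h.zero]
  · rw [w 7 (by decide), h.m1]
  · rw [w 8 (by decide), h.d1]
  · rw [a 0 (by decide)]; exact h.tails
  · rw [a 2 (by decide)]; exact h.binom
  · rw [a 3 (by decide)]; exact h.base
  · rw [a 4 (by decide), h.arc]
  · rw [a 5 (by decide), h.tail]
  · rw [a 6 (by decide), h.head]
  · rw [hf.real 0 h2, h.real]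

/-! ### Computing the rank of a set of arcs -/

/-- Count an arc of the list that is at most the current one. -/
def rankInner : Prog := .block [.op (.add 26 26 5), .op (.load 27 10 26),
  .ite (.lt 23 27) .skip (.op (.add 25 25 5))]

/-- Add the contribution of one arc of the list. -/
def rankBody : Prog := .block [Prog.ops [.add 22 22 5, .load 23 10 22, .const 25 0, .const 26 0],
  .while (.lt 26 20) rankInner,
  Prog.ops [.mul 24 23 8, .add 24 24 25, .load 27 2 24, .add 21 21 27]]

/-- Word register `21` receives the rank of the set listed in cells `1, …, len` of word array `10`,
where `len` is held in word register `20`. -/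
def rankProg : Prog := .block [Prog.ops [.load 21 3 20, .const 22 0],
  .while (.lt 22 20) rankBody]

variable {I : Instance} {O T H : ℕ → ℕ} {W : ℕ} {σ : State}

theorem rankInner_loop (hW : Wide I W) (hE : Env I O T H σ) {len : ℕ} (hd : len ≤ I.d)
    (hlen : σ.word 20 = len) (hy : ∀ i, 1 ≤ i → i ≤ len → σ.wordArr 10 i < I.m)
    (h25 : σ.word 25 = 0) (h26 : σ.word 26 = 0) :
    Runs W (.while (.lt 26 20) rankInner) σ (len * 7 + 1) fun τ =>
      τ.word 25 = ((Finset.Icc 1 len).filter (σ.wordArr 10 · ≤ σ.word 23)).card := by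
  have hm1 := hW.m1
  have hd1 := hW.d1
  refine (Runs.loop (N := len) (t := 6) (Inv := fun i τ => τ.word 26 = i ∧
    τ.word 25 = ((Finset.Icc 1 i).filter (σ.wordArr 10 · ≤ σ.word 23)).card) ?_ ?_ ?_).mono
    le_rfl fun τ _ h => h.2
  · simp [h25, h26]
  · rintro i hi ρ hf ⟨h1, h2⟩
    have hE' := hE.of_frame hf (by decide)
    have e20 := hf.word 20 (by decide)
    have e23 := hf.word 23 (by decide)
    have e10 := hf.wordArr 10 (by decide)
    refine ⟨by simp [Test.Holds, h1, e20, hlen, hi], ?_⟩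
    refine (Runs.of_wp ?_).mono (by decide) fun τ _ h _ => h
    have hyi := hy (i + 1) (by omega) (by omega)
    have hcard := Finset.card_filter_le (Finset.Icc 1 i) (σ.wordArr 10 · ≤ σ.word 23)
    rw [Nat.card_Icc] at hcard
    have hIcc : Finset.Icc 1 (i + 1) = insert (i + 1) (Finset.Icc 1 i) := by
      ext x; simp only [Finset.mem_Icc, Finset.mem_insert]; omega
    simp [rankInner, Prog.block, Prog.wp, Op.wp, Test.Holds, h1, h2, hE'.one, e23, e10,
      hIcc, Finset.filter_insert]
    refine ⟨by omega, by omega, fun h => ?_, fun h => ⟨by omega, ?_⟩⟩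
    · rw [if_neg (by omega)]
    · rw [if_pos h, Finset.card_insert_of_notMem (by simp)]
  · rintro ρ hf ⟨h1, -⟩
    have e20 := hf.word 20 (by decide)
    simp [Test.Holds, h1, e20, hlen]

/-- The list follows the topological positions, whereas the rank refers to the original arc numbers,
so it need not be sorted. The order index of each arc is therefore counted afresh, which explains
the quadratic time. -/
theorem rankProg_spec (hW : Wide I W) (hE : Env I O T H σ) {len : ℕ} (hd : len ≤ I.d)
    (hlen : σ.word 20 = len) (hy : ∀ i, 1 ≤ i → i ≤ len → σ.wordArr 10 i < I.m)
    (hinj : Set.InjOn (σ.wordArr 10) (Finset.Icc 1 len)) :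
    Runs W rankProg σ (20 * (len + 1) ^ 2) fun τ =>
      τ.word 21 = setRank I.m ((Finset.Icc 1 len).image (σ.wordArr 10)) := by
  have hm1 := hW.m1
  have hd1 := hW.d1
  have hc := hW.coeffs
  have hrank := setRank_image I.m len (σ.wordArr 10) hinj
  have htot := setRank_lt (m := I.m) (d := I.d) (B := (Finset.Icc 1 len).image (σ.wordArr 10))
    (by intro x hx
        obtain ⟨i, hi, rfl⟩ := Finset.mem_image.1 hx
        simp only [Finset.mem_Icc] at hi
        exact Finset.mem_range.2 (hy i hi.1 hi.2))
    (Finset.card_image_le.trans (by simpa using hd))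
  set f : ℕ → ℕ := fun i => (σ.wordArr 10 i).choose
    ((Finset.Icc 1 len).filter (σ.wordArr 10 · ≤ σ.wordArr 10 i)).card with hf
  rw [hrank] at htot
  change _ + ∑ i ∈ Finset.Icc 1 len, f i < _ at htot
  -- Every partial sum is at most the final rank, which is less than the number of coefficients;
  -- hence no overflow.
  have hbound : ∀ i ≤ len, ∑ j ∈ Finset.range len, I.m.choose j + ∑ i ∈ Finset.Icc 1 i, f i ≤ W := by
    intro i hi
    have : ∑ i ∈ Finset.Icc 1 i, f i ≤ ∑ i ∈ Finset.Icc 1 len, f i :=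
      Finset.sum_le_sum_of_subset (Finset.Icc_subset_Icc_right hi)
    omega
  -- The time bound mirrors the nesting of the program; it is simplified only at the end.
  have key : Runs W rankProg σ (5 + ((len * (5 + ((len * 7 + 1) + (5 + 1)) + 1) + 1) + 1)) fun τ =>
      τ.word 21 = setRank I.m ((Finset.Icc 1 len).image (σ.wordArr 10)) := by
    refine Runs.cons (Q := _) (Runs.of_wp (p := Prog.ops _) (Q := fun ρ => ρ.word 22 = 0 ∧
      ρ.word 21 = ∑ j ∈ Finset.range len, I.m.choose j) ?_ |>.mono (by decide) ?_)
    · have hb := hE.base len (by omega)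
      have := hbound 0 (by omega)
      simp at this
      simp [Prog.ops, Prog.block, Prog.wp, Op.wp, hlen, hb, this]
    · rintro σ₁ hf₁ ⟨h22, h21⟩ -
      have hE₁ := hE.of_frame hf₁ (by decide)
      have e20 := hf₁.word 20 (by decide)
      have e10 := hf₁.wordArr 10 (by decide)
      refine Runs.cons ((Runs.loop (N := len) (t := 5 + ((len * 7 + 1) + (5 + 1)))
        (Inv := fun i τ => τ.word 22 = i ∧
          τ.word 21 = ∑ j ∈ Finset.range len, I.m.choose j + ∑ i ∈ Finset.Icc 1 i, f i)
        ?_ ?_ ?_).mono le_rfl ?_)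
      · simp [h22, h21]
      · rintro i hi ρ hfρ ⟨h1, h2⟩
        have hEρ := hE₁.of_frame hfρ (by decide)
        have e20' := (hfρ.word 20 (by decide)).trans e20
        have e10' := (hfρ.wordArr 10 (by decide)).trans e10
        have hyi := hy (i + 1) (by omega) (by omega)
        refine ⟨by simp [Test.Holds, h1, e20', hlen, hi], ?_⟩
        refine Runs.cons (Runs.of_wp (p := Prog.ops _) (Q := fun ρ' => ρ'.word 22 = i + 1 ∧
          ρ'.word 23 = σ.wordArr 10 (i + 1) ∧ ρ'.word 25 = 0 ∧ ρ'.word 26 = 0)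
          ?_ |>.mono (by decide) ?_)
        · simp [Prog.ops, Prog.block, Prog.wp, Op.wp, h1, hEρ.one, e10']
          omega
        · rintro ρ₁ hf₂ ⟨h3, h4, h5, h6⟩ -
          have hE₂ := hEρ.of_frame hf₂ (by decide)
          have e20₂ := (hf₂.word 20 (by decide)).trans e20'
          have e21₂ := (hf₂.word 21 (by decide)).trans h2
          have e10₂ := (hf₂.wordArr 10 (by decide)).trans e10'
          refine Runs.cons ((rankInner_loop hW hE₂ hd (e20₂.trans hlen) (by rwa [e10₂]) h5 h6).mono
            le_rfl ?_)
          intro ρ₂ hf₃ h7 _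
          have hE₃ := hE₂.of_frame hf₃ (by decide)
          have e22₃ := (hf₃.word 22 (by decide)).trans h3
          have e23₃ := (hf₃.word 23 (by decide)).trans h4
          have e21₃ := (hf₃.word 21 (by decide)).trans e21₂
          rw [e10₂, h4] at h7
          refine Runs.cons (Runs.of_wp (p := Prog.ops _) (Q := fun ρ' => ρ'.word 22 = i + 1 ∧
            ρ'.word 21 = ∑ j ∈ Finset.range len, I.m.choose j + ∑ i ∈ Finset.Icc 1 (i + 1), f i)
            ?_ |>.mono (by decide) ?_)
          · have hcard := Finset.card_filter_le (Finset.Icc 1 len)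
              (σ.wordArr 10 · ≤ σ.wordArr 10 (i + 1))
            rw [Nat.card_Icc] at hcard
            have htab : σ.wordArr 10 (i + 1) * (I.d + 1) + (I.d + 1) ≤ W := by
              refine le_trans ?_ hW.table
              nlinarith
            have hbin := hE₃.binom _ hyi.le ((Finset.Icc 1 len).filter
              (σ.wordArr 10 · ≤ σ.wordArr 10 (i + 1))).card (by omega)
            have hch := (choose_le_sum (d := I.d) hyi.le
              (k := ((Finset.Icc 1 len).filter (σ.wordArr 10 · ≤ σ.wordArr 10 (i + 1))).card)
              (by omega)).trans hc
            have hb := hbound (i + 1) (by omega)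
            rw [Finset.sum_Icc_succ_top (by omega)] at hb ⊢
            simp [Prog.ops, Prog.block, Prog.wp, Op.wp, h7, hE₃.d1, e23₃, e21₃, e22₃, hbin]
            simp only [hf] at hb ⊢
            omega
          · rintro τ - h - 
            exact Runs.nil fun _ => h
      · rintro ρ hfρ ⟨h1, -⟩
        have e20' := (hfρ.word 20 (by decide)).trans e20
        simp [Test.Holds, h1, e20', hlen]
      · rintro τ - ⟨-, h⟩ -
        exact Runs.nil (by rw [h, hrank])
  refine key.mono (by nlinarith) fun _ _ h => h

end LinSPP

namespace LinSPP

/-! ### Listing a set of positions -/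

/-- Decide whether the position in word register `35` belongs to the set. -/
def unrankBody : Prog := .block [
  Prog.ops [.sub 36 35 5, .mul 37 36 8, .add 37 37 34, .load 37 2 37],
  .ite (.lt 33 37) .skip (Prog.ops [.store 9 34 35, .load 36 4 35, .store 10 34 36,
    .sub 33 33 37, .sub 34 34 5]),
  .op (.sub 35 35 5)]

/-- List the set of `K - 1` positions with number `r` in word array `9`, between the sentinels `0`
and `m + 1`, and the corresponding arcs in word array `10`; here `r` and `K` are held in word
registers `30` and `31`. -/
def unrankProg : Prog := .block [
  Prog.ops [.move 33 30, .sub 34 31 5, .store 9 6 6, .store 9 31 7, .move 35 1],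
  .while (.lt 6 35) unrankBody]

/-- The arrays `x` and `y` list the set `C` of `K - 1` positions. -/
structure Lists (m K : ℕ) (O : ℕ → ℕ) (C : Finset ℕ) (x y : ℕ → ℕ) : Prop where
  first : x 0 = 0
  last : x K = m + 1
  lt : ∀ i < K, x i < x (i + 1)
  arc : ∀ i, 1 ≤ i → i < K → y i = O (x i)
  image : (Finset.Ico 1 K).image x = C

variable {I : Instance} {O T H : ℕ → ℕ} {W : ℕ} {σ : State}

/-- The invariant of the listing loop: positions above `p` are done. -/
def UnrankInv (I : Instance) (O : ℕ → ℕ) (K : ℕ) (S : Finset ℕ) (p : ℕ) (τ : State) : Prop :=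
  ∃ k r, τ.word 35 = p ∧ τ.word 34 = k ∧ τ.word 33 = r ∧ k < K ∧ r < p.choose k ∧
    S = unrank p k r ∪ (Finset.Ico (k + 1) K).image (τ.wordArr 9) ∧ τ.wordArr 9 0 = 0 ∧
    τ.wordArr 9 K = I.m + 1 ∧ p < τ.wordArr 9 (k + 1) ∧
    (∀ i, k + 1 ≤ i → i < K → τ.wordArr 9 i < τ.wordArr 9 (i + 1)) ∧
    ∀ i, k + 1 ≤ i → i < K → τ.wordArr 10 i = O (τ.wordArr 9 i)

/-- One level of the recursion of `unrank`: position `p + 1` belongs to the set iff `r` is at least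
`p.choose k`, and it then enters cell `k`, so the list is filled from the top. -/
theorem unrankBody_spec (hW : Wide I W) (hE : Env I O T H σ)
    (hO : ∀ p, 1 ≤ p → p ≤ I.m → O p < I.m) {K p : ℕ} {S : Finset ℕ} (hK : K ≤ I.d)
    (hp : p + 1 ≤ I.m) (h : UnrankInv I O K S (p + 1) σ) :
    Runs W unrankBody σ 20 (UnrankInv I O K S p) := by
  obtain ⟨k, r, h35, h34, h33, hkK, hr, hS, h0, hlast, hlt, hmono, hy⟩ := h
  have hm1 := hW.m1
  have hd1 := hW.d1
  have hc := hW.coeffs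
  refine (Runs.of_wp ?_).mono (by decide) fun τ _ h => h
  have htab : p * (I.d + 1) + (I.d + 1) ≤ W := by
    refine le_trans ?_ hW.table
    nlinarith
  have hbin := hE.binom p (by omega) k (by omega)
  have hch := (choose_le_sum (d := I.d) (m := I.m) (x := p) (by omega) (k := k) (by omega)).trans hc
  have hch' := (choose_le_sum (d := I.d) (m := I.m) (x := p + 1) hp (k := k) (by omega)).trans hc
  have hOp := hO (p + 1) (by omega) hp
  simp [unrankBody, Prog.ops, Prog.block, Prog.wp, Op.wp, Test.Holds, h35, h34, h33, hE.one,
    hE.d1, hbin, hE.arc]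
  refine ⟨by omega, by omega, by omega, hch, fun hlt' => ⟨by omega, k, r, by simp, by simp [h34],
      by simp [h33], hkK, hlt', ?_, by simp [h0], by simp [hlast], by simpa using by omega,
      by simpa using hmono, by simpa using hy⟩,
    fun hlt' => ⟨by omega, by omega, by omega, by omega, ?_⟩⟩
  · rw [hS, unrank, if_pos hlt']
    rfl
  -- For `k = 0` the position is never taken, because `r < 1 = p.choose 0`.
  · obtain _ | k := k
    · simp at hr hlt'; omega
    · rw [Nat.choose_succ_succ'] at hr
      refine ⟨k, r - p.choose (k + 1), by simp, by simp, by simp, by omega, by omega, ?_, ?_, ?_,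
        ?_, ?_, ?_⟩
      · rw [hS, unrank, if_neg (by omega)]
        have e : Finset.Ico (k + 1) K = insert (k + 1) (Finset.Ico (k + 2) K) := by
          ext x; simp only [Finset.mem_Ico, Finset.mem_insert]; omega
        rw [e, Finset.image_insert]
        simp only [State.w_wordArr, State.wa_wordArr]
        simp
        congr 2
        apply Finset.image_congr
        intro x hx
        simp only [Finset.coe_Ico, Set.mem_Ico] at hx
        rw [Function.update_of_ne (by omega)]
      · simp [h0]
      · simp [Function.update_of_ne (show K ≠ k + 1 by omega), hlast]
      · simp
      · intro i hi hiK
        simp only [State.w_wordArr, State.wa_wordArr]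
        simp
        by_cases hik : i = k + 1
        · subst hik
          rw [Function.update_self, Function.update_of_ne (by omega)]
          exact hlt
        · rw [Function.update_of_ne hik, Function.update_of_ne (by omega)]
          exact hmono i (by omega) hiK
      · intro i hi hiK
        simp only [State.w_wordArr, State.wa_wordArr]
        simp
        by_cases hik : i = k + 1
        · subst hik
          simp
        · rw [Function.update_of_ne hik, Function.update_of_ne hik]
          exact hy i (by omega) hiK

theorem unrankProg_spec (hW : Wide I W) (hE : Env I O T H σ)
    (hO : ∀ p, 1 ≤ p → p ≤ I.m → O p < I.m) {K r : ℕ} (h1 : 1 ≤ K) (hK : K ≤ I.d)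
    (h30 : σ.word 30 = r) (h31 : σ.word 31 = K) (hr : r < I.m.choose (K - 1)) :
    Runs W unrankProg σ (30 * (I.m + 1)) fun τ =>
      Lists I.m K O (unrank I.m (K - 1) r) (τ.wordArr 9) (τ.wordArr 10) := by
  have hm1 := hW.m1
  have hd1 := hW.d1
  have hc := hW.coeffs
  have key : Runs W unrankProg σ (6 + ((I.m * (20 + 1) + 1) + 1)) fun τ =>
      Lists I.m K O (unrank I.m (K - 1) r) (τ.wordArr 9) (τ.wordArr 10) := by
    refine Runs.cons (Runs.of_wp (p := Prog.ops _)
      (Q := UnrankInv I O K (unrank I.m (K - 1) r) I.m) ?_ |>.mono (by decide) ?_)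
    · have hch := (choose_le_sum (d := I.d) (m := I.m) le_rfl (k := K - 1) (by omega)).trans hc
      simp [Prog.ops, Prog.block, Prog.wp, Op.wp, h30, h31, hE.one, hE.m, hE.m1, hE.zero]
      refine ⟨by omega, by omega, by omega, K - 1, r, by simp, by simp, by simp, by omega, hr, ?_,
        ?_, ?_, ?_, ?_, ?_⟩
      · rw [Nat.sub_add_cancel h1]; simp
      · simp [Function.update_of_ne (show 0 ≠ K by omega)]
      · simp
      · simp [Nat.sub_add_cancel h1]
      · intros; omega
      · intros; omega
    · intro ρ hf hinv _
      have hE₁ := hE.of_frame hf (by decide)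
      refine Runs.cons ((Runs.loop (N := I.m) (t := 20)
        (Inv := fun i => UnrankInv I O K (unrank I.m (K - 1) r) (I.m - i)) hinv ?_ ?_).mono
        le_rfl ?_)
      · intro i hi ρ' hf' hinv'
        have hE' := hE₁.of_frame hf' (by decide)
        refine ⟨?_, ?_⟩
        · obtain ⟨_, _, h35, -⟩ := hinv'
          simp [Test.Holds, h35, hE'.zero, hi]
        · refine (unrankBody_spec (p := I.m - (i + 1)) hW hE' hO hK (by omega) ?_).mono le_rfl
            fun _ _ h _ => h
          rwa [show I.m - (i + 1) + 1 = I.m - i by omega]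
      · rintro ρ' hf' ⟨_, _, h35, -⟩
        have hE' := hE₁.of_frame hf' (by decide)
        simp [Test.Holds, h35, hE'.zero]
      · rintro τ - ⟨k, r', -, -, -, hkK, hr', hS, h0, hlast, hlt, hmono, hy⟩ -
        rw [Nat.sub_self] at hr' hS hlt
        -- `Nat.choose 0 k` is positive only for `k = 0`: no element is left to be listed.
        obtain rfl : k = 0 := by
          by_contra hk
          rw [Nat.choose_eq_zero_of_lt (by omega)] at hr'
          omega
        refine Runs.nil ⟨h0, hlast, ?_, fun i hi hiK => hy i hi hiK, by simpa [unrank] using hS.symm⟩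
        intro i hi
        obtain _ | i := i
        · rw [h0]; exact hlt
        · exact hmono _ (by omega) hi
  exact key.mono (by omega) fun _ _ h => h

/-! ### Gaps of a listed set -/

variable {m K j : ℕ} {C : Finset ℕ} {x y : ℕ → ℕ}

theorem Lists.strictMono (h : Lists m K O C x y) {i i' : ℕ} (h1 : i < i') (h2 : i' ≤ K) :
    x i < x i' := by
  induction i' with
  | zero => omega
  | succ i' ih =>
    rcases Nat.lt_succ_iff_lt_or_eq.1 h1 with h3 | rfl
    · exact (ih h3 (by omega)).trans (h.lt _ (by omega))
    · exact h.lt _ (by omega)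

theorem Lists.lt_iff (h : Lists m K O C x y) {i i' : ℕ} (h1 : i ≤ K) (h2 : i' ≤ K) :
    x i < x i' ↔ i < i' := by
  refine ⟨fun h3 => ?_, fun h3 => h.strictMono h3 h2⟩
  by_contra hcon
  rcases Nat.lt_or_eq_of_le (not_lt.1 hcon) with h4 | h4
  · have := h.strictMono h4 h1; omega
  · subst h4; omega

theorem Lists.mem (h : Lists m K O C x y) {i : ℕ} (h1 : 1 ≤ i) (h2 : i < K) : x i ∈ C := by
  rw [← h.image]
  exact Finset.mem_image_of_mem _ (Finset.mem_Ico.2 ⟨h1, h2⟩)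

/-- Cells `K - j, …, K - 1` hold the top `j` elements. The sentinels in cells `0` and `K` cover the
extreme gaps. -/
theorem Lists.gap (h : Lists m K O C x y) (hj : j < K) :
    Gap m j C (x (K - j - 1)) (x (K - j)) := by
  have hinj : Set.InjOn x (Finset.Ico 1 K) := by
    intro i hi i' hi' e
    simp only [Finset.coe_Ico, Set.mem_Ico] at hi hi'
    have h1 := h.lt_iff (i := i) (i' := i') (by omega) (by omega)
    have h2 := h.lt_iff (i := i') (i' := i) (by omega) (by omega)
    omega
  refine ⟨?_, ?_, ?_, ?_, ?_, ?_⟩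
  · rw [← h.image]
    intro z hz
    obtain ⟨i, hi, rfl⟩ := Finset.mem_image.1 hz
    rw [Finset.mem_Ico] at hi
    have h1 := h.strictMono (i := 0) (i' := i) (by omega) (by omega)
    have h2 := h.strictMono (i := i) (i' := K) (by omega) le_rfl
    rw [h.last] at h2
    exact Finset.mem_Icc.2 ⟨by omega, by omega⟩
  · by_cases h0 : K - j - 1 = 0
    · rw [h0, h.first]; simp
    · exact Finset.mem_insert_of_mem (h.mem (by omega) (by omega))
  · by_cases h0 : j = 0
    · rw [h0, Nat.sub_zero, h.last]; simp
    · exact Finset.mem_insert_of_mem (h.mem (by omega) (by omega))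
  · exact h.strictMono (by omega) (by omega)
  · intro z hz
    rw [← h.image] at hz
    obtain ⟨i, hi, rfl⟩ := Finset.mem_image.1 hz
    rw [Finset.mem_Ico] at hi
    by_cases hi' : i < K - j
    · left
      by_contra hcon
      have := (h.lt_iff (i := K - j - 1) (i' := i) (by omega) (by omega)).1 (by omega)
      omega
    · right
      by_contra hcon
      have := (h.lt_iff (i := i) (i' := K - j) (by omega) (by omega)).1 (by omega)
      omega
  · have : C.filter (x (K - j) ≤ ·) = (Finset.Ico (K - j) K).image x := by
      rw [← h.image, Finset.filter_image]
      congr 1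
      ext i
      simp only [Finset.mem_filter, Finset.mem_Ico]
      constructor
      · rintro ⟨h1, h2⟩
        have := h.lt_iff (i := i) (i' := K - j) (by omega) (by omega)
        omega
      · rintro ⟨h1, h2⟩
        have := h.lt_iff (i := i) (i' := K - j) (by omega) (by omega)
        omega
    rw [this, Finset.card_image_of_injOn, Nat.card_Ico]
    · omega
    · exact hinj.mono (by
        intro i; simp only [Finset.coe_Ico, Set.mem_Ico]; omega)

end LinSPP

namespace LinSPP

/-! ### The state of a normalization pass -/

/-- The arcs in the order of their positions `1, …, m`, with their tails and heads. -/
structure Numbering (I : Instance) (O T H : ℕ → ℕ) : Prop where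
  arc : ∀ p, 1 ≤ p → p ≤ I.m → ∃ a : Fin I.m, O p = a ∧ T p = I.tail a ∧ H p = I.head a
  inj : ∀ p p', 1 ≤ p → p ≤ I.m → 1 ≤ p' → p' ≤ I.m → O p = O p' → p = p'
  source : H 0 = I.s
  sink : T (I.m + 1) = I.t
  lt : ∀ p p', 1 ≤ p → p ≤ I.m → 1 ≤ p' → p' ≤ I.m → H p = T p' → p < p'

/-- The coefficient of a set of positions, stored at the rank of the corresponding arc set. -/
noncomputable def coeff (I : Instance) (O : ℕ → ℕ) (a : ℕ → ℝ) (S : Finset ℕ) : ℝ :=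
  if S ⊆ Finset.Icc 1 I.m ∧ S.card ≤ I.d then a (setRank I.m (S.image O)) else 0

variable {I : Instance} {O T H : ℕ → ℕ}

theorem Numbering.arc_lt (hN : Numbering I O T H) : ∀ p, 1 ≤ p → p ≤ I.m → O p < I.m := by
  intro p h1 h2
  obtain ⟨a, ha, -⟩ := hN.arc p h1 h2
  rw [ha]; exact a.2

theorem Numbering.tail_lt (hN : Numbering I O T H) {p : ℕ} (h1 : 1 ≤ p) (h2 : p ≤ I.m + 1) :
    T p < I.n := by
  rcases Nat.lt_succ_iff_lt_or_eq.1 (Nat.lt_succ_of_le h2) with h | rfl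
  · obtain ⟨a, -, ha, -⟩ := hN.arc p h1 (by omega)
    rw [ha]; exact (I.tail a).2
  · rw [hN.sink]; exact I.t.2

theorem Numbering.head_lt (hN : Numbering I O T H) {p : ℕ} (h2 : p ≤ I.m) : H p < I.n := by
  rcases Nat.eq_zero_or_pos p with rfl | h
  · rw [hN.source]; exact I.s.2
  · obtain ⟨a, -, -, ha⟩ := hN.arc p h h2
    rw [ha]; exact (I.head a).2

theorem Numbering.injOn (hN : Numbering I O T H) : Set.InjOn O (Finset.Icc 1 I.m) := by
  intro p hp p' hp' h
  simp only [Finset.coe_Icc, Set.mem_Icc] at hp hp'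
  exact hN.inj p p' hp.1 hp.2 hp'.1 hp'.2 h

theorem Numbering.image_sub (hN : Numbering I O T H) {S : Finset ℕ} (hS : S ⊆ Finset.Icc 1 I.m) :
    S.image O ⊆ Finset.range I.m := by
  intro x hx
  obtain ⟨p, hp, rfl⟩ := Finset.mem_image.1 hx
  have := Finset.mem_Icc.1 (hS hp)
  exact Finset.mem_range.2 (hN.arc_lt p this.1 this.2)

theorem coeff_supp (a : ℕ → ℝ) : Supp I.m I.d (coeff I O a) := fun _ hS => if_neg hS

/-- Sets of positions have distinct ranks, so writing one cell changes one coefficient. -/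
theorem coeff_update (hN : Numbering I O T H) (a : ℕ → ℝ) {S : Finset ℕ}
    (hS : S ⊆ Finset.Icc 1 I.m) (hd : S.card ≤ I.d) (v : ℝ) (S' : Finset ℕ) :
    coeff I O (Function.update a (setRank I.m (S.image O)) v) S' =
      if S' = S then v else coeff I O a S' := by
  by_cases h : S' = S
  · subst h
    simp [coeff, hS, hd]
  · rw [if_neg h]
    unfold coeff
    split_ifs with h'
    · rw [Function.update_of_ne]
      intro e
      apply h
      have := setRank_inj (hN.image_sub h'.1) (hN.image_sub hS) e
      have hi := hN.injOn
      apply Finset.coe_injective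
      exact (hi.image_eq_image_iff (by exact_mod_cast h'.1) (by exact_mod_cast hS)).1
        (by exact_mod_cast congrArg (fun X : Finset ℕ => (X : Set ℕ)) this)
    · rfl

/-- The vertices that occur in a numbering. -/
def Occurs (T H : ℕ → ℕ) (m z : ℕ) : Prop :=
  (∃ p ≤ m, H p = z) ∨ ∃ p, 1 ≤ p ∧ p ≤ m + 1 ∧ T p = z

/-- The pass has dealt with the arcs `c, …, hi - 1`; `M` marks the vertices found to be connected
to `hi`, and `π` holds their potentials. -/
structure PassData (T H : ℕ → ℕ) (m : ℕ) (C : Finset ℕ) (hi : ℕ) (q q' : Finset ℕ → ℝ)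
    (M : ℕ → ℕ) (π : ℕ → ℝ) (c : ℕ) : Prop where
  mark_le : ∀ z, Occurs T H m z → M z ≤ 1
  mark : ∀ z, Occurs T H m z →
    (M z = 1 ↔ z = T hi ∨ ∃ b, c ≤ b ∧ b < hi ∧ T b = z ∧ Reach T H b hi)
  sink : π (T hi) = 0
  rel : ∀ b, c ≤ b → b < hi →
      (Reach T H b hi → q' (insert b C) = q (insert b C) + π (H b) - π (T b)) ∧
      (¬ Reach T H b hi → q' (insert b C) = 0) ∧
      (Basic T H hi b → q' (insert b C) = 0)
  other : ∀ S, (∀ b, c ≤ b → b < hi → S ≠ insert b C) → q' S = q S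

variable {m : ℕ} {C : Finset ℕ} {lo hi : ℕ} {q q' q'' : Finset ℕ → ℝ} {M : ℕ → ℕ} {π : ℕ → ℝ}

/-- By `reach_iff`, `p` reaches `hi` iff its head is the tail of `hi` or of a later arc that reaches
`hi`, which is exactly what the marks record. -/
theorem PassData.mark_head {p : ℕ} (h : PassData T H m C hi q q' M π (p + 1)) (hp : p < hi)
    (hm : hi ≤ m + 1) : M (H p) = 1 ↔ Reach T H p hi := by
  rw [h.mark _ (.inl ⟨p, by omega, rfl⟩), reach_iff]
  constructor
  · rintro (h1 | ⟨b, h1, h2, h3, h4⟩)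
    · exact .inl ⟨hp, h1⟩
    · exact .inr ⟨b, by omega, h2, h3.symm, h4⟩
  · rintro (⟨-, h1⟩ | ⟨b, h1, h2, h3, h4⟩)
    · exact .inl h1
    · exact .inr ⟨b, by omega, h2, h3.symm, h4⟩

/-- A processed set is not processed again. -/
theorem insert_ne {b b' : ℕ} (hb : b ∉ C) (hbb : b ≠ b') : insert b C ≠ insert b' C := by
  intro e
  have : b ∈ insert b' C := e ▸ Finset.mem_insert_self _ _
  exact (Finset.mem_insert.1 this).elim hbb hb

theorem PassData.unreachable {b : ℕ} (h : PassData T H m C hi q q' M π (b + 1)) (hb : b < hi)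
    (hC : ∀ x, b ≤ x → x < hi → x ∉ C) (hr : ¬ Reach T H b hi)
    (hq : ∀ S, q'' S = if S = insert b C then 0 else q' S) :
    PassData T H m C hi q q'' M π b := by
  refine ⟨h.mark_le, fun z hz => ?_, h.sink, fun b' h1 h2 => ?_, fun S hS => ?_⟩
  · rw [h.mark z hz]
    constructor
    · rintro (h1 | ⟨b', h1, h2⟩)
      · exact .inl h1
      · exact .inr ⟨b', by omega, h2⟩
    · rintro (h1 | ⟨b', h1, h2, h3, h4⟩)
      · exact .inl h1
      · have : b' ≠ b := by rintro rfl; exact hr h4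
        exact .inr ⟨b', by omega, h2, h3, h4⟩
  · rw [hq]
    by_cases hbb : b' = b
    · subst hbb
      rw [if_pos rfl]
      exact ⟨fun h => absurd h hr, fun _ => rfl, fun _ => rfl⟩
    · rw [if_neg (insert_ne (hC b' h1 h2) hbb)]
      exact h.rel b' (by omega) h2
  · rw [hq, if_neg (hS b le_rfl hb)]
    exact h.other S fun b' h1 h2 => hS b' (by omega) h2

/-- The tail is marked already, so it is `T hi` or the tail of a later arc reaching `hi`. Thus `b`
is not basic, and its potential is already fixed. -/
theorem PassData.reachable {b : ℕ} (h : PassData T H m C hi q q' M π (b + 1)) (hb : b < hi)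
    (hC : ∀ x, b ≤ x → x < hi → x ∉ C) (hr : Reach T H b hi) (hM : M (T b) = 1)
    (hbm : 1 ≤ b ∧ b ≤ m)
    (hq : ∀ S, q'' S = if S = insert b C then q (insert b C) + π (H b) - π (T b) else q' S) :
    PassData T H m C hi q q'' M π b := by
  have hMb := (h.mark (T b) (.inr ⟨b, hbm.1, by omega, rfl⟩)).1 hM
  refine ⟨h.mark_le, fun z hz => ?_, h.sink, fun b' h1 h2 => ?_, fun S hS => ?_⟩
  · rw [h.mark z hz]
    constructor
    · rintro (h1 | ⟨b', h1, h2⟩)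
      · exact .inl h1
      · exact .inr ⟨b', by omega, h2⟩
    · rintro (h1 | ⟨b', h1, h2, h3, h4⟩)
      · exact .inl h1
      · by_cases hbb : b' = b
        · subst hbb; rwa [h3] at hMb
        · exact .inr ⟨b', by omega, h2, h3, h4⟩
  · rw [hq]
    by_cases hbb : b' = b
    · subst hbb
      rw [if_pos rfl]
      refine ⟨fun _ => rfl, fun h => absurd hr h, fun h3 => ?_⟩
      rcases hMb with h4 | ⟨b'', h4, h5, h6, h7⟩
      · exact absurd h4 h3.2.1
      · exact absurd h7 (h3.2.2 b'' (by omega) h5 h6)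
    · rw [if_neg (insert_ne (hC b' h1 h2) hbb)]
      exact h.rel b' (by omega) h2
  · rw [hq, if_neg (hS b le_rfl hb)]
    exact h.other S fun b' h1 h2 => hS b' (by omega) h2

/-- In the backward scan the first arc met at an unmarked tail is the basic one. The potential of
that tail is chosen to make the coefficient `0`. -/
theorem PassData.first {b : ℕ} (h : PassData T H m C hi q q' M π (b + 1)) (hb : b < hi)
    (hC : ∀ x, b ≤ x → x < hi → x ∉ C) (hr : Reach T H b hi) (hM : M (T b) ≠ 1)
    (hbm : 1 ≤ b ∧ hi ≤ m + 1)
    (hq : ∀ S, q'' S = if S = insert b C then 0 else q' S) :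
    PassData T H m C hi q q'' (Function.update M (T b) 1)
      (Function.update π (T b) (q (insert b C) + π (H b))) b := by
  have hMb := mt (h.mark (T b) (.inr ⟨b, hbm.1, by omega, rfl⟩)).2 hM
  rw [not_or] at hMb
  -- If the head of such an arc were `T b`, then `T b` would be marked. Hence the new potential
  -- disturbs none of the relations established earlier.
  have hH : ∀ b', b ≤ b' → Reach T H b' hi → H b' ≠ T b := by
    intro b' h1 h2 h3
    rcases reach_iff.1 h2 with ⟨-, h4⟩ | ⟨c, h4, h5, h6, h7⟩
    · exact hMb.1 (h3.symm.trans h4)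
    · exact hMb.2 ⟨c, by omega, h5, h6.symm.trans h3, h7⟩
  refine ⟨fun z hz => ?_, fun z hz => ?_, ?_, fun b' h1 h2 => ?_, fun S hS => ?_⟩
  · rw [Function.update_apply]
    split_ifs
    · exact le_rfl
    · exact h.mark_le z hz
  · by_cases hzb : z = T b
    · subst hzb
      rw [Function.update_self]
      exact iff_of_true rfl (.inr ⟨b, le_rfl, hb, rfl, hr⟩)
    · rw [Function.update_of_ne hzb, h.mark z hz]
      constructor
      · rintro (h1 | ⟨b', h1, h2⟩)
        · exact .inl h1
        · exact .inr ⟨b', by omega, h2⟩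
      · rintro (h1 | ⟨b', h1, h2, h3, h4⟩)
        · exact .inl h1
        · have : b' ≠ b := by rintro rfl; exact hzb h3.symm
          exact .inr ⟨b', by omega, h2, h3, h4⟩
  · rw [Function.update_of_ne (Ne.symm hMb.1), h.sink]
  · rw [hq]
    by_cases hbb : b' = b
    · subst hbb
      rw [if_pos rfl, Function.update_self, Function.update_of_ne (hH b' le_rfl hr)]
      exact ⟨fun _ => by ring, fun h => absurd hr h, fun _ => rfl⟩
    · rw [if_neg (insert_ne (hC b' h1 h2) hbb)]
      obtain ⟨h3, h4⟩ := h.rel b' (by omega) h2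
      refine ⟨fun h5 => ?_, h4⟩
      rw [Function.update_of_ne (hH b' h1 h5), Function.update_of_ne, h3 h5]
      exact fun h6 => hMb.2 ⟨b', by omega, h2, h6, h5⟩
  · rw [hq, if_neg (hS b le_rfl hb)]
    exact h.other S fun b' h1 h2 => hS b' (by omega) h2

/-- Only the marks need clearing: potentials left over from other passes are not read before being
overwritten, because every read is at a marked vertex. -/
theorem PassData.start (hM : ∀ z, Occurs T H m z → M z = 0) :
    PassData T H m C hi q q (Function.update M (T hi) 1) (Function.update π (T hi) 0) hi := by
  refine ⟨fun z hz => ?_, fun z hz => ?_, by simp, fun b h1 h2 => by omega, fun S _ => rfl⟩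
  · rw [Function.update_apply]
    split_ifs
    · exact le_rfl
    · rw [hM z hz]; exact Nat.zero_le _
  · rw [Function.update_apply]
    split_ifs with h
    · simp [h]
    · rw [hM z hz]
      refine iff_of_false (by omega) ?_
      rintro (h1 | ⟨b, h1, h2, -⟩)
      · exact h h1
      · omega

/-- The effect of a pass, including that it leaves other sets alone. -/
structure PassSpec (T H : ℕ → ℕ) (C : Finset ℕ) (lo hi : ℕ) (q q' : Finset ℕ → ℝ) : Prop where
  rel : PassRel T H q q' C lo hi
  other : ∀ S, S ≠ C → (∀ b, lo < b → b < hi → S ≠ insert b C) → q' S = q S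

theorem PassData.finish (h : PassData T H m C hi q q' M π (lo + 1))
    (hC : ∀ x, lo < x → x < hi → x ∉ C)
    (h1 : Reach T H lo hi → ∀ S, q'' S = if S = C then q C + π (H lo) else q' S)
    (h2 : ¬ Reach T H lo hi → q'' = q') : PassSpec T H C lo hi q q'' := by
  have hCC : ∀ b, lo < b → b < hi → insert b C ≠ C := fun b hb hb' e =>
    hC b hb hb' (e ▸ Finset.mem_insert_self _ _)
  have hqC : q' C = q C := h.other C fun b hb hb' => (hCC b hb hb').symm
  have e : ∀ S, S ≠ C → q'' S = q' S := by
    intro S hS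
    by_cases hr : Reach T H lo hi
    · rw [h1 hr, if_neg hS]
    · rw [h2 hr]
  refine ⟨⟨π, h.sink, fun b hb hb' => ?_, fun hr => ?_, fun hr => ?_⟩, fun S hS hS' => ?_⟩
  · rw [e _ (hCC b hb hb')]
    exact h.rel b hb hb'
  · rw [h1 hr, if_pos rfl]
  · rw [h2 hr, hqC]
  · rw [e S hS]
    exact h.other S hS'

end LinSPP

namespace LinSPP

/-! ### The normalization pass -/

/-- Deal with the arc at the position in word register `41`. -/
def passBody : Prog := .block [
  Prog.ops [.load 36 4 41, .store 10 31 36, .move 20 31],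
  rankProg,
  .block [Prog.ops [.load 44 5 41, .load 45 6 41, .load 46 11 45],
    .ite (.eq 46 5)
      (.block [Prog.ops [.rload 1 0 21, .rload 2 2 45, .radd 1 1 2, .load 46 11 44],
        .ite (.eq 46 5) .skip (Prog.ops [.store 11 44 5, .rstore 2 44 1]),
        Prog.ops [.rload 2 2 44, .rsub 1 1 2, .rstore 0 21 1]])
      (.op (.rstore 0 21 0)),
    .op (.sub 41 41 5)]]

/-- Clear the marks at the head of one position and the tail of the next. -/
def clearBody : Prog := Prog.ops [.load 42 6 41, .store 11 42 6, .add 41 41 5, .load 42 5 41,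
  .store 11 42 6]

/-- Normalize in the gap below the top `j` elements of the listed set. -/
def passProg : Prog := .block [
  Prog.ops [.sub 38 31 32, .load 39 9 38, .sub 38 38 5, .load 40 9 38, .const 41 0],
  .while (.lt 41 7) clearBody,
  Prog.ops [.load 42 5 39, .store 11 42 5, .rstore 2 42 0, .sub 41 39 5],
  .while (.lt 40 41) passBody,
  Prog.ops [.load 45 6 40, .load 46 11 45],
  .ite (.eq 46 5) (.block [.op (.sub 20 31 5), rankProg,
    Prog.ops [.rload 1 0 21, .rload 2 2 45, .radd 1 1 2, .rstore 0 21 1]]) .skip]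

variable {I : Instance} {O T H : ℕ → ℕ} {W : ℕ} {σ : State} {K j : ℕ} {C : Finset ℕ} {lo hi : ℕ}
  {q : Finset ℕ → ℝ}

theorem rankProg_positions (hW : Wide I W) (hN : Numbering I O T H) (hE : Env I O T H σ)
    {len : ℕ} (hd : len ≤ I.d) (hlen : σ.word 20 = len) {x : ℕ → ℕ} {S : Finset ℕ}
    (hS : S ⊆ Finset.Icc 1 I.m) (hcard : S.card = len) (hx : (Finset.Icc 1 len).image x = S)
    (hy : ∀ i, 1 ≤ i → i ≤ len → σ.wordArr 10 i = O (x i)) :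
    Runs W rankProg σ (20 * (len + 1) ^ 2) fun τ =>
      τ.word 21 = setRank I.m (S.image O) := by
  have hmem : ∀ i, 1 ≤ i → i ≤ len → x i ∈ S := fun i h1 h2 => by
    rw [← hx]; exact Finset.mem_image_of_mem _ (Finset.mem_Icc.2 ⟨h1, h2⟩)
  have hxi : Set.InjOn x (Finset.Icc 1 len) := by
    rw [← Finset.card_image_iff, hx, hcard, Nat.card_Icc]; omega
  have e : (Finset.Icc 1 len).image (σ.wordArr 10) = S.image O := by
    rw [← hx, Finset.image_image]
    apply Finset.image_congr
    intro i hi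
    simp only [Finset.coe_Icc, Set.mem_Icc] at hi
    exact hy i hi.1 hi.2
  rw [← e]
  apply rankProg_spec hW hE hd hlen
  · intro i h1 h2
    rw [hy i h1 h2]
    have := Finset.mem_Icc.1 (hS (hmem i h1 h2))
    exact hN.arc_lt _ this.1 this.2
  · intro i hi i' hi' h
    have hi2 := hi
    have hi2' := hi'
    simp only [Finset.coe_Icc, Set.mem_Icc] at hi hi'
    rw [hy i hi.1 hi.2, hy i' hi'.1 hi'.2] at h
    exact hxi hi2 hi2' (hN.injOn (by exact_mod_cast hS (hmem i hi.1 hi.2))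
      (by exact_mod_cast hS (hmem i' hi'.1 hi'.2)) h)

/-- The state of the machine between two arcs of a pass. -/
structure PassInv (I : Instance) (O T H : ℕ → ℕ) (K : ℕ) (C : Finset ℕ) (hi : ℕ)
    (q : Finset ℕ → ℝ) (b : ℕ) (τ : State) : Prop where
  pos : τ.word 41 = b
  lists : Lists I.m K O C (τ.wordArr 9) (τ.wordArr 10)
  data : PassData T H I.m C hi q (coeff I O (τ.realArr 0)) (τ.wordArr 11) (τ.realArr 2) (b + 1)

/-- `C` occupies cells `1, …, K - 1`; cell `K` of the arc list is free for the additional arc when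
the rank of `C ∪ {b}` is computed. -/
theorem Lists.update {m : ℕ} {x y : ℕ → ℕ} (h : Lists m K O C x y) (v : ℕ) :
    Lists m K O C x (Function.update y K v) :=
  ⟨h.first, h.last, h.lt, fun i h1 h2 => by
    rw [Function.update_of_ne (by omega)]; exact h.arc i h1 h2, h.image⟩

theorem passBody_spec (hW : Wide I W) (hN : Numbering I O T H) (hE : Env I O T H σ)
    (hK : K ≤ I.d) (h31 : σ.word 31 = K) (hg : Gap I.m j C lo hi) (hcard : C.card + 1 = K)
    {b : ℕ} (hlo : lo < b + 1) (hb : b + 1 < hi) (h : PassInv I O T H K C hi q (b + 1) σ) :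
    Runs W passBody σ (50 * (K + 1) ^ 2) (PassInv I O T H K C hi q b) := by
  have hm1 := hW.m1
  have hd1 := hW.d1
  have hn := hW.n
  have hhi := hg.hi_le
  obtain ⟨hpos, hL, hP⟩ := h
  have hnm : ∀ x, b + 1 ≤ x → x < hi → x ∉ C := fun x h1 h2 => hg.notMem (by omega) h2
  have hS : insert (b + 1) C ⊆ Finset.Icc 1 I.m :=
    Finset.insert_subset (Finset.mem_Icc.2 ⟨by omega, by omega⟩) hg.sub
  have hSc : (insert (b + 1) C).card = K := by
    rw [Finset.card_insert_of_notMem (hnm _ le_rfl hb), hcard]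
  have hne : ∀ b', b + 1 + 1 ≤ b' → b' < hi → insert (b + 1) C ≠ insert b' C :=
    fun b' h1 h2 => insert_ne (hnm _ le_rfl hb) (by omega)
  have key : Runs W passBody σ (4 + (20 * (K + 1) ^ 2 + (28 + 1)))
      (PassInv I O T H K C hi q b) := by
    refine Runs.cons (Runs.of_wp (p := Prog.ops _) (Q := fun ρ => ρ.word 20 = K ∧
      ρ.wordArr 10 = Function.update (σ.wordArr 10) K (O (b + 1))) ?_ |>.mono (by decide) ?_)
    · have := hN.arc_lt (b + 1) (by omega) (by omega)
      simp [Prog.ops, Prog.block, Prog.wp, Op.wp, hpos, h31, hE.arc]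
      omega
    rintro σ₁ hf₁ ⟨h20, h10⟩ -
    have hE₁ := hE.of_frame hf₁ (by decide)
    refine Runs.cons ((rankProg_positions hW hN hE₁ hK h20 (S := insert (b + 1) C)
      (x := Function.update (σ.wordArr 9) K (b + 1)) hS hSc ?_ ?_).mono le_rfl ?_)
    · have : Finset.Icc 1 K = insert K (Finset.Ico 1 K) := by
        ext i; simp only [Finset.mem_Icc, Finset.mem_insert, Finset.mem_Ico]; omega
      rw [this, Finset.image_insert, Function.update_self, ← hL.image]
      congr 1
      apply Finset.image_congr
      intro i hi
      simp only [Finset.coe_Ico, Set.mem_Ico] at hi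
      rw [Function.update_of_ne (by omega)]
    · intro i h1 h2
      rw [h10]
      by_cases hi : i = K
      · subst hi; simp
      · rw [Function.update_of_ne hi, Function.update_of_ne hi]
        exact hL.arc i h1 (by omega)
    intro σ₂ hf₂ h21 _
    have hE₂ := hE₁.of_frame hf₂ (by decide)
    have e41 : σ₂.word 41 = b + 1 := by
      rw [hf₂.word 41 (by decide), hf₁.word 41 (by decide), hpos]
    have e9 : σ₂.wordArr 9 = σ.wordArr 9 := by
      rw [hf₂.wordArr 9 (by decide), hf₁.wordArr 9 (by decide)]
    have e10 : σ₂.wordArr 10 = Function.update (σ.wordArr 10) K (O (b + 1)) := by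
      rw [hf₂.wordArr 10 (by decide), h10]
    have e11 : σ₂.wordArr 11 = σ.wordArr 11 := by
      rw [hf₂.wordArr 11 (by decide), hf₁.wordArr 11 (by decide)]
    have r0 : σ₂.realArr 0 = σ.realArr 0 := by
      rw [hf₂.realArr 0 (by decide), hf₁.realArr 0 (by decide)]
    have r2 : σ₂.realArr 2 = σ.realArr 2 := by
      rw [hf₂.realArr 2 (by decide), hf₁.realArr 2 (by decide)]
    have hT := hN.tail_lt (p := b + 1) (by omega) (by omega)
    have hH := hN.head_lt (p := b + 1) (by omega)
    have hML := hP.mark_le (H (b + 1)) (.inl ⟨b + 1, by omega, rfl⟩)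
    have hML' := hP.mark_le (T (b + 1)) (.inr ⟨b + 1, by omega, by omega, rfl⟩)
    have hMr := hP.mark_head (by omega) hhi
    -- The pass works in place. The cell still holds the old coefficient because `C ∪ {b}` has not
    -- been processed yet.
    have hval : σ.realArr 0 (setRank I.m ((insert (b + 1) C).image O)) = q (insert (b + 1) C) := by
      rw [← hP.other _ hne, coeff, if_pos ⟨hS, by omega⟩]
    have hL' := hL.update (K := K) (O (b + 1))
    have hcu := coeff_update hN (σ.realArr 0) hS (by omega : (insert (b + 1) C).card ≤ I.d)
    generalize setRank I.m ((insert (b + 1) C).image O) = rk at h21 hval hcu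
    refine Runs.cons ((Runs.of_wp (p := Prog.block _) ?_).mono (t' := 28) (by decide)
      fun τ _ h _ => Runs.nil h)
    simp [Prog.ops, Prog.block, Prog.wp, Op.wp, Test.Holds, e41, hE₂.tail, hE₂.head, e11, r0,
      r2, h21, hE₂.one, hE₂.real]
    refine ⟨by omega, by omega, by omega, fun hM => ⟨by omega, fun hM' => ⟨by omega, ?_⟩,
      fun hM' => ⟨by omega, ?_⟩⟩, fun hM => ⟨by omega, ?_⟩⟩
    · refine ⟨by simp, by simpa [e9, e10] using hL', ?_⟩
      simp [r0, r2, e11]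
      exact hP.reachable (by omega) hnm (hMr.1 hM) hM' ⟨by omega, by omega⟩
        fun S => by rw [hcu, hval]
    · refine ⟨by simp, by simpa [e9, e10] using hL', ?_⟩
      simp [r0, r2, e11, hval]
      exact hP.first (by omega) hnm (hMr.1 hM) hM' ⟨by omega, by omega⟩ (hcu 0)
    · refine ⟨by simp, by simpa [e9, e10] using hL', ?_⟩
      simp [r0, r2, e11]
      exact hP.unreachable (by omega) hnm (mt hMr.2 hM) (hcu 0)
  exact key.mono (by nlinarith) fun _ _ h => h

/-- Only the ends of arcs and the two terminals are cleared, which takes `O(m)` steps however many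
vertices there are. -/
theorem clear_loop (hW : Wide I W) (hN : Numbering I O T H) (hE : Env I O T H σ)
    (h41 : σ.word 41 = 0) :
    Runs W (.while (.lt 41 7) clearBody) σ ((I.m + 1) * 7 + 1) fun τ =>
      ∀ z, Occurs T H I.m z → τ.wordArr 11 z = 0 := by
  have hm1 := hW.m1
  have hd1 := hW.d1
  have hn := hW.n
  refine (Runs.loop (N := I.m + 1) (t := 6) (Inv := fun i τ => τ.word 41 = i ∧
    ∀ z, ((∃ p < i, H p = z) ∨ ∃ p, 1 ≤ p ∧ p ≤ i ∧ T p = z) → τ.wordArr 11 z = 0)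
    ?_ ?_ ?_).mono le_rfl ?_
  · refine ⟨h41, ?_⟩
    rintro z (⟨p, h, -⟩ | ⟨p, h, h', -⟩) <;> omega
  · rintro i hi ρ hf ⟨h1, h2⟩
    have hE' := hE.of_frame hf (by decide)
    refine ⟨by simp [Test.Holds, h1, hE'.m1]; omega, ?_⟩
    refine (Runs.of_wp ?_).mono (by decide) fun τ _ h _ => h
    have hT := hN.tail_lt (p := i + 1) (by omega) (by omega)
    have hH := hN.head_lt (p := i) (by omega)
    simp [clearBody, Prog.ops, Prog.block, Prog.wp, Op.wp, h1, hE'.one, hE'.zero, hE'.head,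
      hE'.tail]
    refine ⟨by omega, by omega, by omega, fun z hz => ?_⟩
    rw [Function.update_apply, Function.update_apply]
    split_ifs with h3 h4
    · rfl
    · rfl
    · apply h2
      rcases hz with ⟨p, h5, h6⟩ | ⟨p, h5, h6, h7⟩
      · have : p ≠ i := by rintro rfl; exact h4 h6.symm
        exact .inl ⟨p, by omega, h6⟩
      · have : p ≠ i + 1 := by rintro rfl; exact h3 h7.symm
        exact .inr ⟨p, h5, by omega, h7⟩
  · rintro ρ hf ⟨h1, -⟩
    have hE' := hE.of_frame hf (by decide)
    simp [Test.Holds, h1, hE'.m1]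
  · rintro τ - ⟨-, h⟩ z hz
    apply h
    rcases hz with ⟨p, h5, h6⟩ | h5
    · exact .inl ⟨p, by omega, h6⟩
    · exact .inr h5

theorem passProg_spec (hW : Wide I W) (hN : Numbering I O T H) (hE : Env I O T H σ)
    (hK : K ≤ I.d) (hjK : j < K) (h31 : σ.word 31 = K) (h32 : σ.word 32 = j)
    (hcard : C.card + 1 = K) (hL : Lists I.m K O C (σ.wordArr 9) (σ.wordArr 10)) :
    Runs W passProg σ (100 * (I.m + 1) * (K + 1) ^ 2) fun τ =>
      ∃ lo hi, Gap I.m j C lo hi ∧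
        PassSpec T H C lo hi (coeff I O (σ.realArr 0)) (coeff I O (τ.realArr 0)) := by
  have hm1 := hW.m1
  have hd1 := hW.d1
  have hn := hW.n
  have hg := hL.gap hjK
  set lo := σ.wordArr 9 (K - j - 1) with hlo
  set hi := σ.wordArr 9 (K - j) with hhi
  have hlt := hg.lt
  have hle := hg.hi_le
  set q := coeff I O (σ.realArr 0) with hq
  have key : Runs W passProg σ (6 + (((I.m + 1) * 7 + 1) + (5 +
      (((hi - 1 - lo) * (50 * (K + 1) ^ 2 + 1) + 1) + (3 +
        ((1 + (20 * (C.card + 1) ^ 2 + (5 + 1)) + 1) + 1)))))) fun τ =>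
      PassSpec T H C lo hi q (coeff I O (τ.realArr 0)) := by
    refine Runs.cons (Runs.of_wp (p := Prog.ops _) (Q := fun ρ => ρ.word 39 = hi ∧
      ρ.word 40 = lo ∧ ρ.word 41 = 0) ?_ |>.mono (by decide) ?_)
    · simp [Prog.ops, Prog.block, Prog.wp, Op.wp, h31, h32, hE.one, ← hlo, ← hhi]
      omega
    rintro σ₁ hf₁ ⟨h39, h40, h41⟩ -
    have hE₁ := hE.of_frame hf₁ (by decide)
    refine Runs.cons ((clear_loop hW hN hE₁ h41).mono le_rfl ?_)
    intro σ₂ hf₂ hcl _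
    have hE₂ := hE₁.of_frame hf₂ (by decide)
    have e39 := (hf₂.word 39 (by decide)).trans h39
    have e9 := (hf₂.wordArr 9 (by decide)).trans (hf₁.wordArr 9 (by decide))
    have e10 := (hf₂.wordArr 10 (by decide)).trans (hf₁.wordArr 10 (by decide))
    have r0 := (hf₂.realArr 0 (by decide)).trans (hf₁.realArr 0 (by decide))
    refine Runs.cons (Runs.of_wp (p := Prog.ops _) (Q := PassInv I O T H K C hi q (hi - 1))
      ?_ |>.mono (by decide) ?_)
    · have hT := hN.tail_lt (p := hi) (by omega) (by omega)
      simp [Prog.ops, Prog.block, Prog.wp, Op.wp, e39, hE₂.one, hE₂.tail, hE₂.real]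
      refine ⟨by omega, by omega, by simp, by simpa [e9, e10] using hL, ?_⟩
      rw [Nat.sub_add_cancel (by omega)]
      simp [r0]
      exact PassData.start hcl
    intro σ₃ hf₃ hinv _
    have hE₃ := hE₂.of_frame hf₃ (by decide)
    have e40 : σ₃.word 40 = lo := by
      rw [hf₃.word 40 (by decide), hf₂.word 40 (by decide), h40]
    have e31 : σ₃.word 31 = K := by
      rw [hf₃.word 31 (by decide), hf₂.word 31 (by decide), hf₁.word 31 (by decide), h31]
    refine Runs.cons ((Runs.loop (N := hi - 1 - lo) (t := 50 * (K + 1) ^ 2)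
      (Inv := fun i => PassInv I O T H K C hi q (hi - 1 - i)) hinv ?_ ?_).mono le_rfl ?_)
    · intro i hi' ρ hf hinv'
      have hE' := hE₃.of_frame hf (by decide)
      refine ⟨?_, ?_⟩
      · simp [Test.Holds, hinv'.pos, hf.word 40 (by decide), e40]
        omega
      · refine (passBody_spec (b := hi - 1 - (i + 1)) hW hN hE' hK
          ((hf.word 31 (by decide)).trans e31) hg hcard (by omega) (by omega) ?_).mono le_rfl
          fun _ _ h _ => h
        rwa [show hi - 1 - (i + 1) + 1 = hi - 1 - i by omega]
    · intro ρ hf hinv'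
      simp [Test.Holds, hinv'.pos, hf.word 40 (by decide), e40]
      omega
    intro σ₄ hf₄ hinv' _
    rw [show hi - 1 - (hi - 1 - lo) = lo by omega] at hinv'
    have hE₄ := hE₃.of_frame hf₄ (by decide)
    have e40' : σ₄.word 40 = lo := (hf₄.word 40 (by decide)).trans e40
    obtain ⟨-, hL₄, hP⟩ := hinv'
    have hH := hN.head_lt (p := lo) (by omega)
    have hML := hP.mark_le (H lo) (.inl ⟨lo, by omega, rfl⟩)
    have hMr := hP.mark_head (by omega) hle
    have hnm : ∀ x, lo < x → x < hi → x ∉ C := fun x h1 h2 => hg.notMem h1 h2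
    refine Runs.cons (Runs.of_wp (p := Prog.ops _) (Q := fun ρ => ρ.word 45 = H lo ∧
      ρ.word 46 = σ₄.wordArr 11 (H lo)) ?_ |>.mono (by decide) ?_)
    · simp [Prog.ops, Prog.block, Prog.wp, Op.wp, e40', hE₄.head]
      omega
    rintro σ₅ hf₅ ⟨h45, h46⟩ -
    have hE₅ := hE₄.of_frame hf₅ (by decide)
    have r0₅ := hf₅.realArr 0 (by decide)
    have r2₅ := hf₅.realArr 2 (by decide)
    refine Runs.cons ((Runs.ite ?_ ?_).mono le_rfl fun τ _ h _ => Runs.nil h)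
    · intro hM
      simp only [Test.Holds, h46, hE₅.one] at hM
      refine Runs.cons (Runs.of_wp (p := .op _) (Q := fun ρ => ρ.word 20 = C.card)
        ?_ |>.mono (by decide) ?_)
      · simp [Prog.wp, Op.wp, hE₅.one, hf₅.word 31 (by decide), hf₄.word 31 (by decide), e31]
        omega
      intro σ₆ hf₆ h20 _
      have hE₆ := hE₅.of_frame hf₆ (by decide)
      refine Runs.cons ((rankProg_positions hW hN hE₆ (by omega) h20 hg.sub rfl
        (x := σ₆.wordArr 9) ?_ ?_).mono le_rfl ?_)
      · have : Finset.Icc 1 C.card = Finset.Ico 1 K := by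
          ext i; simp only [Finset.mem_Icc, Finset.mem_Ico]; omega
        rw [this, hf₆.wordArr 9 (by decide), hf₅.wordArr 9 (by decide)]
        exact hL₄.image
      · intro i h1 h2
        rw [hf₆.wordArr 9 (by decide), hf₅.wordArr 9 (by decide), hf₆.wordArr 10 (by decide),
          hf₅.wordArr 10 (by decide)]
        exact hL₄.arc i h1 (by omega)
      intro σ₇ hf₇ h21 _
      have r0₇ : σ₇.realArr 0 = σ₄.realArr 0 := by
        rw [hf₇.realArr 0 (by decide), hf₆.realArr 0 (by decide), r0₅]
      have r2₇ : σ₇.realArr 2 = σ₄.realArr 2 := by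
        rw [hf₇.realArr 2 (by decide), hf₆.realArr 2 (by decide), r2₅]
      have e45 : σ₇.word 45 = H lo := by
        rw [hf₇.word 45 (by decide), hf₆.word 45 (by decide), h45]
      have hCd : C.card ≤ I.d := by omega
      have hval : σ₄.realArr 0 (setRank I.m (C.image O)) = q C := by
        rw [← hP.other C fun b h1 h2 e => hnm b (by omega) h2 (e ▸ Finset.mem_insert_self _ _),
          coeff, if_pos ⟨hg.sub, hCd⟩]
      refine Runs.cons ((Runs.of_wp (p := Prog.ops _) ?_).mono (t' := 5) (by decide)
        fun τ _ h _ => Runs.nil h)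
      simp [Prog.ops, Prog.block, Prog.wp, Op.wp, h21, e45, r0₇, r2₇]
      exact hP.finish hnm (fun _ S => by rw [coeff_update hN _ hg.sub hCd, hval])
        fun hr => absurd (hMr.1 hM) hr
    · intro hM
      simp only [Test.Holds, h46, hE₅.one] at hM
      refine (Runs.skip ?_).mono (by omega) fun τ _ h => h
      rw [r0₅]
      exact hP.finish hnm (fun hr => absurd (hMr.2 hr) hM) fun _ => rfl
  refine key.mono ?_ fun τ _ h => ⟨lo, hi, hg, h⟩
  have h1 : hi - 1 - lo ≤ I.m := by omega
  have h2 : (hi - 1 - lo) * (50 * (K + 1) ^ 2 + 1) ≤ I.m * (50 * (K + 1) ^ 2 + 1) :=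
    Nat.mul_le_mul_right _ h1
  have h3 : 1 ≤ (K + 1) ^ 2 := Nat.one_le_pow _ _ (by omega)
  have h4 : (C.card + 1) ^ 2 ≤ (K + 1) ^ 2 := Nat.pow_le_pow_left (by omega) 2
  have h5 : I.m ≤ I.m * (K + 1) ^ 2 := Nat.le_mul_of_pos_right _ h3
  nlinarith

end LinSPP

namespace LinSPP

/-! ### All passes -/

/-- One pass. -/
def tupleBody : Prog := .block [unrankProg, passProg, .op (.add 30 30 5)]

/-- All passes for the sets of a given cardinality. -/
def levelBody : Prog := .block [
  Prog.ops [.const 30 0, .mul 47 1 8, .add 47 47 31, .sub 47 47 5, .load 48 2 47],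
  .while (.lt 30 48) tupleBody, .op (.sub 31 31 5)]

/-- All passes in the gap below the top `j` elements. -/
def stageBody : Prog := .block [.op (.move 31 4), .while (.lt 32 31) levelBody,
  .op (.add 32 32 5)]

/-- The normalization of the cost function. -/
def normalizeProg : Prog := .block [.op (.const 32 0), .while (.lt 32 8) stageBody]

variable {I : Instance} {O T H : ℕ → ℕ} {W : ℕ} {σ : State} {m d K j : ℕ} {C : Finset ℕ}
  {lo hi : ℕ} {q q' q₁ q₂ : Finset ℕ → ℝ}

theorem PassRel.congr (h : PassRel T H q q' C lo hi) (h1 : q₁ C = q C) (h2 : q₂ C = q' C)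
    (h3 : ∀ b, lo < b → b < hi → q₁ (insert b C) = q (insert b C))
    (h4 : ∀ b, lo < b → b < hi → q₂ (insert b C) = q' (insert b C)) :
    PassRel T H q₁ q₂ C lo hi := by
  obtain ⟨π, h5, h6, h7⟩ := h
  refine ⟨π, h5, fun b hb hb' => ?_, ?_⟩
  · rw [h3 b hb hb', h4 b hb hb']
    exact h6 b hb hb'
  · rw [h1, h2]
    exact h7

/-- The passes for the sets satisfying `P` have been carried out. -/
structure PartialStep (T H : ℕ → ℕ) (m j K : ℕ) (P : Finset ℕ → Prop) (q q' : Finset ℕ → ℝ) :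
    Prop where
  pass : ∀ C lo hi, Gap m j C lo hi → C.card + 1 = K → P C → PassRel T H q q' C lo hi
  pending : ∀ C lo hi, Gap m j C lo hi → C.card + 1 = K → ¬ P C →
    q' C = q C ∧ ∀ b, lo < b → b < hi → q' (insert b C) = q (insert b C)
  other : ∀ S, S.card ≠ K → S.card + 1 ≠ K → q' S = q S

/-- Passes for different sets `C` touch disjoint coefficients: those of cardinality `K` by
`Gap.unique_insert`, and only `C` itself in cardinality `K - 1`. Consequently each pass sees
original values, and the sequential passes have the joint effect required by `StepRel`. -/
theorem PartialStep.add {P : Finset ℕ → Prop} (h : PartialStep T H m j K P q q₁)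
    (hp : PassSpec T H C lo hi q₁ q₂) (hg : Gap m j C lo hi) (hc : C.card + 1 = K) (hC : ¬ P C) :
    PartialStep T H m j K (fun X => P X ∨ X = C) q q₂ := by
  have hcard : ∀ {X lo hi b}, Gap m j X lo hi → X.card + 1 = K → lo < b → b < hi →
      (insert b X).card = K := fun hg hc h1 h2 => by
    rw [Finset.card_insert_of_notMem (hg.notMem h1 h2), hc]
  have same : ∀ X lo' hi', Gap m j X lo' hi' → X.card + 1 = K → X ≠ C →
      q₂ X = q₁ X ∧ ∀ b, lo' < b → b < hi' → q₂ (insert b X) = q₁ (insert b X) := by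
    intro X lo' hi' hg' hc' hne
    refine ⟨hp.other X hne fun b h1 h2 e => ?_, fun b h1 h2 => hp.other _ (fun e => ?_)
      fun b' h3 h4 e => ?_⟩
    · have := hcard hg hc h1 h2
      rw [← e] at this; omega
    · have := hcard hg' hc' h1 h2
      rw [e] at this; omega
    · exact hne (hg'.unique_insert hg h1 h2 h3 h4 e).2
  refine ⟨fun X lo' hi' hg' hc' hX => ?_, fun X lo' hi' hg' hc' hX => ?_, fun S h1 h2 => ?_⟩
  · by_cases hne : X = C
    · subst hne
      obtain ⟨rfl, rfl⟩ := hg.unique hg'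
      obtain ⟨h1, h2⟩ := h.pending _ _ _ hg hc hC
      exact hp.rel.congr h1.symm rfl (fun b hb hb' => (h2 b hb hb').symm) fun _ _ _ => rfl
    · obtain ⟨h1, h2⟩ := same X lo' hi' hg' hc' hne
      exact (h.pass X lo' hi' hg' hc' (hX.resolve_right hne)).congr rfl h1 (fun _ _ _ => rfl) h2
  · rw [not_or] at hX
    obtain ⟨h1, h2⟩ := same X lo' hi' hg' hc' hX.2
    obtain ⟨h3, h4⟩ := h.pending X lo' hi' hg' hc' hX.1
    exact ⟨h1.trans h3, fun b hb hb' => (h2 b hb hb').trans (h4 b hb hb')⟩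
  · rw [hp.other S, h.other S h1 h2]
    · rintro rfl; exact h2 hc
    · rintro b hb hb' rfl
      exact h1 (hcard hg hc hb hb')

/-- Passing from `k` to `k + 1` multiplies the binomial coefficient by `(m - k) / (k + 1)`, which is
at most `m / 2` for `k ≥ 1`. The factor `2` pays for the step from `0` to `1`. -/
theorem choose_mul_two_pow_le (m k : ℕ) : m.choose k * 2 ^ k ≤ 2 * m ^ k := by
  induction k with
  | zero => simp
  | succ k ih =>
    obtain _ | k := k
    · simp; omega
    · have h1 := Nat.choose_succ_right_eq m (k + 1)
      have h2 : m.choose (k + 1 + 1) * 2 ≤ m.choose (k + 1) * m := by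
        calc _ ≤ m.choose (k + 1 + 1) * (k + 1 + 1) := Nat.mul_le_mul_left _ (by omega)
          _ = _ := h1
          _ ≤ _ := Nat.mul_le_mul_left _ (Nat.sub_le _ _)
      calc _ = m.choose (k + 1 + 1) * 2 * 2 ^ (k + 1) := by ring
        _ ≤ m.choose (k + 1) * m * 2 ^ (k + 1) := Nat.mul_le_mul_right _ h2
        _ = m.choose (k + 1) * 2 ^ (k + 1) * m := by ring
        _ ≤ 2 * m ^ (k + 1) * m := Nat.mul_le_mul_right _ ih
        _ = _ := by ring

theorem sq_le_two_pow (k : ℕ) : (k + 2) ^ 2 * 2 ≤ 9 * 2 ^ k := by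
  induction k with
  | zero => norm_num
  | succ k ih =>
    obtain _ | k := k
    · norm_num
    · have : (k + 1 + 1 + 2) ^ 2 ≤ 2 * (k + 1 + 2) ^ 2 := by
        ring_nf
        omega
      rw [pow_succ 2 (k + 1)]
      linarith

/-- This absorbs the quadratic cost of computing ranks, which would otherwise add a factor `d²` to
the running time. -/
theorem choose_mul_sq_le (m k : ℕ) : m.choose k * (k + 2) ^ 2 ≤ 9 * m ^ k := by
  have h1 := choose_mul_two_pow_le m k
  have h2 := sq_le_two_pow k
  have h3 := Nat.mul_le_mul_left (m.choose k) h2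
  nlinarith

theorem tupleBody_spec (hW : Wide I W) (hN : Numbering I O T H) (hE : Env I O T H σ)
    (hK : K + 1 ≤ I.d) (hjK : j ≤ K) (h31 : σ.word 31 = K + 1) (h32 : σ.word 32 = j) {r : ℕ}
    (h30 : σ.word 30 = r) (hr : r < I.m.choose K) :
    Runs W tupleBody σ (140 * (I.m + 1) * (K + 2) ^ 2) fun τ => τ.word 30 = r + 1 ∧
      ∃ lo hi, Gap I.m j (unrank I.m K r) lo hi ∧
        PassSpec T H (unrank I.m K r) lo hi (coeff I O (σ.realArr 0)) (coeff I O (τ.realArr 0)) := by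
  have key : Runs W tupleBody σ (30 * (I.m + 1) + (100 * (I.m + 1) * (K + 1 + 1) ^ 2 + (1 + 1)))
      fun τ => τ.word 30 = r + 1 ∧ ∃ lo hi, Gap I.m j (unrank I.m K r) lo hi ∧
        PassSpec T H (unrank I.m K r) lo hi (coeff I O (σ.realArr 0))
          (coeff I O (τ.realArr 0)) := by
    refine Runs.cons ((unrankProg_spec hW hE hN.arc_lt (by omega) hK h30 h31 hr).mono le_rfl ?_)
    intro σ₁ hf₁ hL _
    have hE₁ := hE.of_frame hf₁ (by decide)
    rw [Nat.add_sub_cancel] at hL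
    have hcard := (Finset.mem_powersetCard.1 (unrank_mem hr)).2
    refine Runs.cons ((passProg_spec hW hN hE₁ hK (j := j) (by omega)
      ((hf₁.word 31 (by decide)).trans h31) ((hf₁.word 32 (by decide)).trans h32)
      (by rw [hcard]) hL).mono le_rfl ?_)
    rintro σ₂ hf₂ hp -
    rw [hf₁.realArr 0 (by decide)] at hp
    have hE₂ := hE₁.of_frame hf₂ (by decide)
    refine Runs.cons ((Runs.of_wp (p := .op _) ?_).mono (t' := 1) (by decide)
      fun τ _ h _ => Runs.nil h)
    have hch := (choose_le_sum (d := I.d) (m := I.m) le_rfl (k := K) (by omega)).trans hW.coeffs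
    have e30 : σ₂.word 30 = r := by rw [hf₂.word 30 (by decide), hf₁.word 30 (by decide), h30]
    simp only [Prog.wp, Op.wp, e30, hE₂.one]
    exact ⟨by omega, by simp, hp⟩
  refine key.mono ?_ fun _ _ h => h
  have h3 : 1 ≤ (K + 2) ^ 2 := Nat.one_le_pow _ _ (by omega)
  have : (I.m + 1) ≤ (I.m + 1) * (K + 2) ^ 2 := Nat.le_mul_of_pos_right _ h3
  nlinarith

/-- The `I.m.choose K` passes take `O(m (K + 2)²)` steps each, which is `O(m ^ (K + 1))` in total by
`choose_mul_sq_le`. -/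
theorem levelBody_spec (hW : Wide I W) (hN : Numbering I O T H) (hE : Env I O T H σ)
    (hm : 1 ≤ I.m) (hK : K + 1 ≤ I.d) (hjK : j ≤ K) (h31 : σ.word 31 = K + 1)
    (h32 : σ.word 32 = j) :
    Runs W levelBody σ (3000 * I.m ^ I.d) fun τ => τ.word 31 = K ∧
      StepRel T H I.m I.d j (K + 1) (coeff I O (σ.realArr 0)) (coeff I O (τ.realArr 0)) := by
  have hd1 := hW.d1
  have key : Runs W levelBody σ (6 + ((I.m.choose K * (140 * (I.m + 1) * (K + 2) ^ 2 + 1) + 1) +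
      (1 + 1))) fun τ => τ.word 31 = K ∧
      StepRel T H I.m I.d j (K + 1) (coeff I O (σ.realArr 0)) (coeff I O (τ.realArr 0)) := by
    refine Runs.cons (Runs.of_wp (p := Prog.ops _) (Q := fun ρ => ρ.word 30 = 0 ∧
      ρ.word 48 = I.m.choose K) ?_ |>.mono (by decide) ?_)
    · have htab : I.m * (I.d + 1) + (I.d + 1) ≤ W := by
        refine le_trans ?_ hW.table
        nlinarith
      have hch := (choose_le_sum (d := I.d) (m := I.m) le_rfl (k := K) (by omega)).trans hW.coeffs
      have hbin := hE.binom I.m le_rfl K (by omega)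
      have e : I.m * (I.d + 1) + (K + 1) - 1 = I.m * (I.d + 1) + K := by omega
      simp [Prog.ops, Prog.block, Prog.wp, Op.wp, hE.m, hE.d1, h31, hE.one, e, hbin]
      omega
    rintro σ₁ hf₁ ⟨h30, h48⟩ -
    have hE₁ := hE.of_frame hf₁ (by decide)
    have r0 := hf₁.realArr 0 (by decide)
    refine Runs.cons ((Runs.loop (N := I.m.choose K) (t := 140 * (I.m + 1) * (K + 2) ^ 2)
      (Inv := fun r τ => τ.word 30 = r ∧ PartialStep T H I.m j (K + 1)
        (fun C => ∃ r' < r, unrank I.m K r' = C) (coeff I O (σ.realArr 0))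
        (coeff I O (τ.realArr 0))) ?_ ?_ ?_).mono le_rfl ?_)
    · refine ⟨h30, ?_⟩
      rw [r0]
      exact ⟨fun _ _ _ _ _ ⟨_, h, _⟩ => absurd h (Nat.not_lt_zero _),
        fun _ _ _ _ _ _ => ⟨rfl, fun _ _ _ => rfl⟩, fun _ _ _ => rfl⟩
    · rintro r hr ρ hf ⟨h1, h2⟩
      have hE' := hE₁.of_frame hf (by decide)
      refine ⟨by simp [Test.Holds, h1, hf.word 48 (by decide), h48, hr], ?_⟩
      refine (tupleBody_spec hW hN hE' hK hjK
        (by rw [hf.word 31 (by decide), hf₁.word 31 (by decide), h31])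
        (by rw [hf.word 32 (by decide), hf₁.word 32 (by decide), h32]) h1 hr).mono le_rfl ?_
      rintro τ - ⟨h3, lo, hi, h4, h5⟩ -
      refine ⟨h3, ?_⟩
      have h6 := h2.add h5 h4 (by rw [(Finset.mem_powersetCard.1 (unrank_mem hr)).2]) (by
        rintro ⟨r', h7, h8⟩
        have := unrank_inj (h7.trans hr) hr h8
        omega)
      convert h6 using 2 with X
      constructor
      · rintro ⟨r', h7, h8⟩
        by_cases h9 : r' = r
        · right; rw [← h8, h9]
        · exact .inl ⟨r', by omega, h8⟩
      · rintro (⟨r', h7, h8⟩ | h7)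
        · exact ⟨r', by omega, h8⟩
        · exact ⟨r, by omega, h7.symm⟩
    · rintro ρ hf ⟨h1, -⟩
      simp [Test.Holds, h1, hf.word 48 (by decide), h48]
    rintro σ₂ hf₂ ⟨-, h2⟩ -
    have hE₂ := hE₁.of_frame hf₂ (by decide)
    refine Runs.cons ((Runs.of_wp (p := .op _) ?_).mono (t' := 1) (by decide)
      fun τ _ h _ => Runs.nil h)
    have e31 : σ₂.word 31 = K + 1 := by
      rw [hf₂.word 31 (by decide), hf₁.word 31 (by decide), h31]
    simp only [Prog.wp, Op.wp, e31, hE₂.one]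
    refine ⟨by omega, by simp, coeff_supp _, fun C lo hi hg hc => h2.pass C lo hi hg hc ?_,
      h2.other⟩
    -- Each set `C` of `K` positions has a number below `I.m.choose K`, so its pass has been carried
    -- out.
    exact exists_unrank (Finset.mem_powersetCard.2 ⟨hg.sub, by omega⟩)
  refine key.mono ?_ fun _ _ h => h
  have h1 := choose_mul_sq_le I.m K
  have h2 : I.m ^ (K + 1) ≤ I.m ^ I.d := Nat.pow_le_pow_right hm hK
  rw [pow_succ] at h2
  have h3 : 1 ≤ I.m ^ I.d := Nat.one_le_pow _ _ hm
  have h4 : 1 ≤ (K + 2) ^ 2 := Nat.one_le_pow _ _ (by omega)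
  have h5 : I.m.choose K ≤ I.m.choose K * (K + 2) ^ 2 := Nat.le_mul_of_pos_right _ h4
  have h6 : I.m.choose K * (K + 2) ^ 2 * (I.m + 1) ≤ 9 * I.m ^ K * (I.m + 1) :=
    Nat.mul_le_mul_right _ h1
  have h7 : I.m ^ K ≤ I.m ^ K * I.m := Nat.le_mul_of_pos_right _ hm
  nlinarith

theorem stageBody_spec (hW : Wide I W) (hN : Numbering I O T H) (hE : Env I O T H σ)
    (hm : 1 ≤ I.m) (hj : j ≤ I.d) (h32 : σ.word 32 = j) :
    Runs W stageBody σ (I.d * (3000 * I.m ^ I.d + 1) + 4) fun τ => τ.word 32 = j + 1 ∧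
      Down T H I.m I.d j (coeff I O (σ.realArr 0)) j (coeff I O (τ.realArr 0)) := by
  have hd1 := hW.d1
  have key : Runs W stageBody σ (1 + (((I.d - j) * (3000 * I.m ^ I.d + 1) + 1) + (1 + 1)))
      fun τ => τ.word 32 = j + 1 ∧
        Down T H I.m I.d j (coeff I O (σ.realArr 0)) j (coeff I O (τ.realArr 0)) := by
    refine Runs.cons (Runs.of_wp (p := .op _) (Q := fun ρ => ρ.word 31 = I.d)
      ?_ |>.mono (by decide) ?_)
    · simp [Prog.wp, Op.wp, hE.d]; omega
    rintro σ₁ hf₁ h31 -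
    have hE₁ := hE.of_frame hf₁ (by decide)
    have r0 := hf₁.realArr 0 (by decide)
    have h32₁ := (hf₁.word 32 (by decide)).trans h32
    refine Runs.cons ((Runs.loop (N := I.d - j) (t := 3000 * I.m ^ I.d)
      (Inv := fun i τ => τ.word 31 = I.d - i ∧
        Down T H I.m I.d j (coeff I O (σ.realArr 0)) (I.d - i) (coeff I O (τ.realArr 0)))
      ?_ ?_ ?_).mono le_rfl ?_)
    · refine ⟨h31, ?_⟩
      rw [r0]
      exact .start
    · rintro i hi ρ hf ⟨h1, h2⟩
      have hE' := hE₁.of_frame hf (by decide)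
      have e : I.d - (i + 1) + 1 = I.d - i := by omega
      refine ⟨by simp [Test.Holds, h1, hf.word 32 (by decide), h32₁]; omega, ?_⟩
      refine (levelBody_spec (K := I.d - (i + 1)) (j := j) hW hN hE' hm (by omega) (by omega)
        (h1.trans e.symm) ((hf.word 32 (by decide)).trans h32₁)).mono le_rfl ?_
      rintro τ - ⟨h3, h4⟩ -
      rw [← e] at h2
      exact ⟨h3, .step h2 (by omega) h4⟩
    · rintro ρ hf ⟨h1, -⟩
      simp [Test.Holds, h1, hf.word 32 (by decide), h32₁]
      omega
    rintro σ₂ hf₂ ⟨-, h2⟩ -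
    have hE₂ := hE₁.of_frame hf₂ (by decide)
    rw [show I.d - (I.d - j) = j by omega] at h2
    refine Runs.cons ((Runs.of_wp (p := .op _) ?_).mono (t' := 1) (by decide)
      fun τ _ h _ => Runs.nil h)
    simp only [Prog.wp, Op.wp, hf₂.word 32 (by decide), h32₁, hE₂.one]
    exact ⟨by omega, by simp, h2⟩
  refine key.mono ?_ fun _ _ h => h
  have : (I.d - j) * (3000 * I.m ^ I.d + 1) ≤ I.d * (3000 * I.m ^ I.d + 1) :=
    Nat.mul_le_mul_right _ (Nat.sub_le _ _)
  omega

theorem normalizeProg_spec (hW : Wide I W) (hN : Numbering I O T H) (hE : Env I O T H σ)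
    (hm : 1 ≤ I.m) :
    Runs W normalizeProg σ (10000 * I.d ^ 2 * I.m ^ I.d) fun τ =>
      Stages T H I.m I.d (coeff I O (σ.realArr 0)) (I.d + 1) (coeff I O (τ.realArr 0)) := by
  have hd1 := hW.d1
  have key : Runs W normalizeProg σ
      (1 + (((I.d + 1) * (I.d * (3000 * I.m ^ I.d + 1) + 4 + 1) + 1) + 1)) fun τ =>
      Stages T H I.m I.d (coeff I O (σ.realArr 0)) (I.d + 1) (coeff I O (τ.realArr 0)) := by
    refine Runs.cons (Runs.of_wp (p := .op _) (Q := fun ρ => ρ.word 32 = 0)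
      ?_ |>.mono (by decide) ?_)
    · simp [Prog.wp, Op.wp]
    rintro σ₁ hf₁ h32 -
    have hE₁ := hE.of_frame hf₁ (by decide)
    have r0 := hf₁.realArr 0 (by decide)
    refine Runs.cons ((Runs.loop (N := I.d + 1) (t := I.d * (3000 * I.m ^ I.d + 1) + 4)
      (Inv := fun j τ => τ.word 32 = j ∧
        Stages T H I.m I.d (coeff I O (σ.realArr 0)) j (coeff I O (τ.realArr 0)))
      ?_ ?_ ?_).mono le_rfl ?_)
    · refine ⟨h32, ?_⟩
      rw [r0]
      exact .zero
    · rintro j hj ρ hf ⟨h1, h2⟩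
      have hE' := hE₁.of_frame hf (by decide)
      refine ⟨by simp [Test.Holds, h1, hE'.d1]; omega, ?_⟩
      refine (stageBody_spec hW hN hE' hm (by omega) h1).mono le_rfl ?_
      rintro τ - ⟨h3, h4⟩ -
      exact ⟨h3, .succ h2 h4⟩
    · rintro ρ hf ⟨h1, -⟩
      have hE' := hE₁.of_frame hf (by decide)
      simp [Test.Holds, h1, hE'.d1]
    rintro σ₂ hf₂ ⟨-, h2⟩ -
    exact Runs.nil h2
  refine key.mono ?_ fun _ _ h => h
  have h1 := I.two_le_d
  have h3 : 1 ≤ I.m ^ I.d := Nat.one_le_pow _ _ hm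
  have h4 : I.d * I.d ≤ I.d * I.d * I.m ^ I.d := Nat.le_mul_of_pos_right _ h3
  have h5 : 2 * (I.d * I.m ^ I.d) ≤ I.d * (I.d * I.m ^ I.d) := Nat.mul_le_mul_right _ h1
  have h6 : 2 * I.d ≤ I.d * I.d := Nat.mul_le_mul_right _ h1
  rw [pow_two, Nat.mul_assoc]
  nlinarith

end LinSPP

namespace LinSPP

/-! ### Preprocessing -/

/-- The input and the constants in the word registers. -/
structure Input (I : Instance) (σ : State) : Prop where
  m : σ.word 1 = I.m
  s : σ.word 2 = I.s
  t : σ.word 3 = I.t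
  d : σ.word 4 = I.d
  one : σ.word 5 = 1
  zero : σ.word 6 = 0
  m1 : σ.word 7 = I.m + 1
  d1 : σ.word 8 = I.d + 1
  tails : ∀ a : Fin I.m, σ.wordArr 0 a = I.tail a
  heads : ∀ a : Fin I.m, σ.wordArr 1 a = I.head a
  real : σ.real 0 = 0

/-- `p` leaves the input alone. -/
def Prog.KeepsInput (p : Prog) : Prop :=
  (∀ x ∈ [1, 2, 3, 4, 5, 6, 7, 8], x ∉ p.mods.1) ∧ 0 ∉ p.mods.2.1 ∧
    ∀ x ∈ [0, 1], x ∉ p.mods.2.2.1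

instance (p : Prog) : Decidable p.KeepsInput := by unfold Prog.KeepsInput; infer_instance

variable {I : Instance} {W : ℕ} {σ : State}

theorem Input.of_frame {τ : State} {p : Prog} (h : Input I σ)
    (hf : Frame p σ τ) (hp : p.KeepsInput) : Input I τ := by
  obtain ⟨h1, h2, h3⟩ := hp
  have w : ∀ x ∈ [1, 2, 3, 4, 5, 6, 7, 8], τ.word x = σ.word x := fun x hx => hf.word x (h1 x hx)
  have a : ∀ x ∈ [0, 1], τ.wordArr x = σ.wordArr x := fun x hx => hf.wordArr x (h3 x hx)
  constructor
  · rw [w 1 (by decide), h.m]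
  · rw [w 2 (by decide), h.s]
  · rw [w 3 (by decide), h.t]
  · rw [w 4 (by decide), h.d]
  · rw [w 5 (by decide), h.one]
  · rw [w 6 (by decide), h.zero]
  · rw [w 7 (by decide), h.m1]
  · rw [w 8 (by decide), h.d1]
  · rw [a 0 (by decide)]; exact h.tails
  · rw [a 1 (by decide)]; exact h.heads
  · rw [hf.real 0 h2, h.real]

/-- Compute one binomial coefficient. -/
def binomCell : Prog := .block [
  .ite (.eq 12 6) (.op (.const 13 1)) (.ite (.eq 10 6) (.op (.const 13 0))
    (Prog.ops [.sub 14 11 8, .load 13 2 14, .sub 14 14 5, .load 14 2 14, .add 13 13 14])),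
  Prog.ops [.store 2 11 13, .add 11 11 5, .add 12 12 5]]

/-- Compute one row of the table of binomial coefficients. -/
def binomRow : Prog := .block [.op (.const 12 0), .while (.lt 12 8) binomCell,
  .op (.add 10 10 5)]

/-- Compute the table of binomial coefficients. -/
def binomProg : Prog := .block [Prog.ops [.const 10 0, .const 11 0],
  .while (.lt 10 7) binomRow]

/-- The table is complete up to column `k` of row `x`. -/
def BinomInv (I : Instance) (x k : ℕ) (τ : State) : Prop :=
  τ.word 10 = x ∧ τ.word 12 = k ∧ τ.word 11 = x * (I.d + 1) + k ∧
    ∀ y z, z ≤ I.d → (y < x ∨ y = x ∧ z < k) → τ.wordArr 2 (y * (I.d + 1) + z) = y.choose z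

theorem binomCell_spec (hW : Wide I W) (hI : Input I σ) {x k : ℕ} (hx : x ≤ I.m) (hk : k ≤ I.d)
    (h : BinomInv I x k σ) : Runs W binomCell σ 15 (BinomInv I x (k + 1)) := by
  obtain ⟨h10, h12, h11, htab⟩ := h
  have hm1 := hW.m1
  have hd1 := hW.d1
  have hidx : x * (I.d + 1) + (I.d + 1) ≤ W := by
    refine le_trans ?_ hW.table
    nlinarith
  have hch := (choose_le_sum (d := I.d) hx hk).trans hW.coeffs
  have upd : ∀ v, v = x.choose k → ∀ y z, z ≤ I.d → (y < x ∨ y = x ∧ z < k + 1) →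
      Function.update (σ.wordArr 2) (x * (I.d + 1) + k) v (y * (I.d + 1) + z) = y.choose z := by
    rintro v rfl y z hz hyz
    rw [Function.update_apply]
    split_ifs with e
    · obtain ⟨rfl, rfl⟩ := index_inj (by omega) (by omega) e
      rfl
    · apply htab y z hz
      rcases hyz with h | ⟨rfl, h⟩
      · exact .inl h
      · refine .inr ⟨rfl, ?_⟩
        rcases Nat.lt_succ_iff_lt_or_eq.1 h with h | rfl
        · exact h
        · exact absurd rfl e
  refine (Runs.of_wp ?_).mono (by decide) fun τ _ h => h
  simp [binomCell, Prog.ops, Prog.block, Prog.wp, Op.wp, Test.Holds, h10, h12, h11, hI.zero,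
    hI.one, hI.d1]
  refine ⟨fun h0 => ⟨by omega, by omega, by omega, ?_⟩, fun h0 => ⟨fun hx0 => ⟨by omega, by omega, ?_⟩,
    fun hx0 => ?_⟩⟩
  · refine ⟨by simp [h10], by simp, by simp; omega, ?_⟩
    simpa using upd 1 (by rw [h0, Nat.choose_zero_right])
  · refine ⟨by simp [h10], by simp, by simp; omega, ?_⟩
    simpa using upd 0 (by
      obtain ⟨k', rfl⟩ := Nat.exists_eq_succ_of_ne_zero h0
      rw [hx0, Nat.choose_zero_succ])
  · obtain ⟨k', rfl⟩ := Nat.exists_eq_succ_of_ne_zero h0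
    obtain ⟨x', rfl⟩ := Nat.exists_eq_succ_of_ne_zero hx0
    simp only [Nat.succ_eq_add_one] at *
    -- The table is stored by rows of length `d + 1`: going back one row, and then one column, gives
    -- the two summands of Pascal's rule.
    have e1 : (x' + 1) * (I.d + 1) + (k' + 1) - (I.d + 1) = x' * (I.d + 1) + (k' + 1) := by
      rw [Nat.succ_mul]; omega
    have e2 : x' * (I.d + 1) + (k' + 1) - 1 = x' * (I.d + 1) + k' := by omega
    have t1 := htab x' (k' + 1) hk (.inl (by omega))
    have t2 := htab x' k' (by omega) (.inl (by omega))
    rw [Nat.choose_succ_succ'] at hch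
    rw [e1, t1, e2, t2]
    refine ⟨by omega, by omega, by omega, by omega, by omega, by omega, by omega, ?_⟩
    refine ⟨by simp [h10], by simp, by simp; omega, ?_⟩
    simpa using upd (x'.choose (k' + 1) + x'.choose k') (by rw [Nat.choose_succ_succ']; omega)

theorem binomProg_spec (hW : Wide I W) (hI : Input I σ) :
    Runs W binomProg σ (40 * ((I.m + 1) * (I.d + 1))) fun τ =>
      ∀ x ≤ I.m, ∀ k ≤ I.d, τ.wordArr 2 (x * (I.d + 1) + k) = x.choose k := by
  have hm1 := hW.m1
  have key : Runs W binomProg σ (3 + (((I.m + 1) * (1 + (((I.d + 1) * (15 + 1) + 1) + (1 + 1)) + 1)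
      + 1) + 1)) fun τ =>
      ∀ x ≤ I.m, ∀ k ≤ I.d, τ.wordArr 2 (x * (I.d + 1) + k) = x.choose k := by
    refine Runs.cons (Runs.of_wp (p := Prog.ops _) (Q := fun ρ => ρ.word 10 = 0 ∧ ρ.word 11 = 0)
      ?_ |>.mono (by decide) ?_)
    · simp [Prog.ops, Prog.block, Prog.wp, Op.wp]
    rintro σ₁ hf₁ ⟨h10, h11⟩ -
    have hI₁ := hI.of_frame hf₁ (by decide)
    refine Runs.cons ((Runs.loop (N := I.m + 1) (t := 1 + (((I.d + 1) * (15 + 1) + 1) + (1 + 1)))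
      (Inv := fun x τ => τ.word 10 = x ∧ τ.word 11 = x * (I.d + 1) ∧
        ∀ y z, z ≤ I.d → y < x → τ.wordArr 2 (y * (I.d + 1) + z) = y.choose z)
      ?_ ?_ ?_).mono le_rfl ?_)
    · exact ⟨h10, by simpa using h11, fun y z _ h => absurd h (Nat.not_lt_zero _)⟩
    · rintro x hx ρ hf ⟨h1, h2, h3⟩
      have hI' := hI₁.of_frame hf (by decide)
      refine ⟨by simp [Test.Holds, h1, hI'.m1]; omega, ?_⟩
      refine Runs.cons (Runs.of_wp (p := .op _) (Q := BinomInv I x 0) ?_ |>.mono (by decide) ?_)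
      · simp only [Prog.wp, Op.wp]
        refine ⟨by omega, by simp [h1], by simp, by simp [h2], ?_⟩
        rintro y z hz (h | h)
        · simpa using h3 y z hz h
        · omega
      intro ρ₁ hf₁ h4 _
      have hI₁ := hI'.of_frame hf₁ (by decide)
      refine Runs.cons ((Runs.loop (N := I.d + 1) (t := 15) (Inv := BinomInv I x) h4 ?_ ?_).mono
        le_rfl ?_)
      · rintro k hk ρ' hf' h
        have hI'' := hI₁.of_frame hf' (by decide)
        refine ⟨by simp [Test.Holds, h.2.1, hI''.d1]; omega, ?_⟩
        exact (binomCell_spec hW hI'' (by omega) (by omega) h).mono le_rfl fun _ _ h _ => h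
      · rintro ρ' hf' h
        have hI'' := hI₁.of_frame hf' (by decide)
        simp [Test.Holds, h.2.1, hI''.d1]
      rintro ρ₂ hf₂ ⟨h5, -, h6, h7⟩ -
      have hI₂ := hI₁.of_frame hf₂ (by decide)
      refine Runs.cons ((Runs.of_wp (p := .op _) ?_).mono (t' := 1) (by decide)
        fun τ _ h _ => Runs.nil fun _ => h)
      simp only [Prog.wp, Op.wp, h5, hI₂.one]
      refine ⟨by omega, by simp, by simp [h6, Nat.succ_mul], fun y z hz hy => ?_⟩
      simpa using h7 y z hz (by omega)
    · rintro ρ hf ⟨h1, -⟩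
      have hI' := hI₁.of_frame hf (by decide)
      simp [Test.Holds, h1, hI'.m1]
    rintro σ₂ - ⟨-, -, h⟩ -
    exact Runs.nil fun x hx k hk => h x k hk (by omega)
  refine key.mono ?_ fun _ _ h => h
  nlinarith

/-- Add one binomial coefficient. -/
def baseBody : Prog :=
  Prog.ops [.load 13 2 11, .add 12 12 13, .add 10 10 5, .add 11 11 5, .store 3 10 12]

/-- Compute the partial sums of the last row of the table. -/
def baseProg : Prog := .block [
  Prog.ops [.const 10 0, .mul 11 1 8, .const 12 0, .store 3 6 6], .while (.lt 10 8) baseBody]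

theorem baseProg_spec (hW : Wide I W) (hI : Input I σ)
    (hbin : ∀ x ≤ I.m, ∀ k ≤ I.d, σ.wordArr 2 (x * (I.d + 1) + k) = x.choose k) :
    Runs W baseProg σ (20 * (I.d + 1)) fun τ =>
      ∀ k ≤ I.d + 1, τ.wordArr 3 k = ∑ j ∈ Finset.range k, I.m.choose j := by
  have hm1 := hW.m1
  have hd1 := hW.d1
  have hidx : I.m * (I.d + 1) + (I.d + 1) ≤ W := by
    refine le_trans ?_ hW.table
    nlinarith
  have key : Runs W baseProg σ (5 + (((I.d + 1) * (6 + 1) + 1) + 1)) fun τ =>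
      ∀ k ≤ I.d + 1, τ.wordArr 3 k = ∑ j ∈ Finset.range k, I.m.choose j := by
    have hstart : (Prog.ops [.const 10 0, .mul 11 1 8, .const 12 0, .store 3 6 6]).wp W σ
        fun ρ => ρ.word 10 = 0 ∧ ρ.word 11 = I.m * (I.d + 1) ∧ ρ.word 12 = 0 ∧
          ρ.wordArr 3 0 = 0 := by
      simp [Prog.ops, Prog.block, Prog.wp, Op.wp, hI.m, hI.d1, hI.zero]
      omega
    refine Runs.cons (Runs.of_wp hstart |>.mono (by decide) ?_)
    rintro σ₁ hf₁ ⟨h10, h11, h12, h3⟩ -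
    have hI₁ := hI.of_frame hf₁ (by decide)
    have e2 := hf₁.wordArr 2 (by decide)
    refine Runs.cons ((Runs.loop (N := I.d + 1) (t := 6) (Inv := fun k τ => τ.word 10 = k ∧
      τ.word 11 = I.m * (I.d + 1) + k ∧ τ.word 12 = ∑ j ∈ Finset.range k, I.m.choose j ∧
      ∀ i ≤ k, τ.wordArr 3 i = ∑ j ∈ Finset.range i, I.m.choose j) ?_ ?_ ?_).mono le_rfl ?_)
    · refine ⟨h10, by simpa using h11, by simpa using h12, fun i hi => ?_⟩
      obtain rfl : i = 0 := by omega
      simpa using h3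
    · rintro k hk ρ hf ⟨h4, h5, h6, h7⟩
      have hI' := hI₁.of_frame hf (by decide)
      have e2' := (hf.wordArr 2 (by decide)).trans e2
      refine ⟨by simp [Test.Holds, h4, hI'.d1]; omega, ?_⟩
      refine (Runs.of_wp ?_).mono (by decide) fun τ _ h _ => h
      have hb := hbin I.m le_rfl k (by omega)
      have hc := (sum_choose_mono I.m (show k + 1 ≤ I.d + 1 by omega)).trans hW.coeffs
      rw [Finset.sum_range_succ] at hc
      simp [baseBody, Prog.ops, Prog.block, Prog.wp, Op.wp, h4, h5, h6, e2', hb, hI'.one]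
      refine ⟨by omega, by omega, by omega, by omega, by omega,
        by rw [Finset.sum_range_succ], fun i hi => ?_⟩
      rw [Function.update_apply]
      split_ifs with h
      · rw [h, Finset.sum_range_succ]
      · exact h7 i (by omega)
    · rintro ρ hf ⟨h1, -⟩
      have hI' := hI₁.of_frame hf (by decide)
      simp [Test.Holds, h1, hI'.d1]
    rintro σ₂ - ⟨-, -, -, h⟩ -
    exact Runs.nil h
  exact key.mono (by omega) fun _ _ h => h

/-! ### Topological numbering of the arcs -/

theorem Instance.exists_walk {a b : Fin I.m}
    (h : Relation.TransGen (fun a b => I.head a = I.tail b) a b) :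
    ∃ P, P ≠ [] ∧ I.IsWalk (I.tail a) (I.tail b) P := by
  induction h using Relation.TransGen.head_induction_on with
  | single h => exact ⟨[_], by simp, rfl, h⟩
  | head h _ ih =>
    obtain ⟨P, -, hP⟩ := ih
    exact ⟨_ :: P, by simp, rfl, by rw [h]; exact hP⟩

/-- In an acyclic digraph, some arc of a nonempty set has no successor in the set. -/
theorem Instance.Acyclic.exists_last (hac : I.Acyclic) {U : Finset (Fin I.m)} (hU : U.Nonempty) :
    ∃ a ∈ U, ∀ b ∈ U, I.tail b ≠ I.head a := by
  -- `r a b` says that `a` comes after `b` on some walk. By acyclicity this is a strict order on a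
  -- finite set, and a minimal element of `U` has no successor in `U`.
  let r : Fin I.m → Fin I.m → Prop :=
    fun a b => Relation.TransGen (fun a b => I.head a = I.tail b) b a
  have : IsTrans (Fin I.m) r := ⟨fun a b c h1 h2 => Relation.TransGen.trans h2 h1⟩
  have : Std.Irrefl r := ⟨fun a h => by
    obtain ⟨P, h1, h2⟩ := Instance.exists_walk h
    exact h1 (hac _ P h2)⟩
  have wf : WellFounded r := Finite.wellFounded_of_trans_of_irrefl r
  obtain ⟨a, ha, hmin⟩ := wf.has_min (U : Set (Fin I.m)) hU
  exact ⟨a, ha, fun b hb h => hmin b hb (.single h.symm)⟩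

/-- Count one arc at its tail. -/
def countBody : Prog := Prog.ops [.load 11 0 10, .load 12 7 11, .add 12 12 5, .store 7 11 12,
  .add 10 10 5]

/-- Count the arcs at their tails. -/
def countProg : Prog := .block [.op (.const 10 0), .while (.lt 10 1) countBody]

/-- Consider one arc for the next position. -/
def selectBody : Prog := .block [.op (.load 12 8 11),
  .ite (.eq 12 6) (.block [Prog.ops [.load 13 1 11, .load 14 7 13],
    .ite (.eq 14 6) (.op (.move 15 11)) .skip]) .skip, .op (.add 11 11 5)]

/-- Number one arc. -/
def placeBody : Prog := .block [Prog.ops [.const 11 0, .const 15 0],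
  .while (.lt 11 1) selectBody,
  Prog.ops [.store 4 10 15, .load 12 0 15, .store 5 10 12, .load 13 1 15, .store 6 10 13,
    .store 8 15 5, .load 14 7 12, .sub 14 14 5, .store 7 12 14, .sub 10 10 5]]

/-- Number the arcs topologically. -/
def topoProg : Prog := .block [countProg, .op (.move 10 1), .while (.lt 6 10) placeBody,
  Prog.ops [.store 6 6 2, .store 5 7 3]]

/-- The arcs in `U` are still to be numbered. -/
structure TopoInv (I : Instance) (p : ℕ) (U : Finset (Fin I.m)) (τ : State) : Prop where
  card : U.card = p
  pos : τ.word 10 = p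
  placed : ∀ a : Fin I.m, τ.wordArr 8 a = if a ∈ U then 0 else 1
  count : ∀ v, τ.wordArr 7 v = (U.filter (fun a => (I.tail a : ℕ) = v)).card
  arc : ∀ p', p < p' → p' ≤ I.m → ∃ a : Fin I.m, a ∉ U ∧ τ.wordArr 4 p' = a ∧
    τ.wordArr 5 p' = I.tail a ∧ τ.wordArr 6 p' = I.head a ∧ ∀ b ∈ U, I.tail b ≠ I.head a
  inj : ∀ p₁ p₂, p < p₁ → p₁ ≤ I.m → p < p₂ → p₂ ≤ I.m → τ.wordArr 4 p₁ = τ.wordArr 4 p₂ → p₁ = p₂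
  lt : ∀ p₁ p₂, p < p₁ → p₁ ≤ I.m → p < p₂ → p₂ ≤ I.m → τ.wordArr 6 p₁ = τ.wordArr 5 p₂ → p₁ < p₂

theorem countProg_spec (hW : Wide I W) (hI : Input I σ) (h7 : σ.wordArr 7 = fun _ => 0) :
    Runs W countProg σ (I.m * 7 + 3) fun τ =>
      ∀ v, τ.wordArr 7 v = (Finset.univ.filter (fun a => (I.tail a : ℕ) = v)).card := by
  have hm1 := hW.m1
  have hn := hW.n
  obtain ⟨F, hF⟩ : ∃ F : ℕ → ℕ → ℕ, ∀ i v, F i v =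
      (Finset.univ.filter (fun a : Fin I.m => (a : ℕ) < i ∧ (I.tail a : ℕ) = v)).card :=
    ⟨_, fun _ _ => rfl⟩
  have key : Runs W countProg σ (1 + ((I.m * (6 + 1) + 1) + 1)) fun τ =>
      ∀ v, τ.wordArr 7 v = (Finset.univ.filter (fun a => (I.tail a : ℕ) = v)).card := by
    refine Runs.cons (Runs.of_wp (p := .op _) (Q := fun ρ => ρ.word 10 = 0) ?_ |>.mono (by decide) ?_)
    · simp [Prog.wp, Op.wp]
    intro σ₁ hf₁ h10 _
    have hI₁ := hI.of_frame hf₁ (by decide)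
    have e7 := (hf₁.wordArr 7 (by decide)).trans h7
    refine Runs.cons ((Runs.loop (N := I.m) (t := 6) (Inv := fun i τ => τ.word 10 = i ∧
      ∀ v, τ.wordArr 7 v = F i v)
      ?_ ?_ ?_).mono le_rfl ?_)
    · exact ⟨h10, fun v => by simp [e7, hF]⟩
    · rintro i hi ρ hf ⟨h1, h2⟩
      have hI' := hI₁.of_frame hf (by decide)
      refine ⟨by simp [Test.Holds, h1, hI'.m, hi], ?_⟩
      refine (Runs.of_wp ?_).mono (by decide) fun τ _ h _ => h
      have ht := hI'.tails ⟨i, hi⟩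
      simp only at ht
      have htn := (I.tail ⟨i, hi⟩).2
      have hins : ∀ v, F (i + 1) v = F i v + if (I.tail ⟨i, hi⟩ : ℕ) = v then 1 else 0 := by
        intro v
        rw [hF, hF]
        split_ifs with hv
        · rw [← Finset.card_insert_of_notMem (a := (⟨i, hi⟩ : Fin I.m)) (by simp)]
          congr 1
          ext a
          simp only [Finset.mem_filter, Finset.mem_univ, true_and, Finset.mem_insert]
          constructor
          · rintro ⟨h3, h4⟩
            by_cases h5 : (a : ℕ) = i
            · exact .inl (Fin.ext h5)
            · exact .inr ⟨by omega, h4⟩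
          · rintro (rfl | ⟨h3, h4⟩)
            · exact ⟨by simp, hv⟩
            · exact ⟨by omega, h4⟩
        · rw [add_zero]
          congr 1
          ext a
          simp only [Finset.mem_filter, Finset.mem_univ, true_and]
          constructor
          · rintro ⟨h3, h4⟩
            have h5 : (a : ℕ) ≠ i := by
              intro h5
              obtain rfl : a = ⟨i, hi⟩ := Fin.ext h5
              exact hv h4
            exact ⟨by omega, h4⟩
          · rintro ⟨h3, h4⟩
            exact ⟨by omega, h4⟩
      have hle : F (i + 1) (I.tail ⟨i, hi⟩) ≤ I.m := by
        rw [hF]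
        exact (Finset.card_filter_le _ _).trans (by simp)
      rw [hins, if_pos rfl] at hle
      simp [countBody, Prog.ops, Prog.block, Prog.wp, Op.wp, h1, ht, hI'.one, h2]
      refine ⟨by omega, by omega, by omega, by omega, fun v => ?_⟩
      rw [Function.update_apply, hins]
      split_ifs with h3 h4 h4
      · rw [h3]
      · exact absurd h3.symm h4
      · exact absurd h4.symm h3
      · rw [h2, add_zero]
    · rintro ρ hf ⟨h1, -⟩
      have hI' := hI₁.of_frame hf (by decide)
      simp [Test.Holds, h1, hI'.m]
    rintro σ₂ - ⟨-, h⟩ -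
    refine Runs.nil fun v => ?_
    rw [h v, hF]
    congr 1
    ext a
    simp
  exact key.mono (by omega) fun _ _ h => h

/-- Positions are assigned from `m` downwards, each to an unplaced arc whose head is the tail of no
unplaced arc; acyclicity provides one. The linear search costs `O(m²)` overall, which is affordable
because `d ≥ 2`. -/
theorem placeBody_spec (hW : Wide I W) (hI : Input I σ) (hac : I.Acyclic) {p : ℕ}
    {U : Finset (Fin I.m)} (h : TopoInv I (p + 1) U σ) :
    Runs W placeBody σ (20 * (I.m + 1)) fun τ => ∃ U, TopoInv I p U τ := by
  have hm1 := hW.m1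
  have hn := hW.n
  have hUm : U.card ≤ I.m := by simpa using Finset.card_le_univ U
  have hcle : ∀ v, σ.wordArr 7 v ≤ I.m := fun v => by
    rw [h.count]; exact (Finset.card_filter_le _ _).trans hUm
  have key : Runs W placeBody σ (3 + ((I.m * (10 + 1) + 1) + (11 + 1))) fun τ =>
      ∃ U, TopoInv I p U τ := by
    refine Runs.cons (Runs.of_wp (p := Prog.ops _) (Q := fun ρ => ρ.word 11 = 0 ∧ ρ.word 15 = 0)
      ?_ |>.mono (by decide) ?_)
    · simp [Prog.ops, Prog.block, Prog.wp, Op.wp]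
    rintro σ₁ hf₁ ⟨h11, h15⟩ -
    have hI₁ := hI.of_frame hf₁ (by decide)
    -- Either register `15` holds a suitable arc, possibly replaced by a later one, or none of the
    -- arcs inspected so far is suitable. The initial value `0` of the register means nothing.
    refine Runs.cons ((Runs.loop (N := I.m) (t := 10) (Inv := fun i τ => τ.word 11 = i ∧
      ((∃ a ∈ U, τ.word 15 = a ∧ ∀ b ∈ U, I.tail b ≠ I.head a) ∨
        ∀ a ∈ U, (a : ℕ) < i → ∃ b ∈ U, I.tail b = I.head a)) ?_ ?_ ?_).mono le_rfl ?_)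
    · exact ⟨h11, .inr fun a _ ha => absurd ha (Nat.not_lt_zero _)⟩
    · rintro i hi ρ hf ⟨h1, h2⟩
      have hI' := hI₁.of_frame hf (by decide)
      have e7 := (hf.wordArr 7 (by decide)).trans (hf₁.wordArr 7 (by decide))
      have e8 := (hf.wordArr 8 (by decide)).trans (hf₁.wordArr 8 (by decide))
      refine ⟨by simp [Test.Holds, h1, hI'.m, hi], ?_⟩
      refine (Runs.of_wp ?_).mono (by decide) fun τ _ h _ => h
      have hp := h.placed ⟨i, hi⟩
      have hh := hI'.heads ⟨i, hi⟩
      have hhn := (I.head ⟨i, hi⟩).2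
      have hc := hcle (I.head ⟨i, hi⟩)
      have hcount := h.count (I.head ⟨i, hi⟩)
      simp only at hp hh
      have hstep : (∃ b ∈ U, I.tail b = I.head ⟨i, hi⟩) ∨ (⟨i, hi⟩ : Fin I.m) ∉ U →
          ((∃ a ∈ U, ρ.word 15 = a ∧ ∀ b ∈ U, I.tail b ≠ I.head a) ∨
            ∀ a ∈ U, (a : ℕ) ≤ i → ∃ b ∈ U, I.tail b = I.head a) := by
        intro h3
        refine h2.imp_right fun h4 a ha hai => ?_
        by_cases h5 : (a : ℕ) = i
        · obtain rfl : a = ⟨i, hi⟩ := Fin.ext h5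
          exact h3.resolve_right (not_not.2 ha)
        · exact h4 a ha (by omega)
      simp [selectBody, Prog.ops, Prog.block, Prog.wp, Op.wp, Test.Holds, h1, e7, e8, hp, hh,
        hI'.zero, hI'.one]
      refine ⟨by split_ifs <;> omega, fun hU => ⟨by omega, by omega, fun h0 => ⟨by omega, by omega,
        .inl ⟨_, hU, rfl, fun b hb hb' => ?_⟩⟩, fun h0 => ⟨by omega, hstep (.inl ?_)⟩⟩,
        fun hU => ⟨by omega, hstep (.inr hU)⟩⟩
      · rw [hcount, Finset.card_eq_zero, Finset.filter_eq_empty_iff] at h0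
        exact h0 hb (by rw [hb'])
      · rw [hcount, Finset.card_eq_zero, Finset.filter_eq_empty_iff] at h0
        push Not at h0
        obtain ⟨b, hb, hb'⟩ := h0
        exact ⟨b, hb, Fin.ext hb'⟩
    · rintro ρ hf ⟨h1, -⟩
      have hI' := hI₁.of_frame hf (by decide)
      simp [Test.Holds, h1, hI'.m]
    rintro σ₂ hf₂ ⟨-, h2⟩ -
    have hI₂ := hI₁.of_frame hf₂ (by decide)
    obtain ⟨a, haU, e15, hlast⟩ : ∃ a ∈ U, σ₂.word 15 = a ∧ ∀ b ∈ U, I.tail b ≠ I.head a := by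
      refine h2.resolve_right fun h3 => ?_
      obtain ⟨a, ha, hmin⟩ := hac.exists_last (U := U) (Finset.card_pos.1 (by rw [h.card]; omega))
      obtain ⟨b, hb, hb'⟩ := h3 a ha a.2
      exact hmin b hb hb'
    have e : ∀ x, x ∉ ([] : List ℕ) → σ₂.wordArr x = σ.wordArr x := fun x hx => by
      rw [hf₂.wordArr x hx, hf₁.wordArr x hx]
    have e10 : σ₂.word 10 = p + 1 := by
      rw [hf₂.word 10 (by decide), hf₁.word 10 (by decide), h.pos]
    have ht := hI₂.tails a
    have hh := hI₂.heads a
    have htn := (I.tail a).2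
    have hhn := (I.head a).2
    have hc := hcle (I.tail a)
    have hpm : p + 1 ≤ I.m := by rw [← h.card]; exact hUm
    rw [e 0 (by simp)] at ht
    rw [e 1 (by simp)] at hh
    refine Runs.cons ((Runs.of_wp (p := Prog.ops _) ?_).mono (t' := 11) (by decide)
      fun τ _ h _ => Runs.nil h)
    simp [Prog.ops, Prog.block, Prog.wp, Op.wp, e15, e10, hI₂.one, e, ht, hh]
    refine ⟨by omega, by omega, by omega, by omega, by omega, U.erase a, ?_, by simp, ?_, ?_, ?_,
      ?_, ?_⟩
    · rw [Finset.card_erase_of_mem haU, h.card]; rfl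
    · intro b
      simp [e, Function.update_apply, h.placed]
      by_cases hba : b = a
      · simp [hba]
      · rw [if_neg (fun h => hba (Fin.ext h))]
        simp [hba]
    · intro v
      simp [e, Function.update_apply, h.count]
      rw [Finset.filter_erase]
      split_ifs with hv
      · subst hv
        rw [Finset.card_erase_of_mem (by simp [haU])]
      · rw [Finset.erase_eq_of_notMem]
        simp only [Finset.mem_filter, not_and]
        exact fun _ h => hv h.symm
    · intro p' h1 h2
      simp [e, Function.update_apply]
      by_cases hp : p' = p + 1
      · subst hp
        exact ⟨a, by simp, by simp, by simp, by simp, fun b _ hb => hlast b hb⟩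
      · obtain ⟨a', h3, h4, h5, h6, h7⟩ := h.arc p' (by omega) h2
        exact ⟨a', fun _ => h3, by simp [hp, h4], by simp [hp, h5], by simp [hp, h6],
          fun b _ hb => h7 b hb⟩
    · intro p₁ p₂ h1 h2 h3 h4
      have hne : ∀ p', p' ≠ p + 1 → p < p' → p' ≤ I.m → σ.wordArr 4 p' ≠ a := by
        intro p' h5 h6 h7 h8
        obtain ⟨a', h9, h10, -⟩ := h.arc p' (by omega) h7
        rw [h10] at h8
        exact h9 (Fin.ext h8 ▸ haU)
      simp [e, Function.update_apply]
      split_ifs with h5 h6 h6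
      · intro; omega
      · exact fun h => absurd h.symm (hne p₂ h6 h3 h4)
      · exact fun h => absurd h (hne p₁ h5 h1 h2)
      · exact fun h' => h.inj p₁ p₂ (by omega) h2 (by omega) h4 h'
    · intro p₁ p₂ h1 h2 h3 h4
      simp [e, Function.update_apply]
      split_ifs with h5 h6 h6
      · exact fun h => absurd (Fin.ext h).symm (hlast a haU)
      · intro; omega
      · obtain ⟨a', h7, h8, h9, h10, h11⟩ := h.arc p₁ (by omega) h2
        rw [h10]
        exact fun h => absurd (Fin.ext h).symm (h11 a haU)
      · exact fun h' => h.lt p₁ p₂ (by omega) h2 (by omega) h4 h'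
  exact key.mono (by omega) fun _ _ h => h

theorem topoProg_spec (hW : Wide I W) (hI : Input I σ) (hac : I.Acyclic)
    (h7 : σ.wordArr 7 = fun _ => 0) (h8 : σ.wordArr 8 = fun _ => 0) :
    Runs W topoProg σ (40 * (I.m + 1) ^ 2) fun τ =>
      Numbering I (τ.wordArr 4) (τ.wordArr 5) (τ.wordArr 6) := by
  have hm1 := hW.m1
  have hn := hW.n
  have key : Runs W topoProg σ ((I.m * 7 + 3) + (1 + ((I.m * (20 * (I.m + 1) + 1) + 1) + (3 + 1))))
      fun τ => Numbering I (τ.wordArr 4) (τ.wordArr 5) (τ.wordArr 6) := by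
    refine Runs.cons ((countProg_spec hW hI h7).mono le_rfl ?_)
    intro σ₁ hf₁ hcount _
    have hI₁ := hI.of_frame hf₁ (by decide)
    have e8 := (hf₁.wordArr 8 (by decide)).trans h8
    refine Runs.cons (Runs.of_wp (p := .op _) (Q := TopoInv I I.m Finset.univ)
      ?_ |>.mono (by decide) ?_)
    · simp only [Prog.wp, Op.wp, hI₁.m]
      refine ⟨by omega, by simp, by simp, fun a => by simp [e8], by simpa using hcount, ?_, ?_, ?_⟩
      · intros; omega
      · intros; omega
      · intros; omega
    intro σ₂ hf₂ hinv _
    have hI₂ := hI₁.of_frame hf₂ (by decide)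
    refine Runs.cons ((Runs.loop (N := I.m) (t := 20 * (I.m + 1))
      (Inv := fun i τ => ∃ U, TopoInv I (I.m - i) U τ) ⟨_, hinv⟩ ?_ ?_).mono le_rfl ?_)
    · rintro i hi ρ hf ⟨U, h⟩
      have hI' := hI₂.of_frame hf (by decide)
      refine ⟨by simp [Test.Holds, h.pos, hI'.zero, hi], ?_⟩
      rw [show I.m - i = I.m - (i + 1) + 1 by omega] at h
      exact (placeBody_spec hW hI' hac h).mono le_rfl fun _ _ h _ => h
    · rintro ρ hf ⟨U, h⟩
      have hI' := hI₂.of_frame hf (by decide)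
      simp [Test.Holds, h.pos, hI'.zero]
    rintro σ₃ hf₃ ⟨U, h⟩ -
    rw [Nat.sub_self] at h
    have hI₃ := hI₂.of_frame hf₃ (by decide)
    refine Runs.cons ((Runs.of_wp (p := Prog.ops _) ?_).mono (t' := 3) (by decide)
      fun τ _ h _ => Runs.nil h)
    simp [Prog.ops, Prog.block, Prog.wp, Op.wp, hI₃.zero, hI₃.s, hI₃.t, hI₃.m1]
    refine ⟨fun p h1 h2 => ?_, fun p p' h1 h2 h3 h4 => h.inj p p' h1 h2 h3 h4, by simp, by simp,
      fun p p' h1 h2 h3 h4 => ?_⟩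
    · obtain ⟨a, -, h3, h4, h5, -⟩ := h.arc p h1 h2
      refine ⟨a, h3, ?_, ?_⟩
      · rw [Function.update_of_ne (by omega), h4]
      · rw [Function.update_of_ne (by omega), h5]
    · rw [Function.update_of_ne (by omega), Function.update_of_ne (by omega)]
      exact h.lt p p' h1 h2 h3 h4
  exact key.mono (by nlinarith) fun _ _ h => h

end LinSPP

namespace LinSPP

/-! ### The answer -/

/-- Check one coefficient. -/
def checkBody : Prog := .block [.op (.rload 1 0 51), .ite (.req 1 0) .skip (.op (.const 52 1)),
  .op (.add 51 51 5)]

/-- Check that all coefficients of sets of at least two arcs vanish. -/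
def checkProg : Prog := .block [Prog.ops [.load 50 3 8, .move 51 7, .const 52 0],
  .while (.lt 51 50) checkBody]

/-- Output the cost of one arc. -/
def outputBody : Prog := .block [Prog.ops [.add 54 53 5, .rload 1 0 54, .load 55 0 53],
  .ite (.eq 55 2) (.op (.radd 1 1 3)) .skip, Prog.ops [.rstore 1 53 1, .add 53 53 5]]

/-- Output the answer. -/
def outputProg : Prog := .block [Prog.ops [.const 53 0, .rload 3 0 6],
  .while (.lt 53 1) outputBody, .op (.sub 0 5 52)]

variable {I : Instance} {O T H : ℕ → ℕ} {W : ℕ} {σ : State}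

theorem checkProg_spec (hW : Wide I W) (hE : Env I O T H σ) :
    Runs W checkProg σ (10 * (I.numCoeffs + 1)) fun τ =>
      τ.word 52 = 0 ∧ (∀ r, I.m + 1 ≤ r → r < I.numCoeffs → σ.realArr 0 r = 0) ∨
      τ.word 52 = 1 ∧ ∃ r, I.m + 1 ≤ r ∧ r < I.numCoeffs ∧ σ.realArr 0 r ≠ 0 := by
  have hm1 := hW.m1
  have hc : I.numCoeffs ≤ W := hW.coeffs
  have hle : I.m + 1 ≤ I.numCoeffs := by
    have := sum_choose_mono I.m (show 2 ≤ I.d + 1 by have := I.two_le_d; omega)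
    simp [Finset.sum_range_succ] at this
    rw [Instance.numCoeffs, Finset.sum_range_succ]
    omega
  have hb := hE.base (I.d + 1) le_rfl
  rw [← Instance.numCoeffs] at hb
  have key : Runs W checkProg σ (4 + (((I.numCoeffs - (I.m + 1)) * (5 + 1) + 1) + 1)) fun τ =>
      τ.word 52 = 0 ∧ (∀ r, I.m + 1 ≤ r → r < I.numCoeffs → σ.realArr 0 r = 0) ∨
      τ.word 52 = 1 ∧ ∃ r, I.m + 1 ≤ r ∧ r < I.numCoeffs ∧ σ.realArr 0 r ≠ 0 := by
    refine Runs.cons (Runs.of_wp (p := Prog.ops _) (Q := fun ρ => ρ.word 50 = I.numCoeffs ∧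
      ρ.word 51 = I.m + 1 ∧ ρ.word 52 = 0) ?_ |>.mono (by decide) ?_)
    · simp [Prog.ops, Prog.block, Prog.wp, Op.wp, hE.d1, hE.m1, hb]
      omega
    rintro σ₁ hf₁ ⟨h50, h51, h52⟩ -
    have hE₁ := hE.of_frame hf₁ (by decide)
    have r0 := hf₁.realArr 0 (by decide)
    refine Runs.cons ((Runs.loop (N := I.numCoeffs - (I.m + 1)) (t := 5)
      (Inv := fun i τ => τ.word 51 = I.m + 1 + i ∧
      (τ.word 52 = 0 ∧ (∀ r, I.m + 1 ≤ r → r < I.m + 1 + i → σ.realArr 0 r = 0) ∨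
      τ.word 52 = 1 ∧ ∃ r, I.m + 1 ≤ r ∧ r < I.m + 1 + i ∧ σ.realArr 0 r ≠ 0))
      ?_ ?_ ?_).mono le_rfl ?_)
    · exact ⟨h51, .inl ⟨h52, fun r h1 h2 => by omega⟩⟩
    · rintro i hi ρ hf ⟨h1, h2⟩
      have hE' := hE₁.of_frame hf (by decide)
      have r0' := (hf.realArr 0 (by decide)).trans r0
      refine ⟨by simp [Test.Holds, h1, hf.word 50 (by decide), h50]; omega, ?_⟩
      refine (Runs.of_wp ?_).mono (by decide) fun τ _ h _ => h
      have zero : σ.realArr 0 (I.m + 1 + i) = 0 →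
          (ρ.word 52 = 0 ∧ (∀ r, I.m + 1 ≤ r → r < I.m + 1 + (i + 1) → σ.realArr 0 r = 0) ∨
          ρ.word 52 = 1 ∧ ∃ r, I.m + 1 ≤ r ∧ r < I.m + 1 + (i + 1) ∧ σ.realArr 0 r ≠ 0) := by
        intro h0
        rcases h2 with ⟨h3, h4⟩ | ⟨h3, r, h4, h5, h6⟩
        · refine .inl ⟨h3, fun r h5 h6 => ?_⟩
          by_cases h7 : r = I.m + 1 + i
          · rw [h7, h0]
          · exact h4 r h5 (by omega)
        · exact .inr ⟨h3, r, h4, by omega, h6⟩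
      simp only [checkBody, Prog.block, Prog.wp, Op.wp, Test.Holds, State.r_word, State.w_word,
        State.r_real, h1, r0', hE'.one, hE'.real]
      simp only [reduceIte, Nat.reduceEqDiff, zero_ne_one]
      refine ⟨fun h0 => ⟨by omega, by omega, zero h0⟩, fun h0 => ⟨by omega, by omega, by omega,
        .inr ⟨trivial, _, by omega, by omega, h0⟩⟩⟩
    · rintro ρ hf ⟨h1, -⟩
      simp [Test.Holds, h1, hf.word 50 (by decide), h50]
      omega
    rintro σ₂ - ⟨-, h⟩ -
    rw [show I.m + 1 + (I.numCoeffs - (I.m + 1)) = I.numCoeffs by omega] at h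
    exact Runs.nil h
  exact key.mono (by omega) fun _ _ h => h

/-- The single arc `a` has rank `a + 1` and the empty set rank `0`, so no positions are involved.
The constant coefficient is charged to the arcs that leave the source. -/
theorem outputProg_spec (hW : Wide I W) (hE : Env I O T H σ) :
    Runs W outputProg σ (20 * (I.m + 1)) fun τ => τ.word 0 = 1 - σ.word 52 ∧
      ∀ a : Fin I.m, τ.realArr 1 a =
        σ.realArr 0 (a + 1) + if I.tail a = I.s then σ.realArr 0 0 else 0 := by
  have hm1 := hW.m1
  have hn := hW.n
  have key : Runs W outputProg σ (3 + ((I.m * (10 + 1) + 1) + (1 + 1))) fun τ =>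
      τ.word 0 = 1 - σ.word 52 ∧ ∀ a : Fin I.m, τ.realArr 1 a =
        σ.realArr 0 (a + 1) + if I.tail a = I.s then σ.realArr 0 0 else 0 := by
    refine Runs.cons (Runs.of_wp (p := Prog.ops _) (Q := fun ρ => ρ.word 53 = 0 ∧
      ρ.real 3 = σ.realArr 0 0) ?_ |>.mono (by decide) ?_)
    · simp [Prog.ops, Prog.block, Prog.wp, Op.wp, hE.zero]
    rintro σ₁ hf₁ ⟨h53, hr3⟩ -
    have hE₁ := hE.of_frame hf₁ (by decide)
    have r0 := hf₁.realArr 0 (by decide)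
    refine Runs.cons ((Runs.loop (N := I.m) (t := 10)
      (Inv := fun i τ => τ.word 53 = i ∧ ∀ a : Fin I.m, (a : ℕ) < i → τ.realArr 1 a =
        σ.realArr 0 (a + 1) + if I.tail a = I.s then σ.realArr 0 0 else 0) ?_ ?_ ?_).mono
      le_rfl ?_)
    · exact ⟨h53, fun a h => absurd h (Nat.not_lt_zero _)⟩
    · rintro i hi ρ hf ⟨h1, h2⟩
      have hE' := hE₁.of_frame hf (by decide)
      have r0' := (hf.realArr 0 (by decide)).trans r0
      have r3 := (hf.real 3 (by decide)).trans hr3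
      refine ⟨by simp [Test.Holds, h1, hE'.m, hi], ?_⟩
      refine (Runs.of_wp ?_).mono (by decide) fun τ _ h _ => h
      have ht := hE'.tails ⟨i, hi⟩
      simp only at ht
      have htn := (I.tail ⟨i, hi⟩).2
      have upd : ∀ v, v = (σ.realArr 0 (i + 1) +
          if I.tail ⟨i, hi⟩ = I.s then σ.realArr 0 0 else 0) → ∀ a : Fin I.m, (a : ℕ) ≤ i →
          Function.update (ρ.realArr 1) i v a =
            σ.realArr 0 (a + 1) + if I.tail a = I.s then σ.realArr 0 0 else 0 := by
        rintro v rfl a ha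
        by_cases h3 : (a : ℕ) = i
        · obtain rfl : a = ⟨i, hi⟩ := Fin.ext h3
          simp
        · rw [Function.update_of_ne h3]
          exact h2 a (by omega)
      simp [outputBody, Prog.ops, Prog.block, Prog.wp, Op.wp, Test.Holds, h1, ht, hE'.one, r0',
        hE'.s, r3]
      refine ⟨by omega, by omega, fun h3 => ⟨by omega, upd _ ?_⟩, fun h3 => ⟨by omega, upd _ ?_⟩⟩
      · rw [if_pos (Fin.ext h3)]
      · rw [if_neg (fun h => h3 (congrArg _ h)), add_zero]
    · rintro ρ hf ⟨h1, -⟩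
      have hE' := hE₁.of_frame hf (by decide)
      simp [Test.Holds, h1, hE'.m]
    rintro σ₂ hf₂ ⟨-, h⟩ -
    have hE₂ := hE₁.of_frame hf₂ (by decide)
    have e52 : σ₂.word 52 = σ.word 52 := by
      rw [hf₂.word 52 (by decide), hf₁.word 52 (by decide)]
    refine Runs.cons ((Runs.of_wp (p := .op _) ?_).mono (t' := 1) (by decide)
      fun τ _ h _ => Runs.nil h)
    simp [Prog.wp, Op.wp, hE₂.one, e52]
    exact ⟨by omega, fun a => h a a.2⟩
  exact key.mono (by omega) fun _ _ h => h

/-! ### Paths and numbered walks -/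

theorem Instance.IsWalk.append : ∀ {u v w : Fin I.n} {P Q : List (Fin I.m)}, I.IsWalk u v P →
    I.IsWalk v w Q → I.IsWalk u w (P ++ Q)
  | _, _, _, [], _, h, h' => by cases h; exact h'
  | _, _, _, _ :: _, _, h, h' => ⟨h.1, h.2.append h'⟩

theorem Instance.IsWalk.exists_prefix {x : Fin I.n} : ∀ {u v : Fin I.n} {P : List (Fin I.m)},
    I.IsWalk u v P → x ∈ P.map I.head → ∃ Q, Q ≠ [] ∧ I.IsWalk u x Q
  | _, _, [], _, hx => by simp at hx
  | u, v, a :: P, h, hx => by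
    rw [List.map_cons, List.mem_cons] at hx
    rcases hx with rfl | hx
    · exact ⟨[a], by simp, h.1, rfl⟩
    · obtain ⟨Q, -, hQ⟩ := h.2.exists_prefix hx
      exact ⟨a :: Q, by simp, h.1, hQ⟩

/-- A repeated vertex would yield a nontrivial closed walk. Hence every `s`-`t`-walk is a simple
path, and costs may be compared on walks. -/
theorem Instance.IsWalk.nodup (hac : I.Acyclic) : ∀ {u v : Fin I.n} {P : List (Fin I.m)},
    I.IsWalk u v P → (u :: P.map I.head).Nodup
  | _, _, [], _ => by simp
  | u, v, a :: P, h => by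
    rw [List.nodup_cons]
    refine ⟨fun hu => ?_, h.2.nodup hac⟩
    obtain ⟨Q, h1, h2⟩ := Instance.IsWalk.exists_prefix (P := a :: P) h hu
    exact h1 (hac u Q h2)

/-- A numbering, together with the arcs as elements of `Fin m`. -/
structure Arcs (I : Instance) (O T H : ℕ → ℕ) (f : ℕ → Fin I.m) : Prop extends
    Numbering I O T H where
  val : ∀ p, 1 ≤ p → p ≤ I.m → O p = f p ∧ T p = I.tail (f p) ∧ H p = I.head (f p)

theorem Numbering.exists_arcs (hN : Numbering I O T H) (hm : 1 ≤ I.m) : ∃ f, Arcs I O T H f := by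
  have : ∀ p, ∃ a : Fin I.m, 1 ≤ p → p ≤ I.m → O p = a ∧ T p = I.tail a ∧ H p = I.head a := by
    intro p
    by_cases h : 1 ≤ p ∧ p ≤ I.m
    · obtain ⟨a, ha⟩ := hN.arc p h.1 h.2
      exact ⟨a, fun _ _ => ha⟩
    · exact ⟨⟨0, hm⟩, fun h1 h2 => absurd ⟨h1, h2⟩ h⟩
  choose f hf using this
  exact ⟨f, hN, hf⟩

variable {f : ℕ → Fin I.m}

theorem Arcs.injOn (hA : Arcs I O T H f) : Set.InjOn f (Finset.Icc 1 I.m) := by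
  intro p hp p' hp' h
  have h1 := hp
  have h2 := hp'
  simp only [Finset.coe_Icc, Set.mem_Icc] at hp hp'
  apply hA.toNumbering.injOn h1 h2
  rw [(hA.val p hp.1 hp.2).1, (hA.val p' hp'.1 hp'.2).1, h]

theorem Arcs.surj (hA : Arcs I O T H f) (a : Fin I.m) : ∃ p, 1 ≤ p ∧ p ≤ I.m ∧ f p = a := by
  have := Finset.surjOn_of_injOn_of_card_le (s := Finset.Icc 1 I.m) (t := Finset.univ) f
    (fun _ _ => by simp) hA.injOn (by simp)
  obtain ⟨p, hp, h⟩ := this (Finset.mem_coe.2 (Finset.mem_univ a))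
  simp only [Finset.coe_Icc, Set.mem_Icc] at hp
  exact ⟨p, hp.1, hp.2, h⟩

theorem Arcs.map_image (hA : Arcs I O T H f) {S : Finset ℕ} (hS : S ⊆ Finset.Icc 1 I.m) :
    (S.image f).map Fin.valEmbedding = S.image O := by
  rw [Finset.map_eq_image, Finset.image_image]
  apply Finset.image_congr
  intro p hp
  have := Finset.mem_Icc.1 (hS hp)
  exact (hA.val p this.1 this.2).1.symm

theorem LWalk.sub_Icc {m : ℕ} {P : Finset ℕ} (h : LWalk T H 0 (m + 1) P) :
    P ⊆ Finset.Icc 1 m := fun x hx => by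
  have := h.mem x hx
  exact Finset.mem_Icc.2 ⟨this.1, by omega⟩

/-- Consecutive arcs of a walk have increasing positions in a topological numbering. -/
theorem Arcs.exists_lwalk (hA : Arcs I O T H f) : ∀ {L : List (Fin I.m)} {u : Fin I.n} {lo : ℕ},
    lo ≤ I.m → H lo = u → I.IsWalk u I.t L →
    ∃ P, LWalk T H lo (I.m + 1) P ∧ L.toFinset = P.image f := by
  intro L
  induction L with
  | nil =>
    intro u lo h1 h2 h3
    cases h3
    exact ⟨∅, .nil (by omega) (by rw [h2, hA.sink]), by simp⟩
  | cons a L ih =>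
    rintro u lo h1 h2 ⟨h3, h4⟩
    obtain ⟨p, hp1, hpm, rfl⟩ := hA.surj a
    obtain ⟨-, hT, hH⟩ := hA.val p hp1 hpm
    obtain ⟨P, h5, h6⟩ := ih hpm hH h4
    have hlt : lo < p := by
      rcases Nat.eq_zero_or_pos lo with rfl | h0
      · exact hp1
      · exact hA.lt lo p h0 h1 hp1 hpm (by rw [h2, hT, h3])
    have := (LWalk.nil (T := T) (H := H) hlt (by rw [h2, hT, h3])).append h5
    refine ⟨_, this, ?_⟩
    rw [Finset.empty_union, Finset.image_insert, List.toFinset_cons, h6]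

theorem Arcs.exists_walk (hA : Arcs I O T H f) {lo hi : ℕ} {P : Finset ℕ}
    (h : LWalk T H lo hi P) : hi ≤ I.m + 1 → ∀ u v : Fin I.n, (u : ℕ) = H lo → (v : ℕ) = T hi →
    ∃ L, I.IsWalk u v L ∧ L.toFinset = P.image f := by
  induction h with
  | nil h1 h2 =>
    intro _ u v hu hv
    exact ⟨[], Fin.ext (by rw [hu, hv, h2]), by simp⟩
  | @snoc b hi R h0 h1 h2 ih =>
    intro hm u v hu hv
    obtain ⟨-, hT, hH⟩ := hA.val b (by have := h0.lt; omega) (by omega)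
    obtain ⟨L, h3, h4⟩ := ih (by omega) u (I.tail (f b)) hu hT.symm
    refine ⟨L ++ [f b], h3.append ⟨rfl, Fin.ext (by rw [← hH, h2, hv])⟩, ?_⟩
    rw [List.toFinset_append, h4, Finset.image_insert]
    ext; simp

theorem Arcs.exists_path (hA : Arcs I O T H f) (hac : I.Acyclic) {P : Finset ℕ}
    (h : LWalk T H 0 (I.m + 1) P) : ∃ L, I.IsPath L ∧ L.toFinset = P.image f := by
  obtain ⟨L, h1, h2⟩ := hA.exists_walk h le_rfl I.s I.t hA.source.symm hA.sink.symm
  exact ⟨L, ⟨h1, h1.nodup hac⟩, h2⟩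

theorem Arcs.reach (hA : Arcs I O T H f) (hcov : I.Covered) :
    ∀ b, 1 ≤ b → b ≤ I.m → Reach T H 0 b := by
  intro b h1 h2
  obtain ⟨L, h3, h4⟩ := hcov (f b)
  obtain ⟨P, h5, h6⟩ := hA.exists_lwalk (Nat.zero_le _) hA.source h3.1
  rw [← List.mem_toFinset, h6] at h4
  obtain ⟨p, hp, e⟩ := Finset.mem_image.1 h4
  obtain rfl : p = b := hA.injOn (by exact_mod_cast h5.sub_Icc hp)
    (by simp only [Finset.coe_Icc, Set.mem_Icc]; exact ⟨h1, h2⟩) e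
  exact ⟨_, (h5.splitAt hp).1⟩

theorem Arcs.linearCost_eq (hA : Arcs I O T H f) {P : Finset ℕ} (hP : P ⊆ Finset.Icc 1 I.m)
    {L : List (Fin I.m)} (hL : L.toFinset = P.image f) (c : Fin I.m → ℝ) :
    I.linearCost c L = ∑ p ∈ P, c (f p) := by
  rw [Instance.linearCost, hL, Finset.sum_image]
  exact hA.injOn.mono (by exact_mod_cast hP)

/-- The sum that defines an input cell has a single term because distinct arc sets have distinct
ranks. -/
theorem Arcs.coeff_init (hA : Arcs I O T H f) {S : Finset ℕ} (hS : S ⊆ Finset.Icc 1 I.m)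
    (hd : S.card ≤ I.d) : coeff I O (I.init.realArr 0) S =
      I.q ⟨S.image f, Finset.card_image_le.trans hd⟩ := by
  rw [coeff, if_pos ⟨hS, hd⟩]
  change (∑ B : {B : Finset (Fin I.m) // B.card ≤ I.d} with
    Instance.rank B.1 = setRank I.m (S.image O), I.q B) = _
  rw [Finset.sum_eq_single_of_mem ⟨S.image f, Finset.card_image_le.trans hd⟩]
  · simp only [Finset.mem_filter, Finset.mem_univ, true_and]
    rw [Instance.rank_eq, hA.map_image hS]
  · rintro ⟨B, hB⟩ h1 h2
    exfalso
    apply h2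
    simp only [Finset.mem_filter, Finset.mem_univ, true_and] at h1
    rw [Instance.rank_eq, ← hA.map_image hS] at h1
    have hsub : ∀ X : Finset (Fin I.m), X.map Fin.valEmbedding ⊆ Finset.range I.m := by
      intro X x hx
      obtain ⟨a, -, rfl⟩ := Finset.mem_map.1 hx
      exact Finset.mem_range.2 a.2
    exact Subtype.ext (Finset.map_injective _ (setRank_inj (hsub _) (hsub _) h1))

theorem Arcs.cost_eq (hA : Arcs I O T H f) {P : Finset ℕ} (hP : P ⊆ Finset.Icc 1 I.m)
    {L : List (Fin I.m)} (hL : L.toFinset = P.image f) :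
    I.cost L = walkCost (coeff I O (I.init.realArr 0)) ∅ P := by
  have hinj : Set.InjOn f P := hA.injOn.mono (by exact_mod_cast hP)
  rw [walkCost, Instance.cost]
  simp only [Finset.union_empty]
  rw [← Finset.sum_filter_of_ne (s := P.powerset) (p := fun S => S.card ≤ I.d)]
  · symm
    refine Finset.sum_bij (fun S hS => ⟨S.image f,
      Finset.card_image_le.trans (Finset.mem_filter.1 hS).2⟩) ?_ ?_ ?_ ?_
    · intro S hS
      simp only [Finset.mem_filter, Finset.mem_powerset, Finset.mem_univ, true_and] at hS ⊢
      rw [hL]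
      exact Finset.image_subset_image hS.1
    · intro S hS S' hS' e
      simp only [Finset.mem_filter, Finset.mem_powerset, Subtype.mk.injEq] at hS hS' e
      apply Finset.coe_injective
      exact (hinj.image_eq_image_iff (by exact_mod_cast hS.1) (by exact_mod_cast hS'.1)).1
        (by exact_mod_cast congrArg (fun X : Finset (Fin I.m) => (X : Set (Fin I.m))) e)
    · rintro ⟨B, hB⟩ h
      simp only [Finset.mem_filter, Finset.mem_univ, true_and, hL] at h
      obtain ⟨S, hS, rfl⟩ := Finset.subset_image_iff.1 h
      refine ⟨S, ?_, rfl⟩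
      rw [Finset.card_image_of_injOn (hinj.mono (by exact_mod_cast hS))] at hB
      simpa using ⟨by exact_mod_cast hS, hB⟩
    · intro S hS
      simp only [Finset.mem_filter, Finset.mem_powerset] at hS
      exact hA.coeff_init (hS.1.trans hP) hS.2
  · intro S hS h
    by_contra hd
    exact h (coeff_supp _ _ (by tauto))

/-- Every path has exactly one arc that leaves the source. -/
theorem Arcs.sum_source (hA : Arcs I O T H f) {P : Finset ℕ} (h : LWalk T H 0 (I.m + 1) P)
    (x : ℝ) : ∑ p ∈ P, (if I.tail (f p) = I.s then x else 0) = x := by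
  -- For the indicator of the source, scaled by `x`, each arc leaving `s` contributes `-x`, no arc
  -- of the path enters `s`, and the ends contribute `-x`.
  have ht := h.telescope fun v => if v = I.s then x else 0
  have hne : T (I.m + 1) ≠ I.s := by
    rw [hA.sink]; exact fun e => I.s_ne_t (Fin.ext e).symm
  rw [if_neg hne, if_pos hA.source, zero_sub] at ht
  rw [← neg_inj, ← ht, ← Finset.sum_neg_distrib]
  apply Finset.sum_congr rfl
  intro p hp
  have hpm := Finset.mem_Icc.1 (h.sub_Icc hp)
  -- An arc entering `s` would precede every arc leaving `s`, including the first arc of a walk that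
  -- goes up to and includes `p`.
  have hHne : H p ≠ I.s := by
    intro e
    rw [← hA.source] at e
    have hr : Reach T H 0 p := ⟨_, (h.splitAt hp).1⟩
    rcases reach_iff.1 hr with ⟨-, h1⟩ | ⟨c, h1, h2, h3, -⟩
    · exact lt_irrefl _ (hA.lt p p hpm.1 hpm.2 hpm.1 hpm.2 (e.trans h1))
    · have := hA.lt p c hpm.1 hpm.2 h1 (by omega) (e.trans h3)
      omega
  have hT : (T p = I.s) ↔ I.tail (f p) = I.s := by
    rw [(hA.val p hpm.1 hpm.2).2.1]
    exact ⟨fun e => Fin.ext e, fun e => congrArg _ e⟩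
  rw [if_neg hHne, zero_sub]
  simp only [hT]

theorem setRank_singleton (m x : ℕ) : setRank m {x} = x + 1 := by
  simp [setRank, colexRank, Finset.filter_singleton, add_comm]

/-- The empty set and the single arcs occupy exactly the ranks `0, …, m`, so the test for
linearizability scans the cells from `m + 1` on. -/
theorem Numbering.forall_coeff_iff (hN : Numbering I O T H) (a : ℕ → ℝ) :
    (∀ S : Finset ℕ, 2 ≤ S.card → coeff I O a S = 0) ↔
      ∀ r, I.m + 1 ≤ r → r < I.numCoeffs → a r = 0 := by
  have two : ∑ j ∈ Finset.range 2, I.m.choose j = I.m + 1 := by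
    simp [Finset.sum_range_succ, add_comm]
  constructor
  · intro h r h1 h2
    obtain ⟨B, hB, hc, rfl⟩ := exists_setRank h2
    have hB2 : 2 ≤ B.card := by
      by_contra hcon
      have := setRank_lt (d := 1) hB (by omega)
      rw [two] at this
      omega
    have hsurj := Finset.surjOn_of_injOn_of_card_le (s := Finset.Icc 1 I.m)
      (t := Finset.range I.m) O (fun p hp => by
        simp only [Finset.coe_Icc, Set.mem_Icc] at hp
        simpa using hN.arc_lt p hp.1 hp.2) hN.injOn (by simp)
    have hB' : B ⊆ (Finset.Icc 1 I.m).image O := fun x hx => by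
      obtain ⟨p, hp, e⟩ := hsurj (Finset.mem_coe.2 (hB hx))
      exact Finset.mem_image.2 ⟨p, by exact_mod_cast hp, e⟩
    obtain ⟨S, hS, rfl⟩ := Finset.subset_image_iff.1 hB'
    have hS' : S ⊆ Finset.Icc 1 I.m := by exact_mod_cast hS
    have hcard : (S.image O).card = S.card := Finset.card_image_of_injOn (hN.injOn.mono hS)
    rw [hcard] at hc hB2
    have := h S hB2
    rwa [coeff, if_pos ⟨hS', by omega⟩] at this
  · intro h S hS
    rw [coeff]
    split_ifs with h1
    · have hcard : (S.image O).card = S.card :=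
        Finset.card_image_of_injOn (hN.injOn.mono (by exact_mod_cast h1.1))
      apply h
      · have := sum_choose_mono I.m hS
        rw [two] at this
        rw [setRank, hcard]
        omega
      · exact setRank_lt (hN.image_sub h1.1) (by rw [hcard]; exact h1.2)
    · rfl

/-! ### The algorithm -/

/-- The algorithm for instances with at least one arc. -/
def mainProg : Prog := .block [Prog.ops [.const 5 1, .add 7 1 5, .add 8 4 5], binomProg, baseProg,
  topoProg, normalizeProg, checkProg, outputProg]

/-- The algorithm. -/
def linSPPProg : Prog := .ite (.eq 1 6) (.op (.const 0 1)) mainProg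

/-- `τ` holds a correct answer. -/
def Correct (I : Instance) (τ : State) : Prop :=
  (τ.word 0 = 1 ∧ I.IsLinearizing (fun a => τ.realArr 1 a)) ∨
    (τ.word 0 = 0 ∧ ¬ ∃ c, I.IsLinearizing c)

theorem Arcs.correct (hA : Arcs I O T H f) (hac : I.Acyclic) (hcov : I.Covered) {a : ℕ → ℝ}
    (hst : Stages T H I.m I.d (coeff I O (I.init.realArr 0)) (I.d + 1) (coeff I O a)) {τ : State}
    {b : ℕ} (hb : b = 0 ∧ (∀ r, I.m + 1 ≤ r → r < I.numCoeffs → a r = 0) ∨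
      b = 1 ∧ ∃ r, I.m + 1 ≤ r ∧ r < I.numCoeffs ∧ a r ≠ 0) (hτ : τ.word 0 = 1 - b)
    (hout : ∀ x : Fin I.m, τ.realArr 1 x = a (x + 1) + if I.tail x = I.s then a 0 else 0) :
    Correct I τ := by
  rcases hb with ⟨rfl, h0⟩ | ⟨rfl, r, h1, h2, h3⟩
  · left
    refine ⟨hτ, fun L hL => ?_⟩
    obtain ⟨P, hP, hLP⟩ := hA.exists_lwalk (Nat.zero_le _) hA.source hL.1
    have hsub := hP.sub_Icc
    rw [hA.cost_eq hsub hLP, hA.linearCost_eq hsub hLP,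
      hst.total_eq_linear ((hA.toNumbering.forall_coeff_iff a).2 h0) hP]
    simp only [hout]
    rw [Finset.sum_add_distrib, hA.sum_source hP, add_comm]
    congr 1
    · apply Finset.sum_congr rfl
      intro p hp
      have hpm := Finset.mem_Icc.1 (hsub hp)
      rw [coeff, if_pos ⟨by simpa using hsub hp, by have := I.two_le_d; simp; omega⟩,
        Finset.image_singleton, setRank_singleton, (hA.val p hpm.1 hpm.2).1]
  · right
    refine ⟨hτ, ?_⟩
    rintro ⟨c, hc⟩
    apply h3
    refine (hA.toNumbering.forall_coeff_iff a).1 (fun S hS => ?_) r h1 h2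
    refine hst.eq_zero (coeff_supp _) (c := fun p => c (f p)) (fun P hP => ?_) (hA.reach hcov) hS
    obtain ⟨L, hL, hLP⟩ := hA.exists_path hac hP
    rw [← hA.cost_eq hP.sub_Icc hLP, hc L hL, hA.linearCost_eq hP.sub_Icc hLP]

theorem numCoeffs_le (hm : 1 ≤ I.m) : I.numCoeffs ≤ (I.d + 1) * I.m ^ I.d := by
  rw [Instance.numCoeffs]
  refine (Finset.sum_le_card_nsmul _ _ (I.m ^ I.d) fun k hk => ?_).trans (by simp)
  exact (Nat.choose_le_pow _ _).trans
    (Nat.pow_le_pow_right hm (Nat.lt_succ_iff.1 (Finset.mem_range.1 hk)))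

theorem mainProg_spec (hW : Wide I W) (hac : I.Acyclic) (hcov : I.Covered) (hm : 1 ≤ I.m) :
    Runs W mainProg I.init (20000 * (I.d ^ 2 * I.m ^ I.d)) (Correct I) := by
  have hm1 := hW.m1
  have hd1 := hW.d1
  have key : Runs W mainProg I.init (4 + (40 * ((I.m + 1) * (I.d + 1)) + (20 * (I.d + 1) +
      (40 * (I.m + 1) ^ 2 + (10000 * I.d ^ 2 * I.m ^ I.d + (10 * (I.numCoeffs + 1) +
      (20 * (I.m + 1) + 1))))))) (Correct I) := by
    refine Runs.cons (Runs.of_wp (p := Prog.ops _) (Q := Input I) ?_ |>.mono (by decide) ?_)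
    · simp [Prog.ops, Prog.block, Prog.wp, Op.wp, Instance.init]
      refine ⟨by omega, by omega, by omega, ?_⟩
      constructor <;> simp
    intro σ₁ hf₁ hI₁ _
    have r₁ := hf₁.realArr 0 (by decide)
    refine Runs.cons ((binomProg_spec hW hI₁).mono le_rfl ?_)
    intro σ₂ hf₂ hbin _
    have hI₂ := hI₁.of_frame hf₂ (by decide)
    have r₂ := (hf₂.realArr 0 (by decide)).trans r₁
    refine Runs.cons ((baseProg_spec hW hI₂ hbin).mono le_rfl ?_)
    intro σ₃ hf₃ hbase _
    have hI₃ := hI₂.of_frame hf₃ (by decide)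
    have r₃ := (hf₃.realArr 0 (by decide)).trans r₂
    have e : ∀ x, x ∉ [2, 3] → σ₃.wordArr x = I.init.wordArr x := fun x hx => by
      have h2 : x ≠ 2 := fun h => hx (by simp [h])
      have h3 : x ≠ 3 := fun h => hx (by simp [h])
      rw [hf₃.wordArr x, hf₂.wordArr x, hf₁.wordArr x]
      · simp [Prog.ops, Prog.block, Prog.mods]
      · simpa [binomProg, binomRow, binomCell, Prog.ops, Prog.block, Prog.mods] using h2
      · simpa [baseProg, baseBody, Prog.ops, Prog.block, Prog.mods] using h3
    refine Runs.cons ((topoProg_spec hW hI₃ hac (e 7 (by simp)) (e 8 (by simp))).mono le_rfl ?_)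
    intro σ₄ hf₄ hN _
    have hI₄ := hI₃.of_frame hf₄ (by decide)
    have r₄ := (hf₄.realArr 0 (by decide)).trans r₃
    have hE : Env I (σ₄.wordArr 4) (σ₄.wordArr 5) (σ₄.wordArr 6) σ₄ := by
      refine ⟨hI₄.m, hI₄.s, hI₄.d, hI₄.one, hI₄.zero, hI₄.m1, hI₄.d1, hI₄.tails, ?_, ?_, rfl, rfl,
        rfl, hI₄.real⟩
      · rw [hf₄.wordArr 2 (by decide), hf₃.wordArr 2 (by decide)]
        exact hbin
      · rw [hf₄.wordArr 3 (by decide)]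
        exact hbase
    obtain ⟨f, hA⟩ := hN.exists_arcs hm
    refine Runs.cons ((normalizeProg_spec hW hN hE hm).mono le_rfl ?_)
    intro σ₅ hf₅ hst _
    rw [r₄] at hst
    have hE₅ := hE.of_frame hf₅ (by decide)
    refine Runs.cons ((checkProg_spec hW hE₅).mono le_rfl ?_)
    intro σ₆ hf₆ hb _
    have hE₆ := hE₅.of_frame hf₆ (by decide)
    refine Runs.cons ((outputProg_spec hW hE₆).mono le_rfl ?_)
    rintro τ - ⟨h0, hout⟩ -
    rw [hf₆.realArr 0 (by decide)] at hout
    exact Runs.nil (hA.correct hac hcov hst hb h0 hout)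
  refine key.mono ?_ fun _ _ h => h
  have hd := I.two_le_d
  have hN := numCoeffs_le hm
  have h1 : 1 ≤ I.m ^ I.d := Nat.one_le_pow _ _ hm
  have h2 : I.m ^ 2 ≤ I.m ^ I.d := Nat.pow_le_pow_right hm hd
  have h3 : I.m ≤ I.m ^ 2 := by nlinarith
  set M := I.m ^ I.d
  have h4 : I.m * I.d ≤ M * I.d := Nat.mul_le_mul_right _ (h3.trans h2)
  have h5 : 2 * (I.d * M) ≤ I.d * (I.d * M) := Nat.mul_le_mul_right _ hd
  have h6 : I.d ≤ I.d * M := Nat.le_mul_of_pos_right _ h1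
  have h7 : 2 * M ≤ I.d * M := Nat.mul_le_mul_right _ hd
  have h8 : 10 * (I.numCoeffs + 1) ≤ 10 * (I.d * M) + 10 * M + 10 := by
    rw [Nat.succ_mul] at hN; omega
  have h9 : (I.m + 1) * (I.d + 1) = I.m * I.d + I.m + I.d + 1 := by ring
  have h10 : (I.m + 1) ^ 2 = I.m ^ 2 + 2 * I.m + 1 := by ring
  have h11 : 10000 * I.d ^ 2 * M = 10000 * (I.d * (I.d * M)) := by ring
  have h12 : I.d ^ 2 * M = I.d * (I.d * M) := by ring
  have h13 : M * I.d = I.d * M := Nat.mul_comm _ _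
  rw [h9, h10, h11, h12]
  omega

/-- The exponent `2` accounts for the addresses in the table of `(m + 1) (d + 1)` binomial
coefficients. The additive constants are covered because `s ≠ t` forces two vertices. -/
theorem wide_size (I : Instance) : Wide I (I.size ^ 2) := by
  have hd := I.two_le_d
  have hn : 2 ≤ I.n := by
    by_contra hcon
    have := I.s.2
    have := I.t.2
    exact I.s_ne_t (Fin.ext (by omega))
  have h1 : I.size ≤ I.size ^ 2 := Nat.le_self_pow (by norm_num) _
  have e : I.size = I.n + I.m + I.d + I.numCoeffs := rfl
  have ec : I.numCoeffs = ∑ j ∈ Finset.range (I.d + 1), I.m.choose j := rfl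
  refine ⟨by omega, by omega, by omega, ?_, by omega⟩
  rw [pow_two]
  exact Nat.mul_le_mul (by omega) (by omega)

theorem linSPPProg_solves (I : Instance) (hac : I.Acyclic) (hcov : I.Covered) :
    SolvesWithin linSPPProg 2 I (20001 * (I.d ^ 2 * I.m ^ I.d + 1)) := by
  have hW := wide_size I
  have : Runs (I.size ^ 2) linSPPProg I.init (20000 * (I.d ^ 2 * I.m ^ I.d) + 1 + 1)
      (Correct I) := by
    refine Runs.ite (fun h => ?_) fun h => ?_
    -- Without arcs there is no path from `s` to `t ≠ s`, so any cost function is linearizing.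
    · have hm : I.m = 0 := h
      refine (Runs.of_wp ?_).mono (t' := 20000 * (I.d ^ 2 * I.m ^ I.d) + 1)
        (by simp [Prog.steps]) fun τ _ h => h
      refine ⟨by have := hW.m1; omega, .inl ⟨by simp, fun P hP => ?_⟩⟩
      obtain _ | ⟨a, P⟩ := P
      · exact absurd hP.1 I.s_ne_t
      · exact absurd a.2 (by omega)
    · have hm : I.m ≠ 0 := h
      exact (mainProg_spec hW hac hcov (by omega)).mono (by omega) fun _ _ h => h
  obtain ⟨k, τ, h1, h2, h3⟩ := this
  exact ⟨k, τ, h1, by omega, h3⟩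

theorem SolvesWithin.mono {p : Prog} {K T T' : ℕ} (h : SolvesWithin p K I T) (hT : T ≤ T') :
    SolvesWithin p K I T' := by
  obtain ⟨k, τ, h1, h2, h3⟩ := h
  exact ⟨k, τ, h1, h2.trans hT, h3⟩

/-- For `m ≥ d` use `m ≤ d (m - d + 1)` and `(m - d + 1)^d ≤ d! C(m,d)`. For `m < d` the power is at
most `d^d`, and there is at least one coefficient. -/
theorem pow_le_mul_numCoeffs (I : Instance) :
    I.m ^ I.d ≤ I.d ^ I.d * I.d.factorial * I.numCoeffs := by
  have hd := I.two_le_d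
  have hc : ∀ k ≤ I.d, I.m.choose k ≤ I.numCoeffs := fun k hk => choose_le_sum le_rfl hk
  by_cases hm : I.d ≤ I.m
  · have h1 : I.m ≤ I.d * (I.m + 1 - I.d) := by
      obtain ⟨x, hx⟩ := Nat.exists_eq_add_of_le hm
      rw [hx, show I.d + x + 1 - I.d = x + 1 by omega]
      nlinarith
    have h2 : (I.m + 1 - I.d) ^ I.d ≤ I.d.factorial * I.m.choose I.d := by
      rw [← Nat.descFactorial_eq_factorial_mul_choose]
      exact Nat.pow_sub_le_descFactorial _ _
    calc I.m ^ I.d ≤ (I.d * (I.m + 1 - I.d)) ^ I.d := Nat.pow_le_pow_left h1 _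
      _ = I.d ^ I.d * (I.m + 1 - I.d) ^ I.d := mul_pow _ _ _
      _ ≤ I.d ^ I.d * (I.d.factorial * I.m.choose I.d) := Nat.mul_le_mul_left _ h2
      _ ≤ I.d ^ I.d * (I.d.factorial * I.numCoeffs) :=
        Nat.mul_le_mul_left _ (Nat.mul_le_mul_left _ (hc _ le_rfl))
      _ = _ := by ring
  · have h1 : 1 ≤ I.numCoeffs := by simpa using hc 0 (Nat.zero_le _)
    calc I.m ^ I.d ≤ I.d ^ I.d := Nat.pow_le_pow_left (by omega) _
      _ ≤ I.d ^ I.d * (I.d.factorial * I.numCoeffs) :=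
        Nat.le_mul_of_pos_right _ (Nat.mul_pos I.d.factorial_pos h1)
      _ = _ := by ring

end LinSPP

theorem mainTheorem2 :
    ∃ (p : LinSPP.Prog) (K : ℕ),
      (∃ C : ℕ, ∀ I : LinSPP.Instance, I.Acyclic → I.Covered →
        LinSPP.SolvesWithin p K I (C * (I.d ^ 2 * I.m ^ I.d + 1))) ∧
      (∀ d : ℕ, ∃ C : ℕ, ∀ I : LinSPP.Instance, I.Acyclic → I.Covered → I.d = d →
        LinSPP.SolvesWithin p K I (C * I.numCoeffs)) ∧
      (∃ C : ℕ, ∀ I : LinSPP.Instance, I.Acyclic → I.Covered → I.d = 2 →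
        LinSPP.SolvesWithin p K I (C * (I.m ^ 2 + 1))) := by
  refine ⟨LinSPP.linSPPProg, 2, ⟨20001, LinSPP.linSPPProg_solves⟩,
    -- The first constant combines `pow_le_mul_numCoeffs` with `1 ≤ numCoeffs`; the second is `4 *
    -- 20001`, where `4 = d ^ 2`.
    fun d => ⟨20001 * (d ^ 2 * (d ^ d * d.factorial) + 1), ?_⟩, ⟨80004, ?_⟩⟩
  · rintro I hac hcov rfl
    refine (LinSPP.linSPPProg_solves I hac hcov).mono ?_
    have h1 := LinSPP.pow_le_mul_numCoeffs I
    have h2 : 1 ≤ I.numCoeffs := by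
      have : I.m.choose 0 ≤ I.numCoeffs := LinSPP.choose_le_sum le_rfl (Nat.zero_le _)
      simpa using this
    have h3 := Nat.mul_le_mul_left (I.d ^ 2) h1
    rw [Nat.mul_assoc]
    apply Nat.mul_le_mul_left
    rw [Nat.add_mul, Nat.one_mul, Nat.mul_assoc]
    exact Nat.add_le_add h3 h2
  · rintro I hac hcov hd
    refine (LinSPP.linSPPProg_solves I hac hcov).mono ?_
    rw [hd]
    omega
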